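/- **Notation.** Let $E=\mathbb R\times\mathbb R^2$ (circulation $m$, position $x$), $\langle x\rangle=(1+|x|^2)^{1/2}$, and let $\mathbf P(\cdot)$ denote Borel probability measures with the weak topology. For a probability measure $F$ on $(\mathbb R^2)^N$ with a density put $$H(F)=\frac1N\int F\log F\,dX,\qquad I(F)=\frac1N\int\frac{|\nabla F|^2}{F}\,dX$$ ($\nabla$ the weak gradient, $I(F)=+\infty$ if the density has no locally integrable weak gradient), and $H(F)=I(F)=+\infty$ if $F$ has no density. For $G\in\mathbf P(E^N)$ disintegrate $G(dM,dX)=R(dM)F^M(dX)$ with $R\in\mathbf P(\mathbb R^N)$, $F^M\in\mathbf P((\mathbb R^2)^N)$, and put $$\tilde M_k(G)=\int\frac1N\sum_{i=1}^N\langle x_i\rangle^k\,G(dM,dX),\qquad \tilde H(G)=\int H(F^M)\,R(dM),\qquad \tilde I(G)=\int I(F^M)\,R(dM)$$ (if $\tilde M_k(G)<\infty$ for some $k>0$, then $\tilde H(G)$ is well defined in $\mathbb R\cup\{+\infty\}$). **Theorem.** Let $k>0$, $A>0$ and let $r\in\mathbf P(\mathbb R)$ be supported in $[-A,A]$. For each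 $N\ge2$ let $G^N\in\mathbf P(E^N)$ be symmetric, with circulation marginal $\int_{(\mathbb R^2)^N}G^N(dm_1,dx_1,\dots,dm_N,dx_N)=r^{\otimes N}(dm_1,\dots,dm_N)$. Let $G^N_j$ be the $j$-th marginal of $G^N$ and assume $\sup_{N\ge2}\tilde M_k(G^N_1)<\infty$. Assume that there is a compatible sequence $(\pi_j)_{j\ge1}$ of symmetric probability measures $\pi_j$ on $E^j$ (the $i$-th marginal of $\pi_j$ is $\pi_i$ for $1\le i\le j$) such that $G^N_j\to\pi_j$ weakly as $N\to\infty$, for every $j\ge1$. Let $\pi\in\mathbf P(\mathbf P(E))$ be the de Finetti measure of the sequence $(\pi_j)$, characterized by $\pi_j=\int_{\mathbf P(E)}g^{\otimes j}\,\pi(dg)$ for all $j\ge1$. Then $\int_{\mathbf P(E)}\tilde M_k(g)\,\pi(dg)<\infty$, $$\int_{\mathbf P(E)}\tilde H(g)\,\pi(dg)=\sup_{j\ge1}\tilde H(\pi_j)\le\liminf_{N\to\infty}\tilde H(G^N),$$ and $$\int_{\mathbf P(E)}\tilde I(g)\,\pi(dg)=\sup_{j\ge1}\tilde I(\pi_j)\le\liminf_{N\to\infty}\tilde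 I(G^N).$$ -/

import Mathlib

open MeasureTheory ProbabilityTheory Filter Topology
open scoped ENNReal

noncomputable section

namespace Vortex

/-- The plane of positions, with its Euclidean norm and Lebesgue measure. -/
abbrev Plane : Type := EuclideanSpace ℝ (Fin 2)

/-- State of one vortex: circulation and position. -/
abbrev State : Type := ℝ × Plane

/-- Configurations of `N` vortices. -/
abbrev Config (N : ℕ) : Type := Fin N → State

/-- The vector `M` of the circulations of a configuration. -/
def circ {N : ℕ} (Y : Config N) : Fin N → ℝ := fun i => (Y i).1

/-- The vector `X` of the positions of a configuration. -/
def pos {N : ℕ} (Y : Config N) : Fin N → Plane := fun i => (Y i).2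

/-- The restriction of a configuration to its first `j` vortices. -/
def firstCoords {j N : ℕ} (h : j ≤ N) (Y : Config N) : Config j :=
  fun i => Y (Fin.castLE h i)

theorem measurable_firstCoords {j N : ℕ} (h : j ≤ N) :
    Measurable (firstCoords h : Config N → Config j) :=
  measurable_pi_lambda _ fun i => measurable_pi_apply (Fin.castLE h i)

/-- The `j`-th marginal of a probability measure on `Config N`. -/
def marginal {N : ℕ} (j : ℕ) (h : j ≤ N) (G : ProbabilityMeasure (Config N)) :
    ProbabilityMeasure (Config j) :=
  G.map (f := firstCoords h) (measurable_firstCoords h).aemeasurable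

/-- Symmetric (exchangeable) laws. -/
def IsSymmetric {N : ℕ} (G : ProbabilityMeasure (Config N)) : Prop :=
  ∀ σ : Equiv.Perm (Fin N),
    (G : Measure (Config N)).map (fun Y => fun i => Y (σ i)) = (G : Measure (Config N))

/-- The law `R` of the circulations under `G`. -/
def circLaw {N : ℕ} (G : ProbabilityMeasure (Config N)) : Measure (Fin N → ℝ) :=
  (G : Measure (Config N)).map circ

/-- The conditional law `F^M` of the positions given the circulations `M`, that is
the disintegration `G(dM,dX) = R(dM) F^M(dX)`; it is unique for `R`-almost every `M`. -/
def condPos {N : ℕ} (G : ProbabilityMeasure (Config N)) : Kernel (Fin N → ℝ) (Fin N → Plane) :=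
  condDistrib pos circ (G : Measure (Config N))

/-- The symmetric laws whose circulations are i.i.d. with law `r`. -/
def IIDCirc (r : ProbabilityMeasure ℝ) {N : ℕ} (G : ProbabilityMeasure (Config N)) : Prop :=
  IsSymmetric G ∧ circLaw G = Measure.pi (fun _ : Fin N => (r : Measure ℝ))

/-- The tensor power `g^{⊗ j}`. -/
def tensorPower (g : ProbabilityMeasure State) (j : ℕ) : ProbabilityMeasure (Config j) :=
  ProbabilityMeasure.pi (fun _ : Fin j => g)

/-- The Japanese bracket `⟨x⟩ = (1 + |x|²)^{1/2}`. -/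
def bracket (x : Plane) : ℝ := Real.sqrt (1 + ‖x‖ ^ 2)

/-- The partial moment `∫ N⁻¹ ∑ᵢ ⟨xᵢ⟩^k G(dM,dX)`. -/
def partialMoment (k : ℝ) {N : ℕ} (G : ProbabilityMeasure (Config N)) : ℝ≥0∞ :=
  ∫⁻ Y, ENNReal.ofReal ((N : ℝ)⁻¹ * ∑ i, bracket (pos Y i) ^ k) ∂(G : Measure (Config N))

/-- The integral of an extended-real function, as the integral of its positive part minus that of
its negative part. It is the usual integral with values in `ℝ ∪ {+∞}` as soon as the integral of the
negative part is finite. -/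
def extIntegral {α : Type*} [MeasurableSpace α] (μ : Measure α) (φ : α → EReal) : EReal :=
  ((∫⁻ a, (φ a).toENNReal ∂μ : ℝ≥0∞) : EReal) - ((∫⁻ a, (-φ a).toENNReal ∂μ : ℝ≥0∞) : EReal)

/-- The density of `F` with respect to the Lebesgue measure, as a real function. -/
def density {N : ℕ} (F : Measure (Fin N → Plane)) (X : Fin N → Plane) : ℝ :=
  (F.rnDeriv volume X).toReal

open Classical in
/-- The normalized Boltzmann entropy `H(F) = N⁻¹ ∫ F log F`, and `+∞` if `F` has no density. -/
def entropy {N : ℕ} (F : Measure (Fin N → Plane)) : EReal :=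
  if F ≪ volume then
    (((N : ℝ)⁻¹ : ℝ) : EReal) *
      extIntegral volume (fun X => ((density F X * Real.log (density F X) : ℝ) : EReal))
  else ⊤

/-- `D = (D₁, …, D_N)` is the weak gradient of `f` on `(ℝ²)^N`, where `Dᵢ` is the gradient in the
`i`-th position: `∫ f ∂_v φ = - ∫ (∑ᵢ Dᵢ · vᵢ) φ` for all test functions `φ` and directions `v`. -/
def IsWeakGradient {N : ℕ} (f : (Fin N → Plane) → ℝ) (D : (Fin N → Plane) → Fin N → Plane) :
    Prop :=
  LocallyIntegrable D volume ∧
  ∀ φ : (Fin N → Plane) → ℝ, ContDiff ℝ ((⊤ : ℕ∞) : WithTop ℕ∞) φ → HasCompactSupport φ →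
    ∀ v : Fin N → Plane,
      ∫ X, f X * fderiv ℝ φ X v = - ∫ X, (∑ i, inner ℝ (D X i) (v i)) * φ X

open Classical in
/-- The normalized Fisher information `I(F) = N⁻¹ ∫ |∇F|² / F`. It is `+∞` if `F` has no density or
if the density has no locally integrable weak gradient (the infimum is then over the empty set).
The weak gradient is unique almost everywhere, so the infimum is over equal values, and the
integrand is `0` where the density and its gradient both vanish. -/
def fisher {N : ℕ} (F : Measure (Fin N → Plane)) : ℝ≥0∞ :=
  if F ≪ volume then
    ⨅ (D : (Fin N → Plane) → Fin N → Plane) (_ : IsWeakGradient (density F) D),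
      (N : ℝ≥0∞)⁻¹ * ∫⁻ X, ENNReal.ofReal (∑ i, ‖D X i‖ ^ 2) / F.rnDeriv volume X
  else ⊤

/-- The partial entropy `∫ H(F^M) R(dM)`. -/
def partialEntropy {N : ℕ} (G : ProbabilityMeasure (Config N)) : EReal :=
  extIntegral (circLaw G) (fun M => entropy (condPos G M))

/-- The partial Fisher information `∫ I(F^M) R(dM)`. -/
def partialFisher {N : ℕ} (G : ProbabilityMeasure (Config N)) : ℝ≥0∞ :=
  ∫⁻ M, fisher (condPos G M) ∂(circLaw G)

/-- A compatible sequence of symmetric laws on the spaces `Config j`, `j ≥ 1`. -/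
def IsCompatible (P : (j : ℕ) → ProbabilityMeasure (Config j)) : Prop :=
  (∀ j, 1 ≤ j → IsSymmetric (P j)) ∧
  ∀ i j, 1 ≤ i → ∀ h : i ≤ j, marginal i h (P j) = P i

/-- `π` is the mixing (de Finetti) measure of the sequence `P`: `P j = ∫ g^{⊗ j} π(dg)` for all
`j ≥ 1`. -/
def IsMixingMeasure (π : ProbabilityMeasure (ProbabilityMeasure State))
    (P : (j : ℕ) → ProbabilityMeasure (Config j)) : Prop :=
  ∀ j, 1 ≤ j → ∀ s : Set (Config j), MeasurableSet s →
    (P j : Measure (Config j)) s =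
      ∫⁻ g, (tensorPower g j : Measure (Config j)) s
        ∂(π : Measure (ProbabilityMeasure State))

end Vortex

end

/-!
# Entropy and Fisher information of mixtures

Both functionals are handled by one argument, contained in `MeanFieldDual`. A normalized functional
`K` of laws of `j` vortices is the supremum of the integrals `j⁻¹ ∫ ψ dG` over a class `T j` of
bounded continuous integrands `ψ`. For the relative entropy with respect to independent vortices
these are the functions `φ - log ∫ e^φ` of the Donsker-Varadhan formula. For the partial Fisher
information they are `-2 div Φ - |Φ|²`, for smooth compactly supported vector fields `Φ` on the
configurations, the divergence being taken in the positions.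

* *Mixtures.* The integral of `ψ ∈ T j` against `g^{⊗ j}` is at most `j K(g)`, so `K` of a mixture
  is at most the mean of `K(g)`. Conversely `K(g)` is the supremum of countably many integrals, so
  its mean is the limit of the means of `maxᵢ ∫ ψᵢ dg` over finite families in `T 1`. Convexity of
  the maximum gives `maxᵢ ∫ ψᵢ dg ≤ j⁻¹ ∫ maxᵢ ∑ₗ ψᵢ(Yₗ) dg^{⊗ j}`, and the maximum of finitely many
  sums is, up to an error of order `j^{1/2}`, an admissible integrand for `j` vortices: for the
  entropy through `log ∑ᵢ exp ∑ₗ ψᵢ(Yₗ)`, for the Fisher information through the field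
  `∑ᵢ wᵢ Φᵢ(Yₗ)` with Gibbs weights `wᵢ` of inverse temperature `j^{-1/2}` (`partialFisher_max`).
  No law of large numbers is needed.
* *Semicontinuity.* A symmetric law on `N` vortices contains `N / j` disjoint blocks of length `j`,
  and the sum of `ψ` over the blocks is an admissible integrand for `N` vortices. Hence
  `K(P j) ≤ liminf K(G N)` by weak convergence of the marginals.

The partial entropy is the relative entropy with respect to `r ⊗ γ`, where `γ` has the density
`Z⁻¹ exp(-⟨x⟩^{k/2})`, minus `∫ ⟨x⟩^{k/2} dG_1 + log Z`
(`partialEntropy_eq_relEntropy_sub`). The bound on the `k`-th moment makes this last term finite and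
upper semicontinuous. The components of the mixture have circulation law `r` almost surely, because
the circulations of the limit laws are independent (`IsMixingMeasure.ae_map_fst_eq`).

For the Fisher information the duality itself has to be proved. If the supremum is finite, then the
divergence is a bounded functional for the norm of `L²(G)`, and the Riesz theorem gives a square
integrable logarithmic gradient `h` of `G` in the positions (`exists_logGradient`). For almost every
vector of circulations it is also a logarithmic gradient of the conditional law of the positions
(`ae_isLogGradient`). Translations then act continuously in total variation on this law, so that it
has a density `f`, and `f h` is the weak gradient of `f` (`IsLogGradient.fisher_le`).
-/

namespace Vortex
open InformationTheory

/-! ### Mixtures, marginals and blocks -/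

/-- A family of bounded continuous functions has a countable subfamily from which every member is a
pointwise limit of uniformly bounded sequences. -/
theorem exists_countable_bounded_approx {X V : Type*} [TopologicalSpace X]
    [SecondCountableTopology X] [LocallyCompactSpace X] [NormedAddCommGroup V]
    [SecondCountableTopology V] (S : Set (X → V))
    (hS : ∀ f ∈ S, Continuous f ∧ ∃ C : ℝ, ∀ x, ‖f x‖ ≤ C) :
    ∃ D : Set (X → V), D.Countable ∧ D ⊆ S ∧ ∀ f ∈ S, ∃ (C : ℝ) (u : ℕ → X → V),
      (∀ n, u n ∈ D) ∧ (∀ n x, ‖u n x‖ ≤ C) ∧ ∀ x, Tendsto (fun n => u n x) atTop (𝓝 (f x)) := by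
  let T : ℕ → Set C(X, V) := fun n => {f | ⇑f ∈ S ∧ ∀ x, ‖f x‖ ≤ n}
  have hd : ∀ n, ∃ c : Set C(X, V), c.Countable ∧ c ⊆ T n ∧ T n ⊆ closure c := fun n => by
    obtain ⟨c, hc, hd⟩ := TopologicalSpace.exists_countable_dense (T n)
    exact ⟨Subtype.val '' c, hc.image _, by rintro _ ⟨x, _, rfl⟩; exact x.2,
      fun x hx => image_closure_subset_closure_image continuous_subtype_val
        ⟨⟨x, hx⟩, hd _, rfl⟩⟩
  choose c hc hcT hTc using hd
  refine ⟨⋃ n, (fun f : C(X, V) => (f : X → V)) '' c n,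
    Set.countable_iUnion fun n => (hc n).image _, ?_, ?_⟩
  · intro F hF
    obtain ⟨n, f, hf, rfl⟩ := Set.mem_iUnion.1 hF
    exact (hcT n hf).1
  · intro f hf
    obtain ⟨hfc, C, hC⟩ := hS f hf
    obtain ⟨n, hn⟩ := exists_nat_ge C
    have hfT : (⟨f, hfc⟩ : C(X, V)) ∈ T n := ⟨hf, fun x => (hC x).trans hn⟩
    obtain ⟨u, hu, hlim⟩ := mem_closure_iff_seq_limit.1 (hTc n hfT)
    refine ⟨n, fun m => u m, fun m => Set.mem_iUnion.2 ⟨n, u m, hu m, rfl⟩,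
      fun m x => (hcT n (hu m)).2 x, fun x => ?_⟩
    exact ((continuous_eval_const x : Continuous fun f : C(X, V) => f x).tendsto _).comp hlim

theorem integral_tendsto_of_bounded {X : Type*} [MeasurableSpace X] [TopologicalSpace X]
    [OpensMeasurableSpace X]
    (μ : Measure X) [IsFiniteMeasure μ] {u : ℕ → X → ℝ} {f : X → ℝ} {C : ℝ}
    (hu : ∀ n, Continuous (u n)) (hb : ∀ n x, ‖u n x‖ ≤ C)
    (hlim : ∀ x, Tendsto (fun n => u n x) atTop (𝓝 (f x))) :
    Tendsto (fun n => ∫ x, u n x ∂μ) atTop (𝓝 (∫ x, f x ∂μ)) :=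
  tendsto_integral_of_dominated_convergence (fun _ => C)
    (fun n => (hu n).measurable.aestronglyMeasurable) (integrable_const C)
    (fun n => Eventually.of_forall (hb n)) (Eventually.of_forall hlim)

theorem integrable_of_continuous_bounded {X : Type*} [MeasurableSpace X] [TopologicalSpace X]
    [OpensMeasurableSpace X] (μ : Measure X) [IsFiniteMeasure μ] {f : X → ℝ}
    (hf : Continuous f) (hb : ∃ C : ℝ, ∀ x, ‖f x‖ ≤ C) : Integrable f μ := by
  obtain ⟨C, hC⟩ := hb
  exact Integrable.of_bound hf.measurable.aestronglyMeasurable C (Eventually.of_forall hC)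

theorem ofReal_integral_le_lintegral_ofReal {α : Type*} [MeasurableSpace α] (μ : Measure α)
    (f : α → ℝ) : ENNReal.ofReal (∫ a, f a ∂μ) ≤ ∫⁻ a, ENNReal.ofReal (f a) ∂μ := by
  by_cases hf : Integrable f μ
  · rw [integral_eq_lintegral_pos_part_sub_lintegral_neg_part hf]
    refine (ENNReal.ofReal_le_ofReal (sub_le_self _ ENNReal.toReal_nonneg)).trans ?_
    exact ENNReal.ofReal_toReal_le
  · simp [integral_undef hf]

theorem measurable_tensorPower (j : ℕ) :
    Measurable (fun g : ProbabilityMeasure State => (tensorPower g j : Measure (Config j))) := by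
  refine Measurable.measure_of_isPiSystem_of_isProbabilityMeasure
    (generateFrom_pi (α := fun _ : Fin j => State)).symm isPiSystem_pi ?_
  rintro _ ⟨s, hs, rfl⟩
  simp only [tensorPower, ProbabilityMeasure.toMeasure_pi, Measure.pi_pi]
  refine Finset.measurable_prod _ fun i _ => ?_
  exact (Measure.measurable_coe (s := s i) (hs i (Set.mem_univ i))).comp measurable_subtype_coe

/-- The kernel `g ↦ g^{⊗ j}`. -/
noncomputable def tensorKernel (j : ℕ) : Kernel (ProbabilityMeasure State) (Config j) :=
  ⟨fun g => (tensorPower g j : Measure (Config j)), measurable_tensorPower j⟩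

theorem tensorKernel_apply (j : ℕ) (g : ProbabilityMeasure State) :
    tensorKernel j g = (tensorPower g j : Measure (Config j)) := rfl

instance (j : ℕ) : IsMarkovKernel (tensorKernel j) :=
  ⟨fun g => by rw [tensorKernel_apply]; infer_instance⟩

theorem IsMixingMeasure.eq_snd {π : ProbabilityMeasure (ProbabilityMeasure State)}
    {P : (j : ℕ) → ProbabilityMeasure (Config j)} (h : IsMixingMeasure π P) {j : ℕ} (hj : 1 ≤ j) :
    (P j : Measure (Config j)) =
      ((π : Measure (ProbabilityMeasure State)) ⊗ₘ tensorKernel j).map Prod.snd := by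
  ext s hs
  rw [h j hj s hs, Measure.map_apply measurable_snd hs,
    Measure.compProd_apply (measurable_snd hs)]
  rfl

theorem IsMixingMeasure.integral_eq {π : ProbabilityMeasure (ProbabilityMeasure State)}
    {P : (j : ℕ) → ProbabilityMeasure (Config j)} (h : IsMixingMeasure π P) {j : ℕ} (hj : 1 ≤ j)
    {f : Config j → ℝ} (hf : Measurable f) (hb : ∃ C : ℝ, ∀ x, ‖f x‖ ≤ C) :
    ∫ Y, f Y ∂(P j : Measure (Config j)) =
      ∫ g, ∫ Y, f Y ∂(tensorPower g j : Measure (Config j))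
        ∂(π : Measure (ProbabilityMeasure State)) := by
  obtain ⟨C, hC⟩ := hb
  rw [h.eq_snd hj, integral_map measurable_snd.aemeasurable hf.aestronglyMeasurable,
    Measure.integral_compProd]
  · rfl
  · exact Integrable.of_bound (hf.comp measurable_snd).aestronglyMeasurable C
      (Eventually.of_forall fun x => hC _)

theorem IsMixingMeasure.lintegral_eq {π : ProbabilityMeasure (ProbabilityMeasure State)}
    {P : (j : ℕ) → ProbabilityMeasure (Config j)} (h : IsMixingMeasure π P) {j : ℕ} (hj : 1 ≤ j)
    {f : Config j → ℝ≥0∞} (hf : Measurable f) :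
    ∫⁻ Y, f Y ∂(P j : Measure (Config j)) =
      ∫⁻ g, ∫⁻ Y, f Y ∂(tensorPower g j : Measure (Config j))
        ∂(π : Measure (ProbabilityMeasure State)) := by
  rw [h.eq_snd hj, lintegral_map hf measurable_snd,
    Measure.lintegral_compProd (f := fun a => f a.2) (hf.comp measurable_snd)]
  rfl

theorem measurable_integral_tensorPower {j : ℕ} {f : Config j → ℝ} (hf : Measurable f) :
    Measurable fun g : ProbabilityMeasure State =>
      ∫ Y, f Y ∂(tensorPower g j : Measure (Config j)) := by
  have := (hf.stronglyMeasurable).integral_kernel (κ := tensorKernel j)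
  exact this.measurable

theorem integral_marginal {j N : ℕ} (h : j ≤ N) (G : ProbabilityMeasure (Config N))
    {f : Config j → ℝ} (hf : Measurable f) :
    ∫ Y, f Y ∂(marginal j h G : Measure (Config j)) =
      ∫ Y, f (firstCoords h Y) ∂(G : Measure (Config N)) := by
  rw [marginal, ProbabilityMeasure.toMeasure_map,
    integral_map (measurable_firstCoords h).aemeasurable hf.aestronglyMeasurable]

/-- Under a symmetric law, all subfamilies of `j` vortices have the same law. -/
theorem IsSymmetric.map_comp_eq {j N : ℕ} (h : j ≤ N) {G : ProbabilityMeasure (Config N)}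
    (hG : IsSymmetric G) {e : Fin j → Fin N} (he : Function.Injective e) :
    (G : Measure (Config N)).map (fun Y i => Y (e i)) =
      (G : Measure (Config N)).map (firstCoords h) := by
  have := (Equiv.Perm.isMultiplyPretransitive (Fin N) j).exists_smul_eq
  obtain ⟨σ, hσ⟩ := this (Fin.castLEEmb h) ⟨e, he⟩
  have hσ' : ∀ i, σ (Fin.castLE h i) = e i := fun i => by
    have := DFunLike.congr_fun hσ i
    simpa using! this
  rw [← hG σ, Measure.map_map (measurable_firstCoords h) (by fun_prop), hG σ]
  congr 1
  funext Y i
  simp [firstCoords, hσ']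

theorem IsSymmetric.integral_comp_eq {j N : ℕ} (h : j ≤ N) {G : ProbabilityMeasure (Config N)}
    (hG : IsSymmetric G) {e : Fin j → Fin N} (he : Function.Injective e) {f : Config j → ℝ}
    (hf : Measurable f) :
    ∫ Y, f (fun i => Y (e i)) ∂(G : Measure (Config N)) =
      ∫ Y, f (firstCoords h Y) ∂(G : Measure (Config N)) := by
  have h1 := hG.map_comp_eq h he
  rw [← integral_map (φ := fun (Y : Config N) i => Y (e i))
    (Measurable.aemeasurable (by fun_prop)) hf.aestronglyMeasurable, h1,
    integral_map (measurable_firstCoords h).aemeasurable hf.aestronglyMeasurable]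

theorem map_tensorPower_single {j : ℕ} (l : Fin j) (g : ProbabilityMeasure State) :
    (tensorPower g j : Measure (Config j)).map (fun Y (_ : Fin 1) => Y l) =
      (tensorPower g 1 : Measure (Config 1)) := by
  simp only [tensorPower, ProbabilityMeasure.toMeasure_pi]
  refine (Measure.pi_eq fun s hs => ?_).symm
  have hpre : (fun (Y : Config j) (_ : Fin 1) => Y l) ⁻¹' Set.univ.pi s =
      Function.eval l ⁻¹' s 0 := by
    ext Y
    simp
  rw [Measure.map_apply (by fun_prop) (MeasurableSet.univ_pi hs), hpre,
    (measurePreserving_eval (fun _ : Fin j => (g : Measure State)) l).measure_preimage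
      (hs 0).nullMeasurableSet]
  simp

theorem integral_tensorPower_single {j : ℕ} (l : Fin j) (g : ProbabilityMeasure State)
    {f : Config 1 → ℝ} (hf : Measurable f) :
    ∫ Y, f (fun _ => Y l) ∂(tensorPower g j : Measure (Config j)) =
      ∫ Y, f Y ∂(tensorPower g 1 : Measure (Config 1)) := by
  rw [← map_tensorPower_single l g,
    integral_map (Measurable.aemeasurable (by fun_prop)) hf.aestronglyMeasurable]

/-- The index of the `q`-th member of the `b`-th block, for `n` consecutive blocks of length `j`. -/
def blockIdx {n j N : ℕ} (h : n * j ≤ N) (b : Fin n) (q : Fin j) : Fin N :=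
  Fin.castLE h (finProdFinEquiv (b, q))

theorem blockIdx_inj {n j N : ℕ} (h : n * j ≤ N) {b b' : Fin n} {q q' : Fin j} :
    blockIdx h b q = blockIdx h b' q' ↔ b = b' ∧ q = q' := by
  simp [blockIdx, (Fin.castLE_injective h).eq_iff]

/-- The `b`-th block of a configuration. -/
def block {n j N : ℕ} (h : n * j ≤ N) (b : Fin n) (Y : Config N) : Config j :=
  fun q => Y (blockIdx h b q)

theorem measurable_block {n j N : ℕ} (h : n * j ≤ N) (b : Fin n) :
    Measurable (block h b : Config N → Config j) := by
  unfold block; fun_prop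

/-! ### Functionals of mean field type -/

/-- A normalized functional `K` of laws of configurations which is dual to classes `T j` of bounded
continuous integrands: `j K` is the supremum of the integrals of the members of `T j`, and the easy
half of this duality also holds for three kinds of integrands built from members of the classes:
sums over disjoint blocks of vortices, members of `T j` against tensor powers, and, up to an error
of order `j ^ (-1/2)`, the maximum of several sums `∑ₗ ψᵢ(Yₗ)`. -/
structure MeanFieldDual (T : (j : ℕ) → Set (Config j → ℝ))
    (K : (N : ℕ) → ProbabilityMeasure (Config N) → ℝ≥0∞) : Prop where
  cont : ∀ j, ∀ ψ ∈ T j, Continuous ψ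
  bdd : ∀ j, ∀ ψ ∈ T j, ∃ C : ℝ, ∀ Y, ‖ψ Y‖ ≤ C
  zero_mem : (fun _ => 0) ∈ T 1
  strong : ∀ j, 1 ≤ j → ∀ G : ProbabilityMeasure (Config j),
    j * K j G ≤ ⨆ ψ ∈ T j, ENNReal.ofReal (∫ Y, ψ Y ∂(G : Measure (Config j)))
  blocks : ∀ (n j N : ℕ) (h : n * j ≤ N), ∀ ψ ∈ T j, ∀ G : ProbabilityMeasure (Config N),
    ENNReal.ofReal (∫ Y, ∑ b, ψ (block h b Y) ∂(G : Measure (Config N))) ≤ N * K N G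
  tensor : ∀ j, 1 ≤ j → ∀ ψ ∈ T j, ∀ g : ProbabilityMeasure State,
    ENNReal.ofReal (∫ Y, ψ Y ∂(tensorPower g j : Measure (Config j))) ≤ j * K 1 (tensorPower g 1)
  max : ∀ (m : ℕ) (ψ : Fin (m + 1) → Config 1 → ℝ), (∀ i, ψ i ∈ T 1) → ∃ C : ℝ,
    ∀ j, 1 ≤ j → ∀ G : ProbabilityMeasure (Config j),
      ENNReal.ofReal ((j : ℝ)⁻¹ * ∫ Y, Finset.univ.sup' Finset.univ_nonempty
          (fun i => ∑ l, ψ i (fun _ => Y l)) ∂(G : Measure (Config j)) - C / √j) ≤ K j G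

namespace MeanFieldDual

variable {T : (j : ℕ) → Set (Config j → ℝ)} {K : (N : ℕ) → ProbabilityMeasure (Config N) → ℝ≥0∞}

theorem exists_seq (h : MeanFieldDual T K) :
    ∃ u : ℕ → Config 1 → ℝ, u 0 = (fun _ => 0) ∧ (∀ n, u n ∈ T 1) ∧
      ∀ G : ProbabilityMeasure (Config 1),
        K 1 G ≤ ⨆ n, ENNReal.ofReal (∫ Y, u n Y ∂(G : Measure (Config 1))) := by
  obtain ⟨D, hDc, hDT, hD⟩ := exists_countable_bounded_approx (T 1)
    fun f hf => ⟨h.cont 1 f hf, h.bdd 1 f hf⟩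
  have hne : D.Nonempty := by
    obtain ⟨_, u, hu, _⟩ := hD _ h.zero_mem
    exact ⟨_, hu 0⟩
  obtain ⟨v, rfl⟩ := hDc.exists_eq_range hne
  refine ⟨fun n => Nat.casesOn n (fun _ => 0) v, rfl, fun n => ?_, fun G => ?_⟩
  · cases n with
    | zero => exact h.zero_mem
    | succ n => exact hDT ⟨n, rfl⟩
  · have h1 := h.strong 1 le_rfl G
    rw [Nat.cast_one, one_mul] at h1
    refine h1.trans (iSup₂_le fun ψ hψ => ?_)
    obtain ⟨C, w, hw, hwb, hlim⟩ := hD ψ hψ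
    refine le_of_tendsto ((ENNReal.continuous_ofReal.tendsto _).comp
      (integral_tendsto_of_bounded (G : Measure (Config 1))
        (fun n => h.cont 1 _ (hDT (hw n))) hwb hlim)) (Eventually.of_forall fun n => ?_)
    obtain ⟨i, hi⟩ := hw n
    simp only [Function.comp_apply]
    rw [← hi]
    exact le_iSup (fun n => ENNReal.ofReal (∫ Y, (Nat.casesOn n (fun _ => 0) v : Config 1 → ℝ) Y
      ∂(G : Measure (Config 1)))) (i + 1)

theorem tensorPower_eq_iSup (h : MeanFieldDual T K) {u : ℕ → Config 1 → ℝ} (hu : ∀ n, u n ∈ T 1)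
    (hK : ∀ G : ProbabilityMeasure (Config 1),
        K 1 G ≤ ⨆ n, ENNReal.ofReal (∫ Y, u n Y ∂(G : Measure (Config 1))))
    (g : ProbabilityMeasure State) :
    K 1 (tensorPower g 1) =
      ⨆ n, ENNReal.ofReal (∫ Y, u n Y ∂(tensorPower g 1 : Measure (Config 1))) := by
  refine le_antisymm (hK _) (iSup_le fun n => ?_)
  simpa using h.tensor 1 le_rfl _ (hu n) g

theorem measurable_tensorPower (h : MeanFieldDual T K) :
    Measurable fun g : ProbabilityMeasure State => K 1 (tensorPower g 1) := by
  obtain ⟨u, -, hu, hK⟩ := h.exists_seq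
  simp_rw [h.tensorPower_eq_iSup hu hK]
  exact Measurable.iSup fun n => (measurable_integral_tensorPower
    (h.cont 1 _ (hu n)).measurable).ennreal_ofReal

/-- Convexity: the functional of a mixture is at most the mixture of the functionals. -/
theorem mixture_le (h : MeanFieldDual T K) {π : ProbabilityMeasure (ProbabilityMeasure State)}
    {P : (j : ℕ) → ProbabilityMeasure (Config j)} (hπ : IsMixingMeasure π P) {j : ℕ}
    (hj : 1 ≤ j) :
    K j (P j) ≤ ∫⁻ g, K 1 (tensorPower g 1) ∂(π : Measure (ProbabilityMeasure State)) := by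
  have hj0 : (j : ℝ≥0∞) ≠ 0 := by exact_mod_cast (by omega : j ≠ 0)
  have key : (j : ℝ≥0∞) * K j (P j) ≤
      j * ∫⁻ g, K 1 (tensorPower g 1) ∂(π : Measure (ProbabilityMeasure State)) := by
    refine (h.strong j hj (P j)).trans (iSup₂_le fun ψ hψ => ?_)
    rw [hπ.integral_eq hj (h.cont j ψ hψ).measurable (h.bdd j ψ hψ)]
    refine (ofReal_integral_le_lintegral_ofReal _ _).trans ?_
    rw [← lintegral_const_mul' _ _ (ENNReal.natCast_ne_top j)]
    exact lintegral_mono fun g => h.tensor j hj ψ hψ g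
  exact (ENNReal.mul_le_mul_iff_right hj0 (ENNReal.natCast_ne_top j)).1 key

/-- The functional of the mixture of the tensor powers `g^{⊗ j}` does not lose anything in the limit
`j → ∞`: the average of `ψ` over `j` independent vortices of law `g` already identifies the best
integrand for `g`. -/
theorem lintegral_le_iSup (h : MeanFieldDual T K)
    {π : ProbabilityMeasure (ProbabilityMeasure State)}
    {P : (j : ℕ) → ProbabilityMeasure (Config j)} (hπ : IsMixingMeasure π P) :
    ∫⁻ g, K 1 (tensorPower g 1) ∂(π : Measure (ProbabilityMeasure State)) ≤
      ⨆ (j : ℕ) (_ : 1 ≤ j), K j (P j) := by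
  obtain ⟨u, hu0, hu, hK⟩ := h.exists_seq
  have hum : ∀ n, Measurable (u n) := fun n => (h.cont 1 _ (hu n)).measurable
  let I : ℕ → ProbabilityMeasure State → ℝ := fun n g =>
    ∫ Y, u n Y ∂(tensorPower g 1 : Measure (Config 1))
  have hIm : ∀ n, Measurable (I n) := fun n => measurable_integral_tensorPower (hum n)
  let M : ℕ → ProbabilityMeasure State → ℝ := fun m g =>
    Finset.univ.sup' Finset.univ_nonempty (fun i : Fin (m + 1) => I i g)
  have hMm : ∀ m, Measurable (M m) := fun m => by
    have := Finset.measurable_sup' (s := (Finset.univ : Finset (Fin (m + 1))))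
      Finset.univ_nonempty (f := fun i => I i) (fun i _ => hIm i)
    convert this using 1
    funext g
    simp [M]
  have hIM : ∀ m g (i : Fin (m + 1)), I i g ≤ M m g := fun m g i =>
    Finset.le_sup' (fun i : Fin (m + 1) => I i g) (Finset.mem_univ i)
  have hM0 : ∀ m g, 0 ≤ M m g := fun m g => by
    refine le_trans (le_of_eq ?_) (hIM m g 0)
    simp [I, hu0]
  have hmono : Monotone fun m g => ENNReal.ofReal (M m g) := by
    intro m m' hm g
    refine ENNReal.ofReal_le_ofReal (Finset.sup'_le _ _ fun i _ => ?_)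
    exact hIM m' g ⟨i, by omega⟩
  have hsup : ∀ g, K 1 (tensorPower g 1) = ⨆ m, ENNReal.ofReal (M m g) := by
    intro g
    rw [h.tensorPower_eq_iSup hu hK]
    refine le_antisymm (iSup_le fun n => ?_) (iSup_le fun m => ?_)
    · exact (ENNReal.ofReal_le_ofReal (hIM n g ⟨n, by omega⟩)).trans
        (le_iSup (fun m => ENNReal.ofReal (M m g)) n)
    · obtain ⟨i, -, hi⟩ := Finset.exists_mem_eq_sup' Finset.univ_nonempty
        (fun i : Fin (m + 1) => I i g)
      simp only [M, hi]
      exact le_iSup (fun n => ENNReal.ofReal (I n g)) (i : ℕ)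
  simp_rw [hsup]
  rw [lintegral_iSup (fun m => (hMm m).ennreal_ofReal) hmono]
  refine iSup_le fun m => ?_
  obtain ⟨C, hC⟩ := h.max m (fun i => u i) fun i => hu i
  have hbd : ∀ n : ℕ, ∃ B : ℝ, ∀ Y, ‖u n Y‖ ≤ B := fun n => h.bdd 1 _ (hu n)
  choose B hB using hbd
  have hIB : ∀ n g, ‖I n g‖ ≤ B n := fun n g => by
    refine (norm_integral_le_of_norm_le_const (Eventually.of_forall (hB n))).trans ?_
    simp
  -- bound for finite maxima
  have hsupB : ∀ (a : Fin (m + 1) → ℝ) (b : Fin (m + 1) → ℝ), (∀ i, ‖a i‖ ≤ b i) →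
      ‖Finset.univ.sup' Finset.univ_nonempty a‖ ≤ ∑ i, b i := fun a b hab => by
    obtain ⟨i, -, hi⟩ := Finset.exists_mem_eq_sup' Finset.univ_nonempty a
    rw [hi]
    exact (hab i).trans (Finset.single_le_sum (f := b)
      (fun k _ => (norm_nonneg _).trans (hab k)) (Finset.mem_univ i))
  have hMint : Integrable (M m) (π : Measure (ProbabilityMeasure State)) :=
    Integrable.of_bound (hMm m).aestronglyMeasurable (∑ i : Fin (m + 1), B i)
      (Eventually.of_forall fun g => hsupB _ _ fun i => hIB i g)
  rw [← ofReal_integral_eq_lintegral_ofReal hMint (Eventually.of_forall (hM0 m))]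
  have hlim : Tendsto (fun j : ℕ => ENNReal.ofReal
      (∫ g, M m g ∂(π : Measure (ProbabilityMeasure State)) - C / √j)) atTop
      (𝓝 (ENNReal.ofReal (∫ g, M m g ∂(π : Measure (ProbabilityMeasure State)) - 0))) := by
    refine (ENNReal.continuous_ofReal.tendsto _).comp (tendsto_const_nhds.sub ?_)
    exact tendsto_const_nhds.div_atTop
      (Real.tendsto_sqrt_atTop.comp tendsto_natCast_atTop_atTop)
  rw [sub_zero] at hlim
  refine le_of_tendsto hlim (eventually_atTop.2 ⟨1, fun j hj => ?_⟩)
  refine le_trans ?_ ((hC j hj (P j)).trans (le_iSup₂ (f := fun j (_ : 1 ≤ j) => K j (P j)) j hj))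
  refine ENNReal.ofReal_le_ofReal (sub_le_sub_right ?_ _)
  have hj0 : (0 : ℝ) < j := by exact_mod_cast hj
  let F : Config j → ℝ := fun Y => Finset.univ.sup' Finset.univ_nonempty
    (fun i : Fin (m + 1) => ∑ l, u i (fun _ => Y l))
  have hSm : ∀ n, Measurable fun Y : Config j => ∑ l, u n (fun _ => Y l) := fun n =>
    Finset.measurable_sum _ fun l _ => (hum n).comp (by fun_prop)
  have hFm : Measurable F := by
    have := Finset.measurable_sup' (s := (Finset.univ : Finset (Fin (m + 1))))
      Finset.univ_nonempty (f := fun i (Y : Config j) => ∑ l, u i (fun _ => Y l))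
      (fun i _ => hSm i)
    convert this using 1
    funext g
    simp [F]
  have hSB : ∀ n (Y : Config j), ‖∑ l, u n (fun _ => Y l)‖ ≤ ∑ _l : Fin j, B n := fun n Y =>
    norm_sum_le_of_le _ fun l _ => hB n _
  have hFB : ∀ Y, ‖F Y‖ ≤ ∑ i : Fin (m + 1), ∑ _l : Fin j, B i := fun Y =>
    hsupB _ _ fun i => hSB i Y
  change _ ≤ (j : ℝ)⁻¹ * ∫ Y, F Y ∂(P j : Measure (Config j))
  rw [hπ.integral_eq hj hFm ⟨_, hFB⟩, ← integral_const_mul]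
  refine integral_mono hMint ?_ fun g => ?_
  · refine Integrable.of_bound
      ((measurable_integral_tensorPower hFm).const_mul _).aestronglyMeasurable
      ((j : ℝ)⁻¹ * ∑ i : Fin (m + 1), ∑ _l : Fin j, B i) (Eventually.of_forall fun g => ?_)
    rw [norm_mul, Real.norm_of_nonneg (inv_nonneg.2 hj0.le)]
    refine mul_le_mul_of_nonneg_left ?_ (inv_nonneg.2 hj0.le)
    refine (norm_integral_le_of_norm_le_const (Eventually.of_forall hFB)).trans ?_
    simp
  · refine Finset.sup'_le _ _ fun i _ => ?_
    rw [le_inv_mul_iff₀ hj0]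
    have : ∫ Y, ∑ l, u i (fun _ => Y l) ∂(tensorPower g j : Measure (Config j)) = j * I i g := by
      rw [integral_finsetSum]
      · simp_rw [integral_tensorPower_single _ g (hum i)]
        simp [I]
      · intro l _
        exact Integrable.of_bound ((hum i).comp (by fun_prop)).aestronglyMeasurable (B i)
          (Eventually.of_forall fun Y => hB i _)
    rw [← this]
    refine integral_mono (Integrable.of_bound (hSm i).aestronglyMeasurable _
      (Eventually.of_forall (hSB i))) (Integrable.of_bound hFm.aestronglyMeasurable _
      (Eventually.of_forall hFB)) fun Y => ?_
    exact Finset.le_sup' (fun i : Fin (m + 1) => ∑ l, u i (fun _ => Y l)) (Finset.mem_univ i)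

/-- Lower semicontinuity along the marginals, with superadditivity over blocks. -/
theorem iSup_le_liminf (h : MeanFieldDual T K) {G : (N : ℕ) → ProbabilityMeasure (Config N)}
    (hG : ∀ N, 2 ≤ N → IsSymmetric (G N)) {P : (j : ℕ) → ProbabilityMeasure (Config j)}
    (hlim : ∀ j, 1 ≤ j →
      Tendsto (fun n : ℕ => marginal j (Nat.le_add_left j n) (G (n + j))) atTop (𝓝 (P j))) :
    ⨆ (j : ℕ) (_ : 1 ≤ j), K j (P j) ≤ liminf (fun N => K N (G N)) atTop := by
  refine iSup₂_le fun j hj => ?_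
  have hj0 : (j : ℝ≥0∞) ≠ 0 := by exact_mod_cast (by omega : j ≠ 0)
  have hjR : (0 : ℝ) < j := by exact_mod_cast hj
  refine (ENNReal.mul_le_mul_iff_right hj0 (ENNReal.natCast_ne_top j)).1 ?_
  refine (h.strong j hj (P j)).trans (iSup₂_le fun ψ hψ => ?_)
  have hψm := (h.cont j ψ hψ).measurable
  obtain ⟨B, hB⟩ := h.bdd j ψ hψ
  let ψb : BoundedContinuousFunction (Config j) ℝ :=
    BoundedContinuousFunction.ofNormedAddCommGroup ψ (h.cont j ψ hψ) B hB
  have hint := (ProbabilityMeasure.tendsto_iff_forall_integral_tendsto.1 (hlim j hj)) ψb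
  change Tendsto (fun n : ℕ => ∫ Y, ψ Y
    ∂(marginal j (Nat.le_add_left j n) (G (n + j)) : Measure (Config j))) atTop
    (𝓝 (∫ Y, ψ Y ∂(P j : Measure (Config j)))) at hint
  set a := ∫ Y, ψ Y ∂(P j : Measure (Config j))
  -- the number of blocks divided by the number of vortices
  have hfrac : Tendsto (fun n : ℕ => (((n + j) / j : ℕ) : ℝ) / ((n + j : ℕ) : ℝ)) atTop
      (𝓝 ((j : ℝ)⁻¹)) := by
    have h1 : Tendsto (fun n : ℕ => (⌊(n : ℝ) * (j : ℝ)⁻¹⌋₊ : ℝ) / (n : ℝ)) atTop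
        (𝓝 ((j : ℝ)⁻¹)) := by
      have := (tendsto_nat_floor_mul_div_atTop (R := ℝ) (a := (j : ℝ)⁻¹)
        (by positivity)).comp tendsto_natCast_atTop_atTop (α := ℕ)
      refine this.congr fun n => ?_
      simp [mul_comm]
    have h2 := h1.comp (tendsto_add_atTop_nat j)
    refine h2.congr fun n => ?_
    simp only [Function.comp_apply, ← div_eq_mul_inv]
    rw [Nat.floor_div_natCast, Nat.floor_natCast]
  have hK : ∀ᶠ n : ℕ in atTop, ENNReal.ofReal ((((n + j) / j : ℕ) : ℝ) / ((n + j : ℕ) : ℝ) *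
      ∫ Y, ψ Y ∂(marginal j (Nat.le_add_left j n) (G (n + j)) : Measure (Config j))) ≤
      K (n + j) (G (n + j)) := by
    refine eventually_atTop.2 ⟨2, fun n hn => ?_⟩
    have hN0 : (0 : ℝ) < ((n + j : ℕ) : ℝ) := by exact_mod_cast (by omega : 0 < n + j)
    have hle : (n + j) / j * j ≤ n + j := Nat.div_mul_le_self _ _
    have hsym := hG (n + j) (by omega)
    have key := h.blocks _ j (n + j) hle ψ hψ (G (n + j))
    rw [integral_finsetSum] at key
    · have hblk : ∀ b, ∫ Y, ψ (block hle b Y) ∂(G (n + j) : Measure (Config (n + j))) =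
          ∫ Y, ψ Y ∂(marginal j (Nat.le_add_left j n) (G (n + j)) : Measure (Config j)) := by
        intro b
        rw [integral_marginal _ _ hψm]
        exact hsym.integral_comp_eq _ (fun q q' hq => ((blockIdx_inj hle).1 hq).2) hψm
      simp_rw [hblk] at key
      rw [Finset.sum_const, Finset.card_univ, Fintype.card_fin, nsmul_eq_mul] at key
      rw [div_mul_eq_mul_div, ENNReal.ofReal_div_of_pos hN0, ENNReal.ofReal_natCast]
      exact ENNReal.div_le_of_le_mul' key
    · intro b _
      exact Integrable.of_bound (hψm.comp (measurable_block hle b)).aestronglyMeasurable B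
        (Eventually.of_forall fun Y => hB _)
  have hl : Tendsto (fun n : ℕ => ENNReal.ofReal ((((n + j) / j : ℕ) : ℝ) / ((n + j : ℕ) : ℝ) *
      ∫ Y, ψ Y ∂(marginal j (Nat.le_add_left j n) (G (n + j)) : Measure (Config j)))) atTop
      (𝓝 (ENNReal.ofReal ((j : ℝ)⁻¹ * a))) :=
    (ENNReal.continuous_ofReal.tendsto _).comp (hfrac.mul hint)
  rw [← liminf_nat_add (fun N => K N (G N)) j]
  have hfin : ENNReal.ofReal ((j : ℝ)⁻¹ * a) ≤ liminf (fun n => K (n + j) (G (n + j))) atTop := by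
    rw [← hl.liminf_eq]
    exact liminf_le_liminf hK
  calc ENNReal.ofReal a = j * ENNReal.ofReal ((j : ℝ)⁻¹ * a) := by
        rw [← ENNReal.ofReal_natCast, ← ENNReal.ofReal_mul hjR.le, mul_inv_cancel_left₀ hjR.ne']
    _ ≤ _ := by gcongr

theorem lintegral_eq_iSup (h : MeanFieldDual T K)
    {π : ProbabilityMeasure (ProbabilityMeasure State)}
    {P : (j : ℕ) → ProbabilityMeasure (Config j)} (hπ : IsMixingMeasure π P) :
    ∫⁻ g, K 1 (tensorPower g 1) ∂(π : Measure (ProbabilityMeasure State)) =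
      ⨆ (j : ℕ) (_ : 1 ≤ j), K j (P j) :=
  le_antisymm (h.lintegral_le_iSup hπ) (iSup₂_le fun _ hj => h.mixture_le hπ hj)

end MeanFieldDual

/-! ### Variational formula for the relative entropy -/

theorem bounded_exp {X : Type*} {f : X → ℝ} (hb : ∃ C : ℝ, ∀ x, ‖f x‖ ≤ C) :
    ∃ C : ℝ, ∀ x, ‖Real.exp (f x)‖ ≤ C := by
  obtain ⟨C, hC⟩ := hb
  refine ⟨Real.exp C, fun x => ?_⟩
  rw [Real.norm_of_nonneg (Real.exp_pos _).le]
  exact Real.exp_le_exp.2 ((le_abs_self _).trans (hC x))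

section Duality

variable {X : Type*} [MeasurableSpace X] {G μ : Measure X} [IsProbabilityMeasure G]
  [IsProbabilityMeasure μ]

theorem integrable_of_measurable_bounded (μ : Measure X) [IsFiniteMeasure μ] {f : X → ℝ}
    (hf : Measurable f) (hb : ∃ C : ℝ, ∀ x, ‖f x‖ ≤ C) : Integrable f μ := by
  obtain ⟨C, hC⟩ := hb
  exact Integrable.of_bound hf.aestronglyMeasurable C (Eventually.of_forall hC)

/-- The Gibbs variational inequality. -/
theorem ofReal_integral_sub_log_le_klDiv {φ : X → ℝ} (hφ : Measurable φ)
    (hb : ∃ C : ℝ, ∀ x, ‖φ x‖ ≤ C) :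
    ENNReal.ofReal (∫ x, φ x ∂G - Real.log (∫ x, Real.exp (φ x) ∂μ)) ≤ klDiv G μ := by
  by_cases htop : klDiv G μ = ⊤
  · simp [htop]
  obtain ⟨hac, hint⟩ := klDiv_ne_top_iff.1 htop
  have hexp : Integrable (fun x => Real.exp (φ x)) μ :=
    integrable_of_measurable_bounded μ hφ.exp (bounded_exp hb)
  have hφG := integrable_of_measurable_bounded G hφ hb
  have h1 := integral_llr_tilted_right hac hφG hexp hint
  have : IsProbabilityMeasure (μ.tilted φ) := isProbabilityMeasure_tilted hexp
  have hac' : G ≪ μ.tilted φ := hac.trans (absolutelyContinuous_tilted hexp)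
  have h2 := toReal_klDiv_of_measure_eq hac' (by simp)
  have h3 := toReal_klDiv_of_measure_eq hac (by simp)
  have h4 : 0 ≤ (klDiv G (μ.tilted φ)).toReal := ENNReal.toReal_nonneg
  refine ENNReal.ofReal_le_of_le_toReal ?_
  linarith

theorem klFun_clip_le {f a b : ℝ} (ha : 0 < a) (ha1 : a ≤ 1) (hb1 : 1 ≤ b) :
    klFun (max a (min f b)) ≤
      f * Real.log (max a (min f b)) - max a (min f b) + 1 := by
  set c := max a (min f b) with hc
  have hc0 : 0 < c := lt_of_lt_of_le ha (le_max_left _ _)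
  have : c * Real.log c ≤ f * Real.log c := by
    rcases le_total 1 f with h | h
    · have h1 : 1 ≤ c := le_trans (le_min h hb1) (le_max_right _ _)
      have h2 : c ≤ f := max_le (ha1.trans h) (min_le_left _ _)
      exact mul_le_mul_of_nonneg_right h2 (Real.log_nonneg h1)
    · have h1 : c ≤ 1 := max_le ha1 ((min_le_left _ _).trans h)
      have h2 : f ≤ c := by
        rw [hc, min_eq_left (h.trans hb1)]
        exact le_max_right _ _
      exact mul_le_mul_of_nonpos_right h2 (Real.log_nonpos hc0.le h1)
  rw [klFun_apply]
  linarith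

/-- Duality for the relative entropy, with bounded measurable test functions. -/
theorem klDiv_le_of_forall_measurable {S : ℝ≥0∞}
    (hS : ∀ φ : X → ℝ, Measurable φ → (∃ C : ℝ, ∀ x, ‖φ x‖ ≤ C) →
      ENNReal.ofReal (∫ x, φ x ∂G - Real.log (∫ x, Real.exp (φ x) ∂μ)) ≤ S) :
    klDiv G μ ≤ S := by
  by_cases hSt : S = ⊤
  · simp [hSt]
  have hac : G ≪ μ := by
    refine Measure.AbsolutelyContinuous.mk fun A hA hμA => ?_
    by_contra hGA
    have hpos : 0 < G.real A := ENNReal.toReal_pos hGA (measure_ne_top _ _)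
    have htop : S = ⊤ := by
      refine ENNReal.eq_top_of_forall_nnreal_le fun r => ?_
      refine le_trans ?_ (hS (A.indicator fun _ => r / G.real A)
        (measurable_const.indicator hA) ⟨‖r / G.real A‖, fun x => ?_⟩)
      · have h1 : ∫ x, A.indicator (fun _ => (r : ℝ) / G.real A) x ∂G = r := by
          rw [integral_indicator hA, setIntegral_const, smul_eq_mul, mul_div_cancel₀ _ hpos.ne']
        have h2 : ∫ x, Real.exp (A.indicator (fun _ => (r : ℝ) / G.real A) x) ∂μ = 1 := by
          have : (fun x => Real.exp (A.indicator (fun _ => (r : ℝ) / G.real A) x)) =ᵐ[μ]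
              fun _ => 1 := by
            have hn : ∀ᵐ x ∂μ, x ∉ A := measure_eq_zero_iff_ae_notMem.1 hμA
            filter_upwards [hn] with x hx
            simp [hx]
          rw [integral_congr_ae this]
          simp
        rw [h1, h2]
        simp
      · exact norm_indicator_le_norm_self _ _
    exact hSt htop
  let f : X → ℝ := fun x => (G.rnDeriv μ x).toReal
  have hfm : Measurable f := (Measure.measurable_rnDeriv G μ).ennreal_toReal
  have hf0 : ∀ x, 0 ≤ f x := fun x => ENNReal.toReal_nonneg
  have hfi : Integrable f μ := Measure.integrable_toReal_rnDeriv
  let c : ℕ → X → ℝ := fun n x => max (Real.exp (-n)) (min (f x) (Real.exp n))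
  have hcm : ∀ n, Measurable (c n) := fun n =>
    measurable_const.max (hfm.min measurable_const)
  have hcpos : ∀ n x, 0 < c n x := fun n x => lt_of_lt_of_le (Real.exp_pos _) (le_max_left _ _)
  have hclow : ∀ (n : ℕ) x, Real.exp (-n) ≤ c n x := fun n x => le_max_left _ _
  have hcup : ∀ (n : ℕ) x, c n x ≤ Real.exp n := fun n x =>
    max_le (Real.exp_le_exp.2 (by linarith [n.cast_nonneg (α := ℝ)])) (min_le_right _ _)
  have hlogm : ∀ n, Measurable fun x => Real.log (c n x) := fun n => (hcm n).log
  have hlogb : ∀ n x, ‖Real.log (c n x)‖ ≤ n := fun n x => by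
    rw [Real.norm_eq_abs, abs_le]
    exact ⟨(Real.le_log_iff_exp_le (hcpos n x)).2 (hclow n x),
      (Real.log_le_iff_le_exp (hcpos n x)).2 (hcup n x)⟩
  have hci : ∀ n, Integrable (c n) μ := fun n => integrable_of_measurable_bounded μ (hcm n)
    ⟨Real.exp n, fun x => by rw [Real.norm_of_nonneg (hcpos n x).le]; exact hcup n x⟩
  have hlim : ∀ x, Tendsto (fun n => c n x) atTop (𝓝 (f x)) := fun x => by
    have h1 : Tendsto (fun n : ℕ => Real.exp (-(n : ℝ))) atTop (𝓝 0) :=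
      (Real.tendsto_exp_neg_atTop_nhds_zero).comp tendsto_natCast_atTop_atTop
    have h2 : Tendsto (fun n : ℕ => min (f x) (Real.exp n)) atTop (𝓝 (f x)) := by
      refine tendsto_const_nhds.congr' ?_
      have := (Real.tendsto_exp_atTop.comp
        (tendsto_natCast_atTop_atTop (R := ℝ))).eventually_ge_atTop
        (f x)
      filter_upwards [this] with n hn
      exact (min_eq_left hn).symm
    simpa [max_eq_right (hf0 x)] using h1.max h2
  have hstep : ∀ n, ∫⁻ x, ENNReal.ofReal (klFun (c n x)) ∂μ ≤ S := fun n => by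
    have hle : ∀ x, klFun (c n x) ≤ f x * Real.log (c n x) - c n x + 1 := fun x =>
      klFun_clip_le (Real.exp_pos _) (Real.exp_le_one_iff.2 (by simp))
        (Real.one_le_exp n.cast_nonneg)
    have hfl : Integrable (fun x => f x * Real.log (c n x)) μ :=
      hfi.mul_bdd (c := n) (hlogm n).aestronglyMeasurable (Eventually.of_forall (hlogb n))
    have hsub : Integrable (fun x => f x * Real.log (c n x) - c n x) μ := hfl.sub (hci n)
    have hint : Integrable (fun x => f x * Real.log (c n x) - c n x + 1) μ :=
      hsub.add (integrable_const 1)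
    have hval : ∫ x, (f x * Real.log (c n x) - c n x + 1) ∂μ =
        ∫ x, Real.log (c n x) ∂G - ∫ x, c n x ∂μ + 1 := by
      rw [integral_add hsub (integrable_const 1), integral_sub hfl (hci n),
        ← integral_rnDeriv_smul hac]
      simp [f]
    have hcpos' : 0 < ∫ x, c n x ∂μ := by
      have : Real.exp (-n) ≤ ∫ x, c n x ∂μ := by
        have := integral_mono (integrable_const (μ := μ) (Real.exp (-n))) (hci n) (hclow n)
        simpa using this
      exact (Real.exp_pos _).trans_le this
    calc ∫⁻ x, ENNReal.ofReal (klFun (c n x)) ∂μ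
        ≤ ∫⁻ x, ENNReal.ofReal (f x * Real.log (c n x) - c n x + 1) ∂μ :=
          lintegral_mono fun x => ENNReal.ofReal_le_ofReal (hle x)
      _ = ENNReal.ofReal (∫ x, Real.log (c n x) ∂G - ∫ x, c n x ∂μ + 1) := by
          rw [← hval, ofReal_integral_eq_lintegral_ofReal hint
            (Eventually.of_forall fun x => (klFun_nonneg (hcpos n x).le).trans (hle x))]
      _ ≤ ENNReal.ofReal (∫ x, Real.log (c n x) ∂G -
            Real.log (∫ x, Real.exp (Real.log (c n x)) ∂μ)) := by
          refine ENNReal.ofReal_le_ofReal ?_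
          simp_rw [Real.exp_log (hcpos n _)]
          linarith [Real.log_le_sub_one_of_pos hcpos']
      _ ≤ S := hS _ (hlogm n) ⟨n, hlogb n⟩
  rw [klDiv_eq_lintegral_klFun_of_ac hac]
  calc ∫⁻ x, ENNReal.ofReal (klFun (f x)) ∂μ
      = ∫⁻ x, liminf (fun n => ENNReal.ofReal (klFun (c n x))) atTop ∂μ := by
        refine lintegral_congr fun x => (Tendsto.liminf_eq ?_).symm
        exact (ENNReal.continuous_ofReal.tendsto _).comp
          ((continuous_klFun.tendsto _).comp (hlim x))
    _ ≤ liminf (fun n => ∫⁻ x, ENNReal.ofReal (klFun (c n x)) ∂μ) atTop :=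
        lintegral_liminf_le fun n => (measurable_klFun.comp (hcm n)).ennreal_ofReal
    _ ≤ S := liminf_le_of_le (by isBoundedDefault) fun b hb => by
        obtain ⟨n, hn⟩ := hb.exists
        exact hn.trans (hstep n)

theorem abs_clip_sub_clip_le (a b B : ℝ) :
    |max (-B) (min a B) - max (-B) (min b B)| ≤ |a - b| := by
  rw [max_comm (-B), max_comm (-B)]
  refine (abs_max_sub_max_le_abs _ _ _).trans ?_
  have h := abs_max_sub_max_le_abs (-a) (-b) (-B)
  rw [max_neg_neg, max_neg_neg, neg_sub_neg, neg_sub_neg, abs_sub_comm, abs_sub_comm b] at h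
  exact h

theorem abs_exp_sub_exp_le {a b B : ℝ} (ha : |a| ≤ B) (hb : |b| ≤ B) :
    |Real.exp a - Real.exp b| ≤ Real.exp B * |a - b| := by
  have h := Convex.norm_image_sub_le_of_norm_deriv_le (f := Real.exp) (s := Set.Icc (-B) B)
    (C := Real.exp B) (fun x _ => Real.differentiableAt_exp) (fun x hx => by
      rw [Real.deriv_exp, Real.norm_of_nonneg (Real.exp_pos _).le]
      exact Real.exp_le_exp.2 hx.2) (convex_Icc _ _) (abs_le.1 hb) (abs_le.1 ha)
  simpa using h

/-- Duality for the relative entropy, with bounded continuous test functions. -/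
theorem klDiv_le_of_forall_continuous [TopologicalSpace X]
    [TopologicalSpace.PseudoMetrizableSpace X]
    [BorelSpace X] {S : ℝ≥0∞}
    (hS : ∀ φ : X → ℝ, Continuous φ → (∃ C : ℝ, ∀ x, ‖φ x‖ ≤ C) →
      ENNReal.ofReal (∫ x, φ x ∂G - Real.log (∫ x, Real.exp (φ x) ∂μ)) ≤ S) :
    klDiv G μ ≤ S := by
  let := TopologicalSpace.pseudoMetrizableSpacePseudoMetric X
  refine klDiv_le_of_forall_measurable fun φ hφ ⟨B, hB⟩ => ?_
  have hφi : Integrable φ (G + μ) := integrable_of_measurable_bounded _ hφ ⟨B, hB⟩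
  have hex : ∀ n : ℕ, ∃ g : X → ℝ, Continuous g ∧ (∀ x, ‖g x‖ ≤ B) ∧
      ∫ x, ‖φ x - g x‖ ∂(G + μ) ≤ ((n : ℝ) + 1)⁻¹ := by
    intro n
    obtain ⟨g, hg, hgi⟩ := hφi.exists_boundedContinuous_integral_sub_le
      (ε := ((n : ℝ) + 1)⁻¹) (by positivity)
    have hBnn : ∀ x : X, 0 ≤ B := fun x => (norm_nonneg _).trans (hB x)
    have hcl : ∀ x, |max (-B) (min (g x) B)| ≤ B := fun x => abs_le.2
      ⟨le_max_left _ _, max_le (by linarith [hBnn x]) (min_le_right _ _)⟩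
    refine ⟨fun x => max (-B) (min (g x) B), by fun_prop, hcl, le_trans ?_ hg⟩
    refine integral_mono ?_ (hφi.sub hgi).norm fun x => ?_
    · refine (hφi.sub ?_).norm
      exact integrable_of_continuous_bounded _ (by fun_prop) ⟨B, hcl⟩
    · have h1 := abs_le.1 (hB x)
      have h2 : φ x = max (-B) (min (φ x) B) := by
        rw [min_eq_left h1.2, max_eq_right h1.1]
      simp only [Real.norm_eq_abs]
      conv_lhs => rw [h2]
      exact abs_clip_sub_clip_le _ _ _
  choose g hgc hgB hg using hex
  have hgm : ∀ n, Measurable (g n) := fun n => (hgc n).measurable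
  have hd : ∀ n, Integrable (fun x => ‖φ x - g n x‖) (G + μ) := fun n =>
    (hφi.sub (integrable_of_measurable_bounded _ (hgm n) ⟨B, hgB n⟩)).norm
  have hsplit : ∀ n, ∫ x, ‖φ x - g n x‖ ∂G ≤ ((n : ℝ) + 1)⁻¹ ∧
      ∫ x, ‖φ x - g n x‖ ∂μ ≤ ((n : ℝ) + 1)⁻¹ := fun n => by
    have h := hg n
    rw [integral_add_measure (hd n).left_of_add_measure (hd n).right_of_add_measure] at h
    have h1 : 0 ≤ ∫ x, ‖φ x - g n x‖ ∂G := integral_nonneg fun x => norm_nonneg _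
    have h2 : 0 ≤ ∫ x, ‖φ x - g n x‖ ∂μ := integral_nonneg fun x => norm_nonneg _
    constructor <;> linarith
  have h0 : Tendsto (fun n : ℕ => ((n : ℝ) + 1)⁻¹) atTop (𝓝 0) := by
    simpa [one_div] using tendsto_one_div_add_atTop_nhds_zero_nat (𝕜 := ℝ)
  have hlim1 : Tendsto (fun n => ∫ x, g n x ∂G) atTop (𝓝 (∫ x, φ x ∂G)) := by
    refine tendsto_iff_norm_sub_tendsto_zero.2
      (squeeze_zero (fun _ => norm_nonneg _) (fun n => ?_) h0)
    rw [norm_sub_rev, ← integral_sub (integrable_of_measurable_bounded _ hφ ⟨B, hB⟩)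
      (integrable_of_measurable_bounded _ (hgm n) ⟨B, hgB n⟩)]
    exact (norm_integral_le_integral_norm _).trans (hsplit n).1
  have hlim2 : Tendsto (fun n => ∫ x, Real.exp (g n x) ∂μ) atTop
      (𝓝 (∫ x, Real.exp (φ x) ∂μ)) := by
    refine tendsto_iff_norm_sub_tendsto_zero.2 (squeeze_zero (fun _ => norm_nonneg _) (fun n => ?_)
      (by simpa using h0.const_mul (Real.exp B)))
    rw [norm_sub_rev, ← integral_sub
      (integrable_of_measurable_bounded _ hφ.exp (bounded_exp ⟨B, hB⟩))
      (integrable_of_measurable_bounded _ (hgm n).exp (bounded_exp ⟨B, hgB n⟩))]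
    refine (norm_integral_le_of_norm_le ((hd n).right_of_add_measure.const_mul (Real.exp B))
      (Eventually.of_forall fun x => abs_exp_sub_exp_le (hB x) (hgB n x))).trans ?_
    rw [integral_const_mul]
    exact mul_le_mul_of_nonneg_left (hsplit n).2 (Real.exp_pos _).le
  have hpos : 0 < ∫ x, Real.exp (φ x) ∂μ :=
    integral_exp_pos (integrable_of_measurable_bounded _ hφ.exp (bounded_exp ⟨B, hB⟩))
  exact le_of_tendsto ((ENNReal.continuous_ofReal.tendsto _).comp
    (hlim1.sub ((Real.continuousAt_log hpos.ne').tendsto.comp hlim2)))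
    (Eventually.of_forall fun n => hS _ (hgc n) ⟨B, hgB n⟩)

end Duality

theorem map_pi_comp_injective {ι κ X : Type*} [Fintype ι] [Fintype κ] [MeasurableSpace X]
    (m : Measure X) [IsProbabilityMeasure m] {e : ι → κ} (he : Function.Injective e) :
    (Measure.pi fun _ : κ => m).map (fun Y i => Y (e i)) = Measure.pi fun _ : ι => m := by
  refine (Measure.pi_eq fun s hs => ?_).symm
  have hpre : (fun (Y : κ → X) i => Y (e i)) ⁻¹' Set.univ.pi s =
      Set.univ.pi (Function.extend e s fun _ => Set.univ) := by
    ext Y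
    simp only [Set.mem_preimage, Set.mem_univ_pi]
    refine ⟨fun h k => ?_, fun h i => by simpa [he.extend_apply] using h (e i)⟩
    by_cases hk : ∃ i, e i = k
    · obtain ⟨i, rfl⟩ := hk
      simpa [he.extend_apply] using h i
    · simp [Function.extend_apply' _ _ _ hk]
  rw [Measure.map_apply (by fun_prop) (MeasurableSet.univ_pi hs), hpre, Measure.pi_pi]
  refine (Fintype.prod_of_injective e he _ _ (fun k hk => ?_) fun i => ?_).symm
  · rw [Function.extend_apply' _ _ _ (by simpa using hk)]
    simp
  · rw [he.extend_apply]

theorem integral_prod_block (m : Measure State) [IsProbabilityMeasure m] {n j N : ℕ}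
    (h : n * j ≤ N) {f : Config j → ℝ} (hf : Measurable f) :
    ∫ Y, ∏ b, f (block h b Y) ∂(Measure.pi fun _ : Fin N => m) =
      (∫ Y, f Y ∂(Measure.pi fun _ : Fin j => m)) ^ n := by
  have hmap : (Measure.pi fun _ : Fin N => m).map (fun Y (b : Fin n) => block h b Y) =
      Measure.pi fun _ : Fin n => Measure.pi fun _ : Fin j => m := by
    have h1 := map_pi_comp_injective m (e := fun p : Fin n × Fin j => blockIdx h p.1 p.2)
      fun p p' hp => Prod.ext ((blockIdx_inj h).1 hp).1 ((blockIdx_inj h).1 hp).2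
    have h2 := Measure.infinitePi_map_curry (fun (_ : Fin n) (_ : Fin j) => m)
    simp only [Measure.infinitePi_eq_pi] at h2
    rw [← h2, ← h1, Measure.map_map (MeasurableEquiv.measurable _) (by fun_prop)]
    rfl
  have h3 := integral_fintype_prod_eq_pow (ι := Fin n) (μ := Measure.pi fun _ : Fin j => m) f
  rw [Fintype.card_fin] at h3
  rw [← h3, ← hmap, integral_map]
  · exact (measurable_pi_lambda _ fun b => measurable_block h b).aemeasurable
  · exact (Finset.measurable_prod _ fun b _ =>
      hf.comp (measurable_pi_apply b)).aestronglyMeasurable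

/-! ### The relative entropy is of mean field type -/

/-- The relative entropy per vortex with respect to the law of independent vortices of law `m`. -/
noncomputable def relEntropy (m : Measure State) (N : ℕ) (G : ProbabilityMeasure (Config N)) :
    ℝ≥0∞ :=
  klDiv (G : Measure (Config N)) (Measure.pi fun _ : Fin N => m) / N

/-- The integrands `φ - log ∫ e^φ dm^{⊗ j}` with `φ` bounded and continuous. -/
def entropyTests (m : Measure State) (j : ℕ) : Set (Config j → ℝ) :=
  {ψ | ∃ φ : Config j → ℝ, Continuous φ ∧ (∃ C : ℝ, ∀ Y, ‖φ Y‖ ≤ C) ∧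
    ψ = fun Y => φ Y - Real.log (∫ Z, Real.exp (φ Z) ∂(Measure.pi fun _ : Fin j => m))}

theorem natCast_mul_relEntropy (m : Measure State) [IsProbabilityMeasure m] (N : ℕ)
    (G : ProbabilityMeasure (Config N)) :
    N * relEntropy m N G = klDiv (G : Measure (Config N)) (Measure.pi fun _ : Fin N => m) := by
  rcases Nat.eq_zero_or_pos N with rfl | hN
  · have : (G : Measure (Config 0)) = Measure.pi fun _ : Fin 0 => m := by
      ext s _
      rcases s.eq_empty_or_nonempty with rfl | hs
      · simp
      · rw [Subsingleton.eq_univ_of_nonempty hs, measure_univ, measure_univ]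
    rw [this, klDiv_self]
    simp
  · exact ENNReal.mul_div_cancel (by exact_mod_cast hN.ne') (ENNReal.natCast_ne_top N)

theorem entropyTests_bdd {m : Measure State} {j : ℕ} {ψ : Config j → ℝ}
    (hψ : ψ ∈ entropyTests m j) : ∃ C : ℝ, ∀ Y, ‖ψ Y‖ ≤ C := by
  obtain ⟨φ, -, ⟨C, hC⟩, rfl⟩ := hψ
  exact ⟨C + ‖_‖, fun Y => (norm_sub_le _ _).trans (add_le_add_left (hC Y) _)⟩

theorem entropyTests_cont {m : Measure State} {j : ℕ} {ψ : Config j → ℝ}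
    (hψ : ψ ∈ entropyTests m j) : Continuous ψ := by
  obtain ⟨φ, hc, -, rfl⟩ := hψ
  fun_prop

variable {m : Measure State} [IsProbabilityMeasure m]

theorem integral_exp_entropyTests {j : ℕ} {ψ : Config j → ℝ} (hψ : ψ ∈ entropyTests m j) :
    ∫ Y, Real.exp (ψ Y) ∂(Measure.pi fun _ : Fin j => m) = 1 := by
  obtain ⟨φ, hc, hb, rfl⟩ := hψ
  have hpos : 0 < ∫ Z, Real.exp (φ Z) ∂(Measure.pi fun _ : Fin j => m) :=
    integral_exp_pos (integrable_of_measurable_bounded _ hc.measurable.exp (bounded_exp hb))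
  simp_rw [Real.exp_sub, Real.exp_log hpos]
  rw [integral_div, div_self hpos.ne']

/-- The Gibbs variational inequality for tensor powers, from the one for a single factor. -/
theorem integral_pi_le_of_forall {g : Measure State} [IsProbabilityMeasure g] {κ : ℝ}
    (hκ : ∀ φ : State → ℝ, Measurable φ → (∃ C : ℝ, ∀ x, ‖φ x‖ ≤ C) →
      ∫ x, φ x ∂g ≤ κ + Real.log (∫ x, Real.exp (φ x) ∂m)) (j : ℕ) :
    ∀ φ : Config j → ℝ, Measurable φ → (∃ C : ℝ, ∀ x, ‖φ x‖ ≤ C) →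
      ∫ Y, φ Y ∂(Measure.pi fun _ : Fin j => g) ≤
        j * κ + Real.log (∫ Y, Real.exp (φ Y) ∂(Measure.pi fun _ : Fin j => m)) := by
  induction j with
  | zero =>
    intro φ _ _
    have h : ∀ Y, φ Y = φ default := fun Y => by rw [Subsingleton.elim Y default]
    simp_rw [h]
    simp
  | succ j ih =>
    intro φ hφ ⟨B, hB⟩
    let e := MeasurableEquiv.piFinSuccAbove (fun _ : Fin (j + 1) => State) 0
    have hg := (measurePreserving_piFinSuccAbove (fun _ : Fin (j + 1) => g) 0).symm
    have hm := (measurePreserving_piFinSuccAbove (fun _ : Fin (j + 1) => m) 0).symm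
    let F : State × Config j → ℝ := fun p => φ (e.symm p)
    have hF : Measurable F := hφ.comp e.symm.measurable
    have hFb : ∀ p, ‖F p‖ ≤ B := fun p => hB _
    have h1 : ∫ Y, φ Y ∂(Measure.pi fun _ : Fin (j + 1) => g) =
        ∫ Z, ∫ y, F (y, Z) ∂g ∂(Measure.pi fun _ : Fin j => g) := by
      rw [← integral_prod_symm _ (integrable_of_measurable_bounded _ hF ⟨B, hFb⟩)]
      exact (hg.integral_comp' φ).symm
    have h2 : ∫ Y, Real.exp (φ Y) ∂(Measure.pi fun _ : Fin (j + 1) => m) =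
        ∫ Z, ∫ y, Real.exp (F (y, Z)) ∂m ∂(Measure.pi fun _ : Fin j => m) := by
      rw [← integral_prod_symm (fun p => Real.exp (F p))
        (integrable_of_measurable_bounded _ hF.exp (bounded_exp ⟨B, hFb⟩))]
      exact (hm.integral_comp' (fun Y => Real.exp (φ Y))).symm
    have hFz : ∀ Z, Measurable fun y => F (y, Z) := fun Z => hF.comp (by fun_prop)
    have hEi : ∀ Z, Integrable (fun y => Real.exp (F (y, Z))) m := fun Z =>
      integrable_of_measurable_bounded _ (hFz Z).exp (bounded_exp ⟨B, fun y => hFb _⟩)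
    have hEpos : ∀ Z, 0 < ∫ y, Real.exp (F (y, Z)) ∂m := fun Z => integral_exp_pos (hEi Z)
    let L : Config j → ℝ := fun Z => Real.log (∫ y, Real.exp (F (y, Z)) ∂m)
    have hLm : Measurable L := by
      refine Measurable.log ?_
      exact (hF.exp.stronglyMeasurable.integral_prod_left (μ := m)).measurable
    have hLb : ∀ Z, ‖L Z‖ ≤ B := fun Z => by
      rw [Real.norm_eq_abs, abs_le]
      constructor
      · refine (Real.le_log_iff_exp_le (hEpos Z)).2 ?_
        have := integral_mono (integrable_const (μ := m) (Real.exp (-B))) (hEi Z)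
          fun y => Real.exp_le_exp.2 (abs_le.1 (hFb (y, Z))).1
        simpa using this
      · refine (Real.log_le_iff_le_exp (hEpos Z)).2 ?_
        have := integral_mono (hEi Z) (integrable_const (μ := m) (Real.exp B))
          fun y => Real.exp_le_exp.2 (abs_le.1 (hFb (y, Z))).2
        simpa using this
    have hLi := integrable_of_measurable_bounded (Measure.pi fun _ : Fin j => g) hLm ⟨B, hLb⟩
    calc ∫ Y, φ Y ∂(Measure.pi fun _ : Fin (j + 1) => g)
        = ∫ Z, ∫ y, F (y, Z) ∂g ∂(Measure.pi fun _ : Fin j => g) := h1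
      _ ≤ ∫ Z, (κ + L Z) ∂(Measure.pi fun _ : Fin j => g) := by
          refine integral_mono ?_ ((integrable_const κ).add hLi) fun Z =>
            hκ _ (hFz Z) ⟨B, fun y => hFb _⟩
          exact (integrable_of_measurable_bounded (g.prod _) hF ⟨B, hFb⟩).integral_prod_right
      _ = κ + ∫ Z, L Z ∂(Measure.pi fun _ : Fin j => g) := by
          rw [integral_add (integrable_const κ) hLi]
          simp
      _ ≤ κ + (j * κ + Real.log (∫ Z, Real.exp (L Z) ∂(Measure.pi fun _ : Fin j => m))) := by
          gcongr
          exact ih L hLm ⟨B, hLb⟩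
      _ = _ := by
          simp_rw [L, Real.exp_log (hEpos _)]
          rw [h2]
          push_cast
          ring

theorem meanFieldDual_relEntropy (m : Measure State) [IsProbabilityMeasure m] :
    MeanFieldDual (entropyTests m) (relEntropy m) where
  cont j ψ hψ := entropyTests_cont hψ
  bdd j ψ hψ := entropyTests_bdd hψ
  zero_mem := ⟨fun _ => 0, continuous_const, ⟨0, by simp⟩, by simp⟩
  strong j _ G := by
    rw [natCast_mul_relEntropy]
    refine klDiv_le_of_forall_continuous fun φ hφ hb => ?_
    refine le_trans (le_of_eq ?_) (le_iSup₂ (f := fun ψ (_ : ψ ∈ entropyTests m j) =>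
      ENNReal.ofReal (∫ Y, ψ Y ∂(G : Measure (Config j)))) _ ⟨φ, hφ, hb, rfl⟩)
    rw [integral_sub (integrable_of_continuous_bounded _ hφ hb) (integrable_const _)]
    simp
  blocks n j N h ψ hψ G := by
    rw [natCast_mul_relEntropy]
    obtain ⟨C, hC⟩ := entropyTests_bdd hψ
    have hψm := (entropyTests_cont hψ).measurable
    have h1 := ofReal_integral_sub_log_le_klDiv (G := (G : Measure (Config N)))
      (μ := Measure.pi fun _ : Fin N => m) (φ := fun Y => ∑ b, ψ (block h b Y))
      (Finset.measurable_sum _ fun b _ => hψm.comp (measurable_block h b))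
      ⟨∑ _b : Fin n, C, fun Y => norm_sum_le_of_le _ fun b _ => hC _⟩
    have h2 := integral_prod_block m h hψm.exp
    rw [integral_exp_entropyTests hψ, one_pow] at h2
    simp_rw [Real.exp_sum, h2, Real.log_one, sub_zero] at h1
    exact h1
  tensor j hj ψ hψ g := by
    have hj0 : (j : ℝ≥0∞) ≠ 0 := by exact_mod_cast (by omega : j ≠ 0)
    have hK : relEntropy m 1 (tensorPower g 1) =
        klDiv (tensorPower g 1 : Measure (Config 1)) (Measure.pi fun _ : Fin 1 => m) := by
      rw [← natCast_mul_relEntropy, Nat.cast_one, one_mul]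
    rw [hK]
    by_cases htop : klDiv (tensorPower g 1 : Measure (Config 1)) (Measure.pi fun _ : Fin 1 => m) = ⊤
    · rw [htop, ENNReal.mul_top hj0]
      exact le_top
    have h1 := integral_pi_le_of_forall (m := m) (g := (g : Measure State))
      (κ := (klDiv (tensorPower g 1 : Measure (Config 1))
        (Measure.pi fun _ : Fin 1 => m)).toReal) ?_ j ψ (entropyTests_cont hψ).measurable
        (entropyTests_bdd hψ)
    · rw [integral_exp_entropyTests hψ, Real.log_one, add_zero] at h1
      refine (ENNReal.ofReal_le_ofReal h1).trans (le_of_eq ?_)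
      rw [ENNReal.ofReal_mul (by positivity), ENNReal.ofReal_natCast, ENNReal.ofReal_toReal htop]
    · intro φ hφ ⟨C, hC⟩
      have h2 := ofReal_integral_sub_log_le_klDiv (G := (tensorPower g 1 : Measure (Config 1)))
        (μ := Measure.pi fun _ : Fin 1 => m) (φ := fun Y => φ (Y 0))
        (hφ.comp (measurable_pi_apply 0)) ⟨C, fun Y => hC _⟩
      have h3 := (ENNReal.ofReal_le_iff_le_toReal htop).1 h2
      have h4 : ∀ (ν : Measure State) [IsProbabilityMeasure ν] (f : State → ℝ), Measurable f →
          ∫ Y, f (Y 0) ∂(Measure.pi fun _ : Fin 1 => ν) = ∫ y, f y ∂ν := fun ν _ f hf =>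
        integral_comp_eval (μ := fun _ : Fin 1 => ν) (i := 0) hf.aestronglyMeasurable
      rw [h4 m (fun y => Real.exp (φ y)) hφ.exp] at h3
      have h5 := h4 (g : Measure State) φ hφ
      simp only [tensorPower, ProbabilityMeasure.toMeasure_pi] at h3 ⊢
      rw [h5] at h3
      linarith
  max p ψ hψ := by
    refine ⟨Real.log (p + 1), fun j hj G => ?_⟩
    have hj0 : (0 : ℝ) < j := by exact_mod_cast hj
    have hψm : ∀ i, Measurable (ψ i) := fun i => (entropyTests_cont (hψ i)).measurable
    choose C hC using fun i => entropyTests_bdd (hψ i)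
    let S : Fin (p + 1) → Config j → ℝ := fun i Y => ∑ l, ψ i (fun _ => Y l)
    let F : Config j → ℝ := fun Y => Finset.univ.sup' Finset.univ_nonempty (fun i => S i Y)
    have hSm : ∀ i, Measurable (S i) := fun i =>
      Finset.measurable_sum _ fun l _ => (hψm i).comp (by fun_prop)
    have hSb : ∀ i Y, ‖S i Y‖ ≤ ∑ _l : Fin j, C i := fun i Y =>
      norm_sum_le_of_le _ fun l _ => hC i _
    have hFm : Measurable F := by
      have := Finset.measurable_sup' (s := (Finset.univ : Finset (Fin (p + 1))))
        Finset.univ_nonempty (f := S) (fun i _ => hSm i)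
      convert this using 1
      funext g
      simp [F]
    have hFe : ∀ Y, ∃ i, F Y = S i Y := fun Y => by
      obtain ⟨i, -, hi⟩ := Finset.exists_mem_eq_sup' Finset.univ_nonempty (fun i => S i Y)
      exact ⟨i, hi⟩
    have hFb : ∀ Y, ‖F Y‖ ≤ ∑ i, ∑ _l : Fin j, C i := fun Y => by
      obtain ⟨i, hi⟩ := hFe Y
      rw [hi]
      exact (hSb i Y).trans (Finset.single_le_sum (f := fun i => ∑ _l : Fin j, C i)
        (fun k _ => (norm_nonneg _).trans (hSb k Y)) (Finset.mem_univ i))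
    have hSe : ∀ i, Integrable (fun Y => Real.exp (S i Y)) (Measure.pi fun _ : Fin j => m) :=
      fun i => integrable_of_measurable_bounded _ (hSm i).exp (bounded_exp ⟨_, hSb i⟩)
    have hS1 : ∀ i, ∫ Y, Real.exp (S i Y) ∂(Measure.pi fun _ : Fin j => m) = 1 := fun i => by
      have h1 : ∫ y, Real.exp (ψ i (fun _ => y)) ∂m = 1 := by
        rw [← integral_exp_entropyTests (hψ i)]
        rw [← integral_comp_eval (μ := fun _ : Fin 1 => m) (i := 0)
          (f := fun y => Real.exp (ψ i (fun _ => y)))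
          ((hψm i).comp (by fun_prop)).exp.aestronglyMeasurable]
        refine integral_congr_ae (Eventually.of_forall fun Y => ?_)
        simp only
        congr 2
        funext q
        rw [Subsingleton.elim q 0]
      simp only [S, Real.exp_sum]
      rw [integral_fintype_prod_eq_pow (fun y => Real.exp (ψ i (fun _ => y))), h1, one_pow]
    have hexpF : ∫ Y, Real.exp (F Y) ∂(Measure.pi fun _ : Fin j => m) ≤ p + 1 := by
      have h1 := integral_mono (μ := Measure.pi fun _ : Fin j => m)
        (integrable_of_measurable_bounded _ hFm.exp (bounded_exp ⟨_, hFb⟩))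
        (integrable_finsetSum Finset.univ fun i _ => hSe i) (fun Y => by
          obtain ⟨i, hi⟩ := hFe Y
          simp only [hi]
          exact Finset.single_le_sum (f := fun i => Real.exp (S i Y))
            (fun k _ => (Real.exp_pos _).le) (Finset.mem_univ i))
      rw [integral_finsetSum _ fun i _ => hSe i] at h1
      simpa [hS1] using h1
    have hpos : 0 < ∫ Y, Real.exp (F Y) ∂(Measure.pi fun _ : Fin j => m) :=
      integral_exp_pos (integrable_of_measurable_bounded _ hFm.exp (bounded_exp ⟨_, hFb⟩))
    have h1 := ofReal_integral_sub_log_le_klDiv (G := (G : Measure (Config j)))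
      (μ := Measure.pi fun _ : Fin j => m) hFm ⟨_, hFb⟩
    rw [relEntropy, ENNReal.le_div_iff_mul_le (Or.inl (by exact_mod_cast hj0.ne'))
      (Or.inl (ENNReal.natCast_ne_top j)), ← ENNReal.ofReal_natCast,
      ← ENNReal.ofReal_mul' hj0.le]
    refine le_trans (ENNReal.ofReal_le_ofReal ?_) h1
    change ((j : ℝ)⁻¹ * ∫ Y, F Y ∂(G : Measure (Config j)) - Real.log (p + 1) / √j) * j ≤ _
    have hlog : Real.log (∫ Y, Real.exp (F Y) ∂(Measure.pi fun _ : Fin j => m)) ≤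
        Real.log (p + 1) := Real.log_le_log hpos hexpF
    have hlog0 : 0 ≤ Real.log ((p : ℝ) + 1) :=
      Real.log_nonneg (by linarith [p.cast_nonneg (α := ℝ)])
    have hsq : 1 ≤ √(j : ℝ) := Real.one_le_sqrt.2 (by exact_mod_cast hj)
    have hmul : Real.log ((p : ℝ) + 1) / √j * j = Real.log (p + 1) * √j := by
      rw [div_mul_eq_mul_div, mul_div_assoc, Real.div_sqrt]
    rw [sub_mul, hmul, mul_comm, mul_inv_cancel_left₀ hj0.ne']
    nlinarith

/-! ### Integrals of extended real functions and of kernels of relative entropies -/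

section ExtIntegral

variable {α : Type*} [MeasurableSpace α] {μ : Measure α}

theorem extIntegral_congr_ae {φ ψ : α → EReal} (h : φ =ᵐ[μ] ψ) :
    extIntegral μ φ = extIntegral μ ψ := by
  unfold extIntegral
  rw [lintegral_congr_ae (h.mono fun a ha => congrArg EReal.toENNReal ha),
    lintegral_congr_ae (h.mono fun a ha => congrArg (fun y : EReal => (-y).toENNReal) ha)]

/-- The integral of the difference of a nonnegative function and an integrable real function. -/
theorem extIntegral_coe_sub {a : α → ℝ≥0∞} {b : α → ℝ} (ha : AEMeasurable a μ)
    (hb : Integrable b μ) :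
    extIntegral μ (fun x => (a x : EReal) - (b x : EReal)) =
      ((∫⁻ x, a x ∂μ : ℝ≥0∞) : EReal) - ((∫ x, b x ∂μ : ℝ) : EReal) := by
  have hpt : ∀ x, ((a x : EReal) - (b x : EReal)).toENNReal + ENNReal.ofReal (b x) =
      (-((a x : EReal) - (b x : EReal))).toENNReal + a x + ENNReal.ofReal (-b x) := fun x => by
    rcases eq_or_ne (a x) ⊤ with h | h
    · simp [h]
    · lift a x to NNReal using h with y
      have h1 : (((y : ℝ≥0∞) : EReal) - (b x : EReal)) = (((y : ℝ) - b x : ℝ) : EReal) := rfl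
      rw [h1, ← EReal.coe_neg, EReal.toENNReal_of_ne_top (EReal.coe_ne_top _),
        EReal.toENNReal_of_ne_top (EReal.coe_ne_top _), EReal.toReal_coe, EReal.toReal_coe]
      rw [← ENNReal.ofReal_coe_nnreal]
      have hy : (0 : ℝ) ≤ y := y.2
      rcases le_total 0 (b x) with hb0 | hb0
      · rw [ENNReal.ofReal_of_nonpos (by linarith : -b x ≤ 0), add_zero]
        rcases le_total (b x) y with h2 | h2
        · rw [ENNReal.ofReal_of_nonpos (by linarith : -((y : ℝ) - b x) ≤ 0), zero_add,
            ← ENNReal.ofReal_add (by linarith) hb0, sub_add_cancel]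
        · rw [ENNReal.ofReal_of_nonpos (by linarith : (y : ℝ) - b x ≤ 0), zero_add,
            ← ENNReal.ofReal_add (by linarith) hy, neg_sub, sub_add_cancel]
      · rw [ENNReal.ofReal_of_nonpos hb0,
          ENNReal.ofReal_of_nonpos (by linarith : -((y : ℝ) - b x) ≤ 0), zero_add, add_zero,
          ← ENNReal.ofReal_add hy (by linarith : 0 ≤ -b x), sub_eq_add_neg]
  have hneg : ∀ x, (-((a x : EReal) - (b x : EReal))).toENNReal ≤ ENNReal.ofReal (b x) :=
      fun x => by
    rw [← EReal.real_coe_toENNReal]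
    refine EReal.toENNReal_le_toENNReal ?_
    rw [EReal.neg_sub (by simp) (by simp), add_comm, ← sub_eq_add_neg]
    exact EReal.sub_le_of_le_add (le_add_of_nonneg_right (EReal.coe_ennreal_nonneg _))
  have ham : AEMeasurable (fun x => (a x : EReal)) μ := ha.coe_ereal_ennreal
  have hbm : AEMeasurable (fun x => (b x : EReal)) μ :=
    hb.aestronglyMeasurable.aemeasurable.coe_real_ereal
  have hsm : AEMeasurable (fun x => (a x : EReal) - (b x : EReal)) μ := ham.sub hbm
  have hnm : AEMeasurable (fun x => ENNReal.ofReal (-b x)) μ :=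
    hb.neg.aestronglyMeasurable.aemeasurable.ennreal_ofReal
  have hint := lintegral_congr (μ := μ) hpt
  rw [lintegral_add_right' _ (hb.aestronglyMeasurable.aemeasurable.ennreal_ofReal),
    lintegral_add_right' _ hnm,
    lintegral_add_right' _ ha] at hint
  have hb1 : ∫⁻ x, ENNReal.ofReal (b x) ∂μ ≠ ⊤ := hb.lintegral_lt_top.ne
  have hb2 : ∫⁻ x, ENNReal.ofReal (-b x) ∂μ ≠ ⊤ := hb.neg.lintegral_lt_top.ne
  have hq : ∫⁻ x, (-((a x : EReal) - (b x : EReal))).toENNReal ∂μ ≠ ⊤ :=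
    ((lintegral_mono hneg).trans_lt hb1.lt_top).ne
  rw [integral_eq_lintegral_pos_part_sub_lintegral_neg_part hb]
  unfold extIntegral
  generalize ∫⁻ x, ((a x : EReal) - (b x : EReal)).toENNReal ∂μ = p at *
  generalize ∫⁻ x, (-((a x : EReal) - (b x : EReal))).toENNReal ∂μ = q at *
  generalize ∫⁻ x, a x ∂μ = A at *
  generalize ∫⁻ x, ENNReal.ofReal (b x) ∂μ = b1 at *
  generalize ∫⁻ x, ENNReal.ofReal (-b x) ∂μ = b2 at *
  rcases eq_or_ne A ⊤ with hA | hA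
  · have hp : p = ⊤ := by
      rw [hA] at hint
      by_contra hp
      exact (ENNReal.add_ne_top.2 ⟨hp, hb1⟩) (by rw [hint]; simp)
    lift q to NNReal using hq
    rw [hA, hp]
    rfl
  · have hp : p ≠ ⊤ := by
      intro hp
      rw [hp, top_add] at hint
      exact (ENNReal.add_ne_top.2 ⟨ENNReal.add_ne_top.2 ⟨hq, hA⟩, hb2⟩) hint.symm
    lift p to NNReal using hp
    lift q to NNReal using hq
    lift A to NNReal using hA
    lift b1 to NNReal using hb1
    lift b2 to NNReal using hb2
    have hint' : (p : ℝ) + b1 = q + A + b2 := by exact_mod_cast hint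
    change (((p : ℝ) - q : ℝ) : EReal) = (((A : ℝ) - ((b1 : ℝ) - b2) : ℝ) : EReal)
    rw [EReal.coe_eq_coe_iff]
    linarith

end ExtIntegral

section Kernels

variable {α β : Type*} [MeasurableSpace α] [MeasurableSpace β] [StandardBorelSpace β]
  {κ η : Kernel α β} [IsMarkovKernel κ] [IsMarkovKernel η]

theorem klDiv_kernel_eq_of_ac {a : α} (h : κ a ≪ η a) :
    klDiv (κ a) (η a) = ∫⁻ x, ENNReal.ofReal (klFun (Kernel.rnDeriv κ η a x).toReal) ∂(η a) := by
  rw [klDiv_eq_lintegral_klFun_of_ac h]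
  refine lintegral_congr_ae ?_
  filter_upwards [Kernel.rnDeriv_eq_rnDeriv_measure (κ := κ) (η := η) (a := a)] with x hx
  rw [hx]

theorem measurable_klFun_rnDeriv (κ η : Kernel α β) :
    Measurable fun p : α × β => ENNReal.ofReal (klFun (Kernel.rnDeriv κ η p.1 p.2).toReal) :=
  (measurable_klFun.comp (Kernel.measurable_rnDeriv κ η).ennreal_toReal).ennreal_ofReal

theorem measurable_klDiv_kernel : Measurable fun a => klDiv (κ a) (η a) := by
  classical
  have h : (fun a => klDiv (κ a) (η a)) = fun a => if a ∈ {a | κ a ≪ η a} then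
      ∫⁻ x, ENNReal.ofReal (klFun (Kernel.rnDeriv κ η a x).toReal) ∂(η a) else ⊤ := by
    funext a
    split_ifs with ha
    · exact klDiv_kernel_eq_of_ac ha
    · exact klDiv_of_not_ac ha
  rw [h]
  exact Measurable.ite (Kernel.measurableSet_absolutelyContinuous κ η)
    (measurable_klFun_rnDeriv κ η).lintegral_kernel_prod_right measurable_const

/-- The integral form of the conditional relative entropy. -/
theorem lintegral_klDiv_kernel (ρ : Measure α) [IsProbabilityMeasure ρ] :
    ∫⁻ a, klDiv (κ a) (η a) ∂ρ = klDiv (ρ ⊗ₘ κ) (ρ ⊗ₘ η) := by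
  by_cases hac : ∀ᵐ a ∂ρ, κ a ≪ η a
  · have hac' := Measure.absolutelyContinuous_compProd_right_iff.2 hac
    have hκ : ρ ⊗ₘ κ = (ρ ⊗ₘ η).withDensity fun p => Kernel.rnDeriv κ η p.1 p.2 := by
      have h1 : κ =ᵐ[ρ] η.withDensity (Kernel.rnDeriv κ η) := by
        filter_upwards [hac] with a ha using (Kernel.withDensity_rnDeriv_eq ha).symm
      have : IsSFiniteKernel (η.withDensity (Kernel.rnDeriv κ η)) :=
        inferInstance
      rw [Measure.compProd_congr h1, Measure.compProd_withDensity]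
      exact Kernel.measurable_rnDeriv κ η
    have hd : (ρ ⊗ₘ κ).rnDeriv (ρ ⊗ₘ η) =ᵐ[ρ ⊗ₘ η] fun p => Kernel.rnDeriv κ η p.1 p.2 := by
      rw [hκ]
      exact Measure.rnDeriv_withDensity _ (Kernel.measurable_rnDeriv κ η)
    rw [klDiv_eq_lintegral_klFun_of_ac hac',
      lintegral_congr_ae (g := fun p : α × β =>
        ENNReal.ofReal (klFun (Kernel.rnDeriv κ η p.1 p.2).toReal))
        (hd.mono fun p hp => by simp only [hp]),
      Measure.lintegral_compProd (measurable_klFun_rnDeriv κ η)]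
    refine lintegral_congr_ae ?_
    filter_upwards [hac] with a ha using klDiv_kernel_eq_of_ac ha
  · have hac' : ¬ ρ ⊗ₘ κ ≪ ρ ⊗ₘ η := fun h =>
      hac (Measure.absolutelyContinuous_compProd_right_iff.1 h)
    rw [klDiv_of_not_ac hac']
    by_contra hne
    refine hac ?_
    filter_upwards [ae_lt_top measurable_klDiv_kernel hne] with a ha
    exact (klDiv_ne_top_iff.1 ha.ne).1

end Kernels

theorem klDiv_map_measurableEquiv {X Y : Type*} [MeasurableSpace X] [MeasurableSpace Y]
    (e : X ≃ᵐ Y) (G μ : Measure X) [IsFiniteMeasure G] [IsFiniteMeasure μ] :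
    klDiv (G.map e) (μ.map e) = klDiv G μ := by
  refine le_antisymm (klDiv_map_le G μ e.measurable) ?_
  have := klDiv_map_le (G.map e) (μ.map e) e.symm.measurable
  simpa [Measure.map_map e.symm.measurable e.measurable] using this

/-! ### The Gibbs measure and the Boltzmann entropy -/

theorem one_le_bracket (x : Plane) : 1 ≤ bracket x :=
  Real.one_le_sqrt.2 (by nlinarith [sq_nonneg ‖x‖])

theorem continuous_bracket : Continuous bracket := by unfold bracket; fun_prop

theorem continuous_bracket_rpow (s : ℝ) : Continuous fun x => bracket x ^ s :=
  continuous_bracket.rpow_const fun x => Or.inl (by linarith [one_le_bracket x])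

theorem one_le_bracket_rpow {s : ℝ} (hs : 0 < s) (x : Plane) : 1 ≤ bracket x ^ s :=
  Real.one_le_rpow (one_le_bracket x) hs.le

theorem integrable_exp_neg_bracket {s : ℝ} (hs : 0 < s) :
    Integrable (fun x : Plane => Real.exp (-bracket x ^ s)) := by
  obtain ⟨n, hn⟩ := exists_nat_gt (3 / s)
  have hns : 3 < n * s := by rwa [div_lt_iff₀ hs] at hn
  have h := integrable_rpow_neg_one_add_norm_sq (E := Plane) (μ := volume) (r := n * s)
    (by simp; linarith)
  refine (h.const_mul (n.factorial : ℝ)).mono'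
    (Real.continuous_exp.comp (continuous_bracket_rpow s).neg).aestronglyMeasurable
    (Eventually.of_forall fun x => ?_)
  have hb0 : 0 < bracket x := by linarith [one_le_bracket x]
  have hu : 0 < bracket x ^ s := Real.rpow_pos_of_pos hb0 s
  rw [Real.norm_of_nonneg (Real.exp_pos _).le]
  have h1 : (bracket x ^ s) ^ n / n.factorial ≤ Real.exp (bracket x ^ s) :=
    Real.pow_div_factorial_le_exp _ hu.le n
  have h2 : ((1 : ℝ) + ‖x‖ ^ 2) ^ (-(n * s) / 2) = ((bracket x ^ s) ^ n)⁻¹ := by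
    have h3 : (bracket x ^ s) ^ n = bracket x ^ (s * n) := by
      rw [← Real.rpow_natCast, ← Real.rpow_mul hb0.le]
    rw [h3, ← Real.rpow_neg hb0.le, bracket, Real.sqrt_eq_rpow, ← Real.rpow_mul (by positivity)]
    congr 1
    ring
  rw [h2, Real.exp_neg, ← div_eq_mul_inv]
  have hf : (0 : ℝ) < n.factorial := by exact_mod_cast n.factorial_pos
  rw [div_le_iff₀ hf] at h1
  rw [inv_le_iff_one_le_mul₀ (Real.exp_pos _), div_mul_eq_mul_div, le_div_iff₀ (by positivity)]
  linarith

/-- The normalizing constant `∫ exp(-⟨x⟩^s) dx`. -/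
noncomputable def gibbsMass (s : ℝ) : ℝ := ∫ x : Plane, Real.exp (-bracket x ^ s)

theorem gibbsMass_pos {s : ℝ} (hs : 0 < s) : 0 < gibbsMass s :=
  integral_exp_pos (integrable_exp_neg_bracket hs)

/-- The probability density proportional to `exp(-⟨x⟩^s)`. -/
noncomputable def gibbsDensity (s : ℝ) (x : Plane) : ℝ :=
  (gibbsMass s)⁻¹ * Real.exp (-bracket x ^ s)

theorem gibbsDensity_pos {s : ℝ} (hs : 0 < s) (x : Plane) : 0 < gibbsDensity s x :=
  mul_pos (inv_pos.2 (gibbsMass_pos hs)) (Real.exp_pos _)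

theorem measurable_gibbsDensity (s : ℝ) : Measurable (gibbsDensity s) :=
  ((Real.continuous_exp.comp (continuous_bracket_rpow s).neg).const_mul _).measurable

theorem integrable_gibbsDensity {s : ℝ} (hs : 0 < s) : Integrable (gibbsDensity s) :=
  (integrable_exp_neg_bracket hs).const_mul _

theorem integral_gibbsDensity {s : ℝ} (hs : 0 < s) : ∫ x, gibbsDensity s x = 1 := by
  unfold gibbsDensity
  rw [integral_const_mul]
  exact inv_mul_cancel₀ (gibbsMass_pos hs).ne'

theorem log_gibbsDensity {s : ℝ} (hs : 0 < s) (x : Plane) :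
    Real.log (gibbsDensity s x) = -bracket x ^ s - Real.log (gibbsMass s) := by
  rw [gibbsDensity, Real.log_mul (inv_pos.2 (gibbsMass_pos hs)).ne' (Real.exp_pos _).ne',
    Real.log_inv, Real.log_exp]
  ring

/-- The probability measure with density proportional to `exp(-⟨x⟩^s)`. -/
noncomputable def gibbs (s : ℝ) : Measure Plane :=
  volume.withDensity fun x => ENNReal.ofReal (gibbsDensity s x)

theorem isProbabilityMeasure_gibbs {s : ℝ} (hs : 0 < s) : IsProbabilityMeasure (gibbs s) := by
  constructor
  rw [gibbs, withDensity_apply _ MeasurableSet.univ, Measure.restrict_univ,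
    ← ofReal_integral_eq_lintegral_ofReal (integrable_gibbsDensity hs)
      (Eventually.of_forall fun x => (gibbsDensity_pos hs x).le), integral_gibbsDensity hs,
    ENNReal.ofReal_one]

theorem withDensity_ofReal_apply {X : Type*} [MeasurableSpace X] {μ : Measure X} {f : X → ℝ}
    (hf : Integrable f μ) (h0 : ∀ x, 0 ≤ f x) {t : Set X} (ht : MeasurableSet t) :
    μ.withDensity (fun x => ENNReal.ofReal (f x)) t =
      ENNReal.ofReal (∫ x, t.indicator f x ∂μ) := by
  rw [withDensity_apply _ ht, integral_indicator ht,
    ofReal_integral_eq_lintegral_ofReal hf.integrableOn (Eventually.of_forall h0)]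

/-- The density of a power of a measure is the product of the densities. -/
theorem pi_withDensity_ofReal {ι X : Type*} [Fintype ι] [MeasurableSpace X] (μ : Measure X)
    [SigmaFinite μ] {f : X → ℝ} (hf : Integrable f μ) (h0 : ∀ x, 0 ≤ f x) :
    Measure.pi (fun _ : ι => μ.withDensity fun x => ENNReal.ofReal (f x)) =
      (Measure.pi fun _ : ι => μ).withDensity fun Y => ENNReal.ofReal (∏ i, f (Y i)) := by
  refine (Measure.pi_eq fun t ht => ?_)
  rw [withDensity_ofReal_apply (f := fun Y : ι → X => ∏ i, f (Y i))
    (Integrable.fintype_prod (f := fun _ => f) fun _ => hf)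
    (fun Y => Finset.prod_nonneg fun i _ => h0 _) (MeasurableSet.univ_pi ht)]
  have h1 : ∀ Y : ι → X, (Set.univ.pi t).indicator (fun Y : ι → X => ∏ i, f (Y i)) Y =
      ∏ i, (t i).indicator f (Y i) := fun Y => by
    by_cases hY : Y ∈ Set.univ.pi t
    · rw [Set.indicator_of_mem hY]
      exact Finset.prod_congr rfl fun i _ =>
        (Set.indicator_of_mem (hY i (Set.mem_univ i)) f).symm
    · rw [Set.indicator_of_notMem hY]
      simp only [Set.mem_univ_pi, not_forall] at hY
      obtain ⟨i, hi⟩ := hY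
      exact (Finset.prod_eq_zero (Finset.mem_univ i) (Set.indicator_of_notMem hi f)).symm
  simp_rw [h1]
  rw [integral_fintype_prod_eq_prod (fun i => (t i).indicator f),
    ENNReal.ofReal_prod_of_nonneg fun i _ => integral_nonneg fun x =>
      Set.indicator_nonneg (fun x _ => h0 x) x]
  exact Finset.prod_congr rfl fun i _ => (withDensity_ofReal_apply hf h0 (ht i)).symm

theorem mul_klFun_div {f ρ : ℝ} (hρ : 0 < ρ) (hf : 0 ≤ f) :
    ρ * klFun (f / ρ) - (ρ - f - f * Real.log ρ) = f * Real.log f := by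
  rcases hf.eq_or_lt with rfl | hf
  · simp [klFun_zero]
  · rw [klFun_apply, Real.log_div hf.ne' hρ.ne']
    field_simp
    ring

/-- The entropy is the relative entropy with respect to independent positions with density
proportional to `exp(-⟨x⟩^s)`, up to a moment and a constant. -/
theorem entropy_eq_klDiv_sub {s : ℝ} (hs : 0 < s) {N : ℕ} (hN : 1 ≤ N)
    (F : Measure (Fin N → Plane)) [IsProbabilityMeasure F]
    (hF : Integrable (fun X : Fin N → Plane => ∑ i, bracket (X i) ^ s) F) :
    entropy F = ((klDiv F (Measure.pi fun _ : Fin N => gibbs s) / N : ℝ≥0∞) : EReal) -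
      (((N : ℝ)⁻¹ * ∫ X, ∑ i, bracket (X i) ^ s ∂F + Real.log (gibbsMass s) : ℝ) : EReal) := by
  have hprob := isProbabilityMeasure_gibbs hs
  have hN0 : (0 : ℝ) < N := by exact_mod_cast hN
  let ρ : (Fin N → Plane) → ℝ := fun X => ∏ i, gibbsDensity s (X i)
  have hρ0 : ∀ X, 0 < ρ X := fun X => Finset.prod_pos fun i _ => gibbsDensity_pos hs _
  have hρm : Measurable ρ := Finset.measurable_prod _ fun i _ =>
    (measurable_gibbsDensity s).comp (measurable_pi_apply i)
  have hpi : (Measure.pi fun _ : Fin N => gibbs s) =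
      (volume : Measure (Fin N → Plane)).withDensity fun X => ENNReal.ofReal (ρ X) :=
    pi_withDensity_ofReal volume (integrable_gibbsDensity hs) fun x => (gibbsDensity_pos hs x).le
  have hdivN : ∀ a : ℝ≥0∞, ((a / N : ℝ≥0∞) : EReal) = (((N : ℝ)⁻¹ : ℝ) : EReal) * (a : EReal) := by
    intro a
    rw [div_eq_mul_inv, mul_comm, EReal.coe_ennreal_mul]
    congr 1
    rw [← ENNReal.ofReal_natCast, ← ENNReal.ofReal_inv_of_pos hN0, EReal.coe_ennreal_ofReal,
      max_eq_left (inv_pos.2 hN0).le]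
  by_cases hac : F ≪ volume
  · have hρi : Integrable ρ := Integrable.fintype_prod (f := fun _ => gibbsDensity s)
      fun _ => integrable_gibbsDensity hs
    have hρ1 : ∫ X, ρ X = 1 := by
      have := integral_fintype_prod_volume_eq_pow (ι := Fin N) (gibbsDensity s)
      simp only [integral_gibbsDensity hs, one_pow] at this
      exact this
    have hfm : Measurable (density F) := (Measure.measurable_rnDeriv F volume).ennreal_toReal
    have hf0 : ∀ X, 0 ≤ density F X := fun X => ENNReal.toReal_nonneg
    have hfi : Integrable (density F) := Measure.integrable_toReal_rnDeriv
    have hf1 : ∫ X, density F X = 1 := by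
      have := Measure.integral_toReal_rnDeriv hac
      simpa [density] using this
    have hlog : ∀ X, Real.log (ρ X) = -(∑ i, bracket (X i) ^ s) - N * Real.log (gibbsMass s) := by
      intro X
      simp only [ρ]
      rw [Real.log_prod fun i _ => (gibbsDensity_pos hs _).ne']
      simp_rw [log_gibbsDensity hs]
      simp [Finset.sum_sub_distrib]
    have hlogF : Integrable (fun X => Real.log (ρ X)) F := by
      simp_rw [hlog]
      exact hF.neg.sub (integrable_const _)
    have hflog : Integrable (fun X => density F X * Real.log (ρ X)) := by
      have := (integrable_rnDeriv_smul_iff hac (f := fun X => Real.log (ρ X))).2 hlogF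
      simpa [density] using this
    have hflogI : ∫ X, density F X * Real.log (ρ X) =
        -(∫ X, ∑ i, bracket (X i) ^ s ∂F) - N * Real.log (gibbsMass s) := by
      have := integral_rnDeriv_smul hac (f := fun X => Real.log (ρ X))
      simp only [smul_eq_mul] at this
      refine this.trans ?_
      simp_rw [hlog]
      have hFn : Integrable (fun X : Fin N → Plane => -∑ i, bracket (X i) ^ s) F := hF.neg
      rw [integral_sub hFn (integrable_const _), integral_neg]
      simp
    let b : (Fin N → Plane) → ℝ := fun X => ρ X - density F X - density F X * Real.log (ρ X)
    have hb : Integrable b := (hρi.sub hfi).sub hflog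
    have hbI : ∫ X, b X = ∫ X, ∑ i, bracket (X i) ^ s ∂F + N * Real.log (gibbsMass s) := by
      simp only [b]
      rw [integral_sub (f := fun X => ρ X - density F X) (hρi.sub hfi) hflog,
        integral_sub hρi hfi, hρ1, hf1, hflogI]
      ring
    let a : (Fin N → Plane) → ℝ≥0∞ := fun X =>
      ENNReal.ofReal (ρ X * klFun (density F X / ρ X))
    have ham : Measurable a :=
      (hρm.mul (measurable_klFun.comp (hfm.div hρm))).ennreal_ofReal
    have hkl : klDiv F (Measure.pi fun _ : Fin N => gibbs s) = ∫⁻ X, a X := by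
      have hac2 : F ≪ Measure.pi fun _ : Fin N => gibbs s := by
        rw [hpi]
        exact hac.trans (withDensity_absolutelyContinuous' hρm.ennreal_ofReal.aemeasurable
          (Eventually.of_forall fun X => by simpa using hρ0 X))
      have hd := Measure.rnDeriv_withDensity_right F volume (f := fun X => ENNReal.ofReal (ρ X))
        hρm.ennreal_ofReal.aemeasurable (Eventually.of_forall fun X => by simpa using hρ0 X)
        (Eventually.of_forall fun X => by simp)
      have hkm : Measurable fun X => ENNReal.ofReal (klFun ((F.rnDeriv
          ((volume : Measure (Fin N → Plane)).withDensity
            fun X => ENNReal.ofReal (ρ X))) X).toReal) :=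
        (measurable_klFun.comp (Measure.measurable_rnDeriv _ _).ennreal_toReal).ennreal_ofReal
      rw [klDiv_eq_lintegral_klFun_of_ac hac2, hpi,
        lintegral_withDensity_eq_lintegral_mul _ hρm.ennreal_ofReal hkm]
      refine lintegral_congr_ae ?_
      filter_upwards [hd] with X hX
      simp only [Pi.mul_apply, a]
      rw [hX, ENNReal.toReal_mul, ENNReal.toReal_inv, ENNReal.toReal_ofReal (hρ0 X).le,
        ← ENNReal.ofReal_mul (hρ0 X).le, inv_mul_eq_div]
      rfl
    have hent : extIntegral volume
        (fun X => ((density F X * Real.log (density F X) : ℝ) : EReal)) =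
        ((klDiv F (Measure.pi fun _ : Fin N => gibbs s) : ℝ≥0∞) : EReal) -
          ((∫ X, ∑ i, bracket (X i) ^ s ∂F + N * Real.log (gibbsMass s) : ℝ) : EReal) := by
      rw [hkl, ← hbI, ← extIntegral_coe_sub ham.aemeasurable hb]
      congr 1
      funext X
      have h1 := mul_klFun_div (hρ0 X) (hf0 X)
      rw [← h1, EReal.coe_sub]
      congr 1
      rw [EReal.coe_ennreal_ofReal, max_eq_left]
      exact mul_nonneg (hρ0 X).le (klFun_nonneg (div_nonneg (hf0 X) (hρ0 X).le))
    rw [entropy, if_pos hac, hent, hdivN, EReal.mul_sub_of_nonneg_of_ne_top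
      (EReal.coe_nonneg.2 (inv_pos.2 hN0).le) (EReal.coe_ne_top _), ← EReal.coe_mul]
    congr 2
    field_simp
  · have hac2 : ¬ F ≪ Measure.pi fun _ : Fin N => gibbs s := fun h =>
      hac (h.trans (by rw [hpi]; exact withDensity_absolutelyContinuous _ _))
    rw [entropy, if_neg hac, klDiv_of_not_ac hac2, hdivN, EReal.coe_ennreal_top,
      EReal.coe_mul_top_of_pos (inv_pos.2 hN0), EReal.top_sub_coe]

/-! ### The partial entropy as a relative entropy -/

theorem measurable_circ {N : ℕ} : Measurable (circ : Config N → Fin N → ℝ) := by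
  unfold circ; fun_prop

theorem measurable_pos {N : ℕ} : Measurable (pos : Config N → Fin N → Plane) := by
  unfold pos; fun_prop

theorem continuous_circ {N : ℕ} : Continuous (circ : Config N → Fin N → ℝ) := by
  unfold circ; fun_prop

theorem continuous_pos {N : ℕ} : Continuous (pos : Config N → Fin N → Plane) := by
  unfold pos; fun_prop

instance {N : ℕ} (G : ProbabilityMeasure (Config N)) : IsProbabilityMeasure (circLaw G) :=
  Measure.isProbabilityMeasure_map measurable_circ.aemeasurable

instance {N : ℕ} (G : ProbabilityMeasure (Config N)) : IsMarkovKernel (condPos G) := by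
  unfold condPos; infer_instance

/-- The disintegration `G(dM,dX) = R(dM) F^M(dX)`. -/
theorem circLaw_compProd_condPos {N : ℕ} (G : ProbabilityMeasure (Config N)) :
    circLaw G ⊗ₘ condPos G = (G : Measure (Config N)).map fun Y => (circ Y, pos Y) :=
  compProd_map_condDistrib measurable_pos.aemeasurable

theorem measurable_circ_pos {N : ℕ} :
    Measurable fun Y : Config N => (circ Y, pos Y) := measurable_circ.prodMk measurable_pos

theorem partialEntropy_eq_relEntropy_sub {s : ℝ} (hs : 0 < s) {N : ℕ} (hN : 1 ≤ N)
    (r : ProbabilityMeasure ℝ) (G : ProbabilityMeasure (Config N))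
    (hR : circLaw G = Measure.pi fun _ : Fin N => (r : Measure ℝ))
    (hmom : Integrable (fun Y : Config N => ∑ i, bracket (pos Y i) ^ s)
      (G : Measure (Config N))) :
    partialEntropy G = (relEntropy ((r : Measure ℝ).prod (gibbs s)) N G : EReal) -
      (((N : ℝ)⁻¹ * ∫ Y, ∑ i, bracket (pos Y i) ^ s ∂(G : Measure (Config N)) +
        Real.log (gibbsMass s) : ℝ) : EReal) := by
  have hprob := isProbabilityMeasure_gibbs hs
  let S : (Fin N → Plane) → ℝ := fun X => ∑ i, bracket (X i) ^ s
  have hSc : Continuous S := continuous_finsetSum _ fun i _ =>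
    (continuous_bracket_rpow s).comp (continuous_apply i)
  have hcp := circLaw_compProd_condPos G
  have hS2 : AEStronglyMeasurable (fun p : (Fin N → ℝ) × (Fin N → Plane) => S p.2)
      ((G : Measure (Config N)).map fun Y => (circ Y, pos Y)) :=
    (hSc.comp continuous_snd).aestronglyMeasurable
  have hSi : Integrable (fun p : (Fin N → ℝ) × (Fin N → Plane) => S p.2)
      (circLaw G ⊗ₘ condPos G) := by
    rw [hcp, integrable_map_measure hS2 measurable_circ_pos.aemeasurable]
    exact hmom
  have hSI : ∫ Y, ∑ i, bracket (pos Y i) ^ s ∂(G : Measure (Config N)) =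
      ∫ M, ∫ X, S X ∂(condPos G M) ∂(circLaw G) := by
    rw [← Measure.integral_compProd hSi, hcp,
      integral_map measurable_circ_pos.aemeasurable hS2]
  let b : (Fin N → ℝ) → ℝ := fun M =>
    (N : ℝ)⁻¹ * ∫ X, S X ∂(condPos G M) + Real.log (gibbsMass s)
  let η : Kernel (Fin N → ℝ) (Fin N → Plane) :=
    Kernel.const _ (Measure.pi fun _ : Fin N => gibbs s)
  let a : (Fin N → ℝ) → ℝ≥0∞ := fun M => klDiv (condPos G M) (η M) / N
  have hent : (fun M => entropy (condPos G M)) =ᵐ[circLaw G]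
      fun M => (a M : EReal) - (b M : EReal) := by
    have h1 := ((Measure.integrable_compProd_iff hSi.aestronglyMeasurable).1 hSi).1
    filter_upwards [h1] with M hM
    exact entropy_eq_klDiv_sub hs hN _ hM
  have ham : Measurable a := measurable_klDiv_kernel.div_const _
  have hb1 : Integrable (fun M => ∫ X, S X ∂(condPos G M)) (circLaw G) := by
    have h1 := ((Measure.integrable_compProd_iff hSi.aestronglyMeasurable).1 hSi).2
    refine h1.congr (Eventually.of_forall fun M => integral_congr_ae
      (Eventually.of_forall fun X => Real.norm_of_nonneg ?_))
    exact Finset.sum_nonneg fun i _ => zero_le_one.trans (one_le_bracket_rpow hs _)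
  have hb : Integrable b (circLaw G) := (hb1.const_mul _).add (integrable_const _)
  have hkl : klDiv (circLaw G ⊗ₘ condPos G) (circLaw G ⊗ₘ η) =
      klDiv (G : Measure (Config N))
        (Measure.pi fun _ : Fin N => (r : Measure ℝ).prod (gibbs s)) := by
    have he := (measurePreserving_arrowProdEquivProdArrow ℝ Plane (Fin N)
      (fun _ => (r : Measure ℝ)) (fun _ => gibbs s)).map_eq
    rw [← klDiv_map_measurableEquiv (MeasurableEquiv.arrowProdEquivProdArrow ℝ Plane (Fin N)),
      he, hcp, Measure.compProd_const, hR]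
    rfl
  rw [partialEntropy, extIntegral_congr_ae hent, extIntegral_coe_sub ham.aemeasurable hb]
  congr 2
  · rw [relEntropy]
    simp only [a]
    simp_rw [div_eq_mul_inv]
    rw [lintegral_mul_const _ measurable_klDiv_kernel, lintegral_klDiv_kernel, hkl]
  · simp only [b]
    rw [integral_add (hb1.const_mul _) (integrable_const _), integral_const_mul, ← hSI]
    simp

theorem circLaw_marginal {j N : ℕ} (h : j ≤ N) (G : ProbabilityMeasure (Config N))
    {r : ProbabilityMeasure ℝ} (hR : circLaw G = Measure.pi fun _ : Fin N => (r : Measure ℝ)) :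
    circLaw (marginal j h G) = Measure.pi fun _ : Fin j => (r : Measure ℝ) := by
  rw [circLaw, marginal, ProbabilityMeasure.toMeasure_map,
    Measure.map_map measurable_circ (measurable_firstCoords h),
    ← map_pi_comp_injective (r : Measure ℝ) (Fin.castLE_injective h), ← hR, circLaw,
    Measure.map_map (by fun_prop) measurable_circ]
  rfl

/-- The circulations of the limit laws are independent with law `r` as well. -/
theorem circLaw_eq_of_tendsto {j : ℕ} {r : ProbabilityMeasure ℝ}
    {u : ℕ → ProbabilityMeasure (Config j)} {G : ProbabilityMeasure (Config j)}
    (hu : ∀ᶠ n in atTop, circLaw (u n) = Measure.pi fun _ : Fin j => (r : Measure ℝ))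
    (hlim : Tendsto u atTop (𝓝 G)) :
    circLaw G = Measure.pi fun _ : Fin j => (r : Measure ℝ) := by
  have h1 := ProbabilityMeasure.tendsto_map_of_tendsto_of_continuous u G hlim continuous_circ
  have h2 : Tendsto (fun n => (u n).map (f := circ) measurable_circ.aemeasurable) atTop
      (𝓝 (ProbabilityMeasure.pi fun _ : Fin j => r)) := by
    refine tendsto_const_nhds.congr' ?_
    filter_upwards [hu] with n hn
    refine Subtype.ext ?_
    exact hn.symm
  exact congrArg (fun μ : ProbabilityMeasure (Fin j → ℝ) => (μ : Measure (Fin j → ℝ)))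
    (tendsto_nhds_unique h1 h2)

theorem circLaw_tensorPower (g : ProbabilityMeasure State) (j : ℕ) :
    circLaw (tensorPower g j) = Measure.pi fun _ : Fin j => (g : Measure State).map Prod.fst := by
  have : IsProbabilityMeasure ((g : Measure State).map Prod.fst) :=
    Measure.isProbabilityMeasure_map measurable_fst.aemeasurable
  rw [circLaw, tensorPower, ProbabilityMeasure.toMeasure_pi]
  exact Measure.pi_map_pi fun _ => measurable_fst.aemeasurable

/-- If the circulations of the mixture are independent with law `r`, then almost every component of
the mixture has circulation law `r`: for each event the second moment is the square of the mean. -/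
theorem IsMixingMeasure.ae_map_fst_eq {π : ProbabilityMeasure (ProbabilityMeasure State)}
    {P : (j : ℕ) → ProbabilityMeasure (Config j)} (h : IsMixingMeasure π P)
    {r : ProbabilityMeasure ℝ}
    (hR : ∀ j, 1 ≤ j → circLaw (P j) = Measure.pi fun _ : Fin j => (r : Measure ℝ)) :
    ∀ᵐ (g : ProbabilityMeasure State) ∂(π : Measure (ProbabilityMeasure State)),
      (g : Measure State).map Prod.fst = (r : Measure ℝ) := by
  have key : ∀ A : Set ℝ, MeasurableSet A →
      ∀ᵐ (g : ProbabilityMeasure State) ∂(π : Measure (ProbabilityMeasure State)),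
      (g : Measure State).map Prod.fst A = (r : Measure ℝ) A := by
    intro A hA
    let u : ProbabilityMeasure State → ℝ := fun g => ((g : Measure State).map Prod.fst).real A
    have hum : Measurable u := by
      have h1 : Measurable fun g : ProbabilityMeasure State =>
          (g : Measure State) (Prod.fst ⁻¹' A) :=
        (Measure.measurable_coe (measurable_fst hA)).comp measurable_subtype_coe
      convert h1.ennreal_toReal using 2 with g
      simp only [u, Measure.real]
      rw [Measure.map_apply measurable_fst hA]
    have hprob : ∀ g : ProbabilityMeasure State,
        IsProbabilityMeasure ((g : Measure State).map Prod.fst) := fun g =>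
      Measure.isProbabilityMeasure_map measurable_fst.aemeasurable
    have hub : ∀ g, ‖u g‖ ≤ 1 := fun g => by
      rw [Real.norm_of_nonneg measureReal_nonneg]
      exact measureReal_le_one
    have hpow : ∀ j, 1 ≤ j → ∫ g, u g ^ j ∂(π : Measure (ProbabilityMeasure State)) =
        (r : Measure ℝ).real A ^ j := by
      intro j hj
      have hbox : MeasurableSet (Set.univ.pi fun _ : Fin j => A) :=
        MeasurableSet.univ_pi fun _ => hA
      have h1 := h j hj (circ ⁻¹' Set.univ.pi fun _ => A) (measurable_circ hbox)
      rw [← Measure.map_apply measurable_circ hbox] at h1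
      change circLaw (P j) _ = _ at h1
      have h2 : ∀ g : ProbabilityMeasure State,
          (tensorPower g j : Measure (Config j)) (circ ⁻¹' Set.univ.pi fun _ => A) =
            ENNReal.ofReal (u g ^ j) := fun g => by
        rw [← Measure.map_apply measurable_circ hbox]
        change circLaw (tensorPower g j) _ = _
        rw [circLaw_tensorPower, Measure.pi_pi, Finset.prod_const, Finset.card_univ,
          Fintype.card_fin, ENNReal.ofReal_pow measureReal_nonneg, ofReal_measureReal]
      simp_rw [h2] at h1
      rw [hR j hj, Measure.pi_pi, Finset.prod_const, Finset.card_univ, Fintype.card_fin,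
        ← ofReal_integral_eq_lintegral_ofReal (integrable_of_measurable_bounded _ (hum.pow_const j)
          ⟨1, fun g => by rw [norm_pow]; exact pow_le_one₀ (norm_nonneg _) (hub g)⟩)
          (Eventually.of_forall fun g => pow_nonneg measureReal_nonneg j),
        ← ofReal_measureReal, ← ENNReal.ofReal_pow measureReal_nonneg] at h1
      exact ((ENNReal.ofReal_eq_ofReal_iff (pow_nonneg measureReal_nonneg j)
        (integral_nonneg fun g => pow_nonneg measureReal_nonneg j)).1 h1).symm
    have hi1 : Integrable u (π : Measure (ProbabilityMeasure State)) :=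
      integrable_of_measurable_bounded _ hum ⟨1, hub⟩
    have hi2 : Integrable (fun g => u g ^ 2) (π : Measure (ProbabilityMeasure State)) :=
      integrable_of_measurable_bounded _ (hum.pow_const 2)
        ⟨1, fun g => by rw [norm_pow]; exact pow_le_one₀ (norm_nonneg _) (hub g)⟩
    set c := (r : Measure ℝ).real A
    have hi3 : Integrable (fun g => u g ^ 2 - 2 * c * u g)
      (π : Measure (ProbabilityMeasure State)) := hi2.sub (hi1.const_mul (2 * c))
    have hvar : ∫ g, (u g ^ 2 - 2 * c * u g + c ^ 2)
        ∂(π : Measure (ProbabilityMeasure State)) = 0 := by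
      rw [integral_add hi3 (integrable_const _), integral_sub hi2 (hi1.const_mul _),
        integral_const_mul, hpow 2 (by norm_num)]
      have := hpow 1 le_rfl
      simp only [pow_one] at this
      rw [this]
      simp
      ring
    have hz := (integral_eq_zero_iff_of_nonneg (fun g => by
      change 0 ≤ u g ^ 2 - 2 * c * u g + c ^ 2
      nlinarith [sq_nonneg (u g - c)]) (hi3.add (integrable_const _))).1 hvar
    filter_upwards [hz] with g hg
    have h1 : (u g - c) ^ 2 = 0 := by
      have : u g ^ 2 - 2 * c * u g + c ^ 2 = 0 := hg
      linarith [this, (by ring : (u g - c) ^ 2 = u g ^ 2 - 2 * c * u g + c ^ 2)]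
    have h2 : u g = c := by
      have := pow_eq_zero_iff (two_ne_zero) |>.1 h1
      linarith
    have := hprob g
    exact (measureReal_eq_measureReal_iff).1 h2
  have hall : ∀ᵐ (g : ProbabilityMeasure State) ∂(π : Measure (ProbabilityMeasure State)), ∀ q : ℚ,
      (g : Measure State).map Prod.fst (Set.Iic (q : ℝ)) = (r : Measure ℝ) (Set.Iic (q : ℝ)) :=
    ae_all_iff.2 fun q => key _ measurableSet_Iic
  filter_upwards [hall] with g hg
  have : IsProbabilityMeasure ((g : Measure State).map Prod.fst) :=
    Measure.isProbabilityMeasure_map measurable_fst.aemeasurable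
  refine ext_of_generate_finite _
    (BorelSpace.measurable_eq.trans Real.borel_eq_generateFrom_Iic_rat)
    Real.isPiSystem_Iic_rat (fun t ht => ?_) (by simp)
  obtain ⟨q, rfl⟩ := Set.mem_iUnion.1 ht
  exact hg q

/-! ### Moments and the conclusion for the entropy -/

section Truncation

variable {X : Type*} [MeasurableSpace X] [TopologicalSpace X] [OpensMeasurableSpace X]

theorem integrable_of_lintegral_sq {μ : Measure X} [IsFiniteMeasure μ] {f : X → ℝ}
    (hf : Continuous f) (h : ∫⁻ x, ENNReal.ofReal (f x ^ 2) ∂μ < ⊤) : Integrable f μ := by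
  have h2 : Integrable (fun x => f x ^ 2) μ := by
    refine ⟨(hf.pow 2).measurable.aestronglyMeasurable, ?_⟩
    rw [hasFiniteIntegral_iff_ofReal (Eventually.of_forall fun x => sq_nonneg _)]
    exact h
  refine (h2.add (integrable_const 1)).mono' hf.measurable.aestronglyMeasurable
    (Eventually.of_forall fun x => ?_)
  simp only [Pi.add_apply, Real.norm_eq_abs]
  nlinarith [sq_abs (f x), sq_nonneg (|f x| - 1)]

variable [HasOuterApproxClosed X] {μ : ℕ → ProbabilityMeasure X} {ν : ProbabilityMeasure X}
  {f : X → ℝ}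

theorem lintegral_ofReal_le_of_tendsto (hf : Continuous f) (h0 : ∀ x, 0 ≤ f x)
    (hlim : Tendsto μ atTop (𝓝 ν)) {B : ℝ≥0∞}
    (hB : ∀ᶠ n in atTop, ∫⁻ x, ENNReal.ofReal (f x) ∂(μ n : Measure X) ≤ B) :
    ∫⁻ x, ENNReal.ofReal (f x) ∂(ν : Measure X) ≤ B :=
  (lintegral_le_liminf_lintegral_of_forall_isOpen_measure_le_liminf_measure hf h0
    fun _ hU => ProbabilityMeasure.le_liminf_measure_open_of_tendsto hlim hU).trans
    (liminf_le_of_frequently_le' hB.frequently)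

/-- Integrals of a nonnegative function are upper semicontinuous along a sequence of laws for which
the integrals of its square are bounded. -/
theorem eventually_integral_le_of_tendsto (hf : Continuous f) (h0 : ∀ x, 0 ≤ f x)
    (hlim : Tendsto μ atTop (𝓝 ν)) {B : ℝ≥0∞} (hB : B < ⊤)
    (hbd : ∀ᶠ n in atTop, ∫⁻ x, ENNReal.ofReal (f x ^ 2) ∂(μ n : Measure X) ≤ B)
    {ε : ℝ} (hε : 0 < ε) :
    ∀ᶠ n in atTop, ∫ x, f x ∂(μ n : Measure X) ≤ ∫ x, f x ∂(ν : Measure X) + ε := by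
  have hν : Integrable f (ν : Measure X) := integrable_of_lintegral_sq hf
    ((lintegral_ofReal_le_of_tendsto (hf.pow 2) (fun x => sq_nonneg _) hlim hbd).trans_lt hB)
  obtain ⟨L, hL⟩ := exists_gt (max 0 (2 * B.toReal / ε))
  have hL0 : 0 < L := (le_max_left _ _).trans_lt hL
  have hBL : B.toReal / L < ε / 2 := by
    have h1 := (le_max_right _ _).trans_lt hL
    rw [div_lt_iff₀ hε] at h1
    rw [div_lt_iff₀ hL0]
    linarith
  have hc : Continuous fun x => min (f x) L := by fun_prop
  have hcb : ∀ x, ‖min (f x) L‖ ≤ L := fun x => by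
    rw [Real.norm_of_nonneg (le_min (h0 x) hL0.le)]
    exact min_le_right _ _
  have h1 := (ProbabilityMeasure.tendsto_iff_forall_integral_tendsto.1 hlim)
    (BoundedContinuousFunction.ofNormedAddCommGroup _ hc L hcb)
  have hle : ∫ x, min (f x) L ∂(ν : Measure X) ≤ ∫ x, f x ∂(ν : Measure X) :=
    integral_mono (integrable_of_measurable_bounded _ hc.measurable ⟨L, hcb⟩) hν
      fun x => min_le_left _ _
  have h2 := h1.eventually_lt_const (u := ∫ x, f x ∂(ν : Measure X) + ε / 2) (by
    change ∫ x, min (f x) L ∂(ν : Measure X) < _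
    linarith)
  filter_upwards [h2, hbd] with n hn hBn
  change ∫ x, min (f x) L ∂(μ n : Measure X) < _ at hn
  have hsq : Integrable (fun x => f x ^ 2) (μ n : Measure X) := by
    refine ⟨(hf.pow 2).measurable.aestronglyMeasurable, ?_⟩
    rw [hasFiniteIntegral_iff_ofReal (Eventually.of_forall fun x => sq_nonneg _)]
    exact hBn.trans_lt hB
  have hmin : Integrable (fun x => min (f x) L) (μ n : Measure X) :=
    integrable_of_measurable_bounded _ hc.measurable ⟨L, hcb⟩
  have h3 : ∫ x, f x ∂(μ n : Measure X) ≤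
      ∫ x, min (f x) L + L⁻¹ * f x ^ 2 ∂(μ n : Measure X) := by
    refine integral_mono (integrable_of_lintegral_sq hf (hBn.trans_lt hB))
      (hmin.add (hsq.const_mul _)) fun x => ?_
    rcases le_total (f x) L with h | h
    · simp only [min_eq_left h]
      have := mul_nonneg (inv_pos.2 hL0).le (sq_nonneg (f x))
      linarith
    · simp only [min_eq_right h]
      have : f x ≤ L⁻¹ * f x ^ 2 := by
        rw [inv_mul_eq_div, le_div_iff₀ hL0]
        nlinarith [h0 x]
      linarith
  have h4 : ∫ x, f x ^ 2 ∂(μ n : Measure X) ≤ B.toReal := by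
    rw [integral_eq_lintegral_of_nonneg_ae (Eventually.of_forall fun x => sq_nonneg _)
      hsq.aestronglyMeasurable]
    exact ENNReal.toReal_mono hB.ne hBn
  rw [integral_add hmin (hsq.const_mul _), integral_const_mul] at h3
  have h5 : L⁻¹ * ∫ x, f x ^ 2 ∂(μ n : Measure X) ≤ B.toReal / L := by
    rw [inv_mul_eq_div]
    gcongr
  linarith

end Truncation

theorem continuous_coe_ennreal_sub (c : ℝ) :
    Continuous fun x : ℝ≥0∞ => (x : EReal) - (c : EReal) := by
  refine continuous_iff_continuousAt.2 fun x => ?_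
  simp_rw [sub_eq_add_neg, ← EReal.coe_neg]
  exact (EReal.continuousAt_add (p := ((x : EReal), ((-c : ℝ) : EReal))) (by simp) (by simp)).comp
    (f := fun x : ℝ≥0∞ => ((x : EReal), ((-c : ℝ) : EReal)))
    (continuous_coe_ennreal_ereal.prodMk continuous_const).continuousAt

theorem monotone_coe_ennreal_sub (c : ℝ) :
    Monotone fun x : ℝ≥0∞ => (x : EReal) - (c : EReal) := fun _ _ h =>
  EReal.sub_le_sub (EReal.coe_ennreal_le_coe_ennreal_iff.2 h) le_rfl

theorem coe_iSup_sub (a : ℕ → ℝ≥0∞) (c : ℝ) :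
    ((⨆ (j : ℕ) (_ : 1 ≤ j), a j : ℝ≥0∞) : EReal) - (c : EReal) =
      ⨆ (j : ℕ) (_ : 1 ≤ j), ((a j : EReal) - (c : EReal)) := by
  have : Nonempty {j : ℕ // 1 ≤ j} := ⟨⟨1, le_rfl⟩⟩
  rw [iSup_subtype', iSup_subtype']
  exact (monotone_coe_ennreal_sub c).map_ciSup_of_continuousAt
    (continuous_coe_ennreal_sub c).continuousAt (OrderTop.bddAbove _)

theorem coe_liminf_sub (a : ℕ → ℝ≥0∞) (c : ℝ) :
    ((liminf a atTop : ℝ≥0∞) : EReal) - (c : EReal) =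
      liminf (fun N => (a N : EReal) - (c : EReal)) atTop :=
  (monotone_coe_ennreal_sub c).map_liminf_of_continuousAt a
    (continuous_coe_ennreal_sub c).continuousAt

theorem partialMoment_one (k : ℝ) (G : ProbabilityMeasure (Config 1)) :
    partialMoment k G = ∫⁻ Y, ENNReal.ofReal (bracket (pos Y 0) ^ k) ∂(G : Measure (Config 1)) := by
  simp [partialMoment]

/-- Under a symmetric law the sum of the moments is governed by the law of a single vortex. -/
theorem IsSymmetric.integral_sum {N : ℕ} (hN : 1 ≤ N) {G : ProbabilityMeasure (Config N)}
    (hG : IsSymmetric G) {f : Config 1 → ℝ} (hf : Measurable f)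
    (hi : Integrable f (marginal 1 hN G : Measure (Config 1))) :
    Integrable (fun Y : Config N => ∑ i, f fun _ => Y i) (G : Measure (Config N)) ∧
      (N : ℝ)⁻¹ * ∫ Y, ∑ i, f (fun _ => Y i) ∂(G : Measure (Config N)) =
        ∫ Y, f Y ∂(marginal 1 hN G : Measure (Config 1)) := by
  have hinj : ∀ i : Fin N, Function.Injective fun _ : Fin 1 => i := fun i a b _ =>
    Subsingleton.elim a b
  have h1 : ∀ i : Fin N, Integrable (fun Y : Config N => f fun _ => Y i)
      (G : Measure (Config N)) := fun i => by
    have h2 := hG.map_comp_eq hN (hinj i)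
    rw [marginal, ProbabilityMeasure.toMeasure_map, ← h2] at hi
    exact (integrable_map_measure hf.aestronglyMeasurable
      (Measurable.aemeasurable (by fun_prop))).1 hi
  refine ⟨integrable_finsetSum _ fun i _ => h1 i, ?_⟩
  have hN0 : (N : ℝ) ≠ 0 := by exact_mod_cast (by omega : N ≠ 0)
  rw [integral_finsetSum _ fun i _ => h1 i, Finset.sum_congr rfl fun i _ =>
    (hG.integral_comp_eq hN (hinj i) hf).trans (integral_marginal hN G hf).symm]
  simp [hN0]

/-- The mean of `⟨x⟩^s` for one vortex. -/
noncomputable def bracketMean (s : ℝ) (G : ProbabilityMeasure (Config 1)) : ℝ :=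
  ∫ Y, bracket (pos Y 0) ^ s ∂(G : Measure (Config 1))

theorem continuous_bracket_pos (s : ℝ) :
    Continuous fun Y : Config 1 => bracket (pos Y 0) ^ s :=
  (continuous_bracket_rpow s).comp ((continuous_apply 0).comp continuous_pos)

theorem bracket_rpow_half_sq (k : ℝ) (x : Plane) : (bracket x ^ (k / 2)) ^ 2 = bracket x ^ k := by
  rw [← Real.rpow_natCast, ← Real.rpow_mul (zero_le_one.trans (one_le_bracket x))]
  simp

theorem lintegral_bracket_sq_eq (k : ℝ) (G : ProbabilityMeasure (Config 1)) :
    ∫⁻ Y, ENNReal.ofReal ((bracket (pos Y 0) ^ (k / 2)) ^ 2) ∂(G : Measure (Config 1)) =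
      partialMoment k G := by
  simp_rw [bracket_rpow_half_sq, partialMoment_one]

theorem integrable_bracket_of_partialMoment {k : ℝ} {G : ProbabilityMeasure (Config 1)}
    (h : partialMoment k G < ⊤) :
    Integrable (fun Y => bracket (pos Y 0) ^ (k / 2)) (G : Measure (Config 1)) :=
  integrable_of_lintegral_sq (continuous_bracket_pos _) (by rwa [lintegral_bracket_sq_eq])

theorem isSymmetric_one (G : ProbabilityMeasure (Config 1)) : IsSymmetric G := fun σ => by
  rw [Subsingleton.elim σ 1]
  exact Measure.map_id

theorem marginal_self {N : ℕ} (G : ProbabilityMeasure (Config N)) (h : N ≤ N) :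
    marginal N h G = G :=
  Subtype.ext Measure.map_id

/-- The partial entropy of a symmetric law is a relative entropy minus a term which depends on the
law of one vortex only. -/
theorem IsSymmetric.partialEntropy_eq {k : ℝ} (hk : 0 < k) {N : ℕ} (hN : 1 ≤ N)
    {r : ProbabilityMeasure ℝ} {G : ProbabilityMeasure (Config N)} (hG : IsSymmetric G)
    (hR : circLaw G = Measure.pi fun _ : Fin N => (r : Measure ℝ))
    (hmom : partialMoment k (marginal 1 hN G) < ⊤) :
    partialEntropy G = (relEntropy ((r : Measure ℝ).prod (gibbs (k / 2))) N G : EReal) -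
      ((bracketMean (k / 2) (marginal 1 hN G) + Real.log (gibbsMass (k / 2)) : ℝ) : EReal) := by
  obtain ⟨h1, h2⟩ := hG.integral_sum hN (continuous_bracket_pos (k / 2)).measurable
    (integrable_bracket_of_partialMoment hmom)
  rw [partialEntropy_eq_relEntropy_sub (half_pos hk) hN r G hR h1, bracketMean, ← h2]
  rfl

theorem IsMixingMeasure.lintegral_partialMoment {π : ProbabilityMeasure (ProbabilityMeasure State)}
    {P : (j : ℕ) → ProbabilityMeasure (Config j)} (h : IsMixingMeasure π P) (k : ℝ) :
    ∫⁻ g, partialMoment k (tensorPower g 1) ∂(π : Measure (ProbabilityMeasure State)) =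
      partialMoment k (P 1) := by
  simp_rw [partialMoment_one]
  exact (h.lintegral_eq le_rfl (continuous_bracket_pos k).measurable.ennreal_ofReal).symm

theorem measurable_partialMoment (k : ℝ) :
    Measurable fun g : ProbabilityMeasure State => partialMoment k (tensorPower g 1) := by
  simp_rw [partialMoment_one]
  exact ((continuous_bracket_pos k).measurable.ennreal_ofReal).lintegral_kernel
    (κ := tensorKernel 1)

/-- The mean entropy of the components of a mixture is the supremum of the entropies of its
marginals. -/
theorem IsMixingMeasure.extIntegral_partialEntropy {k : ℝ} (hk : 0 < k)
    {r : ProbabilityMeasure ℝ} {π : ProbabilityMeasure (ProbabilityMeasure State)}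
    {P : (j : ℕ) → ProbabilityMeasure (Config j)} (h : IsMixingMeasure π P) (hP : IsCompatible P)
    (hR : ∀ j, 1 ≤ j → circLaw (P j) = Measure.pi fun _ : Fin j => (r : Measure ℝ))
    (hmom : partialMoment k (P 1) < ⊤) :
    extIntegral (π : Measure (ProbabilityMeasure State))
        (fun g => partialEntropy (tensorPower g 1)) =
      ⨆ (j : ℕ) (_ : 1 ≤ j), partialEntropy (P j) := by
  have hprob := isProbabilityMeasure_gibbs (half_pos hk)
  have hdual := meanFieldDual_relEntropy ((r : Measure ℝ).prod (gibbs (k / 2)))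
  have hPj : ∀ j, 1 ≤ j → partialEntropy (P j) =
      (relEntropy ((r : Measure ℝ).prod (gibbs (k / 2))) j (P j) : EReal) -
        ((bracketMean (k / 2) (P 1) + Real.log (gibbsMass (k / 2)) : ℝ) : EReal) := by
    intro j hj
    have h1 := (hP.1 j hj).partialEntropy_eq hk hj (hR j hj)
    rw [hP.2 1 j le_rfl hj] at h1
    exact h1 hmom
  have hg : ∀ᵐ (g : ProbabilityMeasure State) ∂(π : Measure (ProbabilityMeasure State)),
      partialEntropy (tensorPower g 1) =
        (relEntropy ((r : Measure ℝ).prod (gibbs (k / 2))) 1 (tensorPower g 1) : EReal) -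
        ((bracketMean (k / 2) (tensorPower g 1) + Real.log (gibbsMass (k / 2)) : ℝ) : EReal) := by
    have hfin := ae_lt_top (measurable_partialMoment k)
      (by rw [h.lintegral_partialMoment]; exact hmom.ne)
    filter_upwards [h.ae_map_fst_eq hR, hfin] with g hg1 hg2
    have h1 := (isSymmetric_one (tensorPower g 1)).partialEntropy_eq hk le_rfl (r := r)
      (by rw [circLaw_tensorPower, hg1])
    rw [marginal_self] at h1
    exact h1 hg2
  have hsnd : Integrable (fun p : ProbabilityMeasure State × Config 1 =>
      bracket (pos p.2 0) ^ (k / 2))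
      ((π : Measure (ProbabilityMeasure State)) ⊗ₘ tensorKernel 1) := by
    have h1 := integrable_bracket_of_partialMoment hmom
    rw [h.eq_snd le_rfl] at h1
    exact (integrable_map_measure (continuous_bracket_pos _).aestronglyMeasurable
      measurable_snd.aemeasurable).1 h1
  have hmean : ∫ g, bracketMean (k / 2) (tensorPower g 1)
      ∂(π : Measure (ProbabilityMeasure State)) = bracketMean (k / 2) (P 1) := by
    unfold bracketMean
    rw [h.eq_snd le_rfl, integral_map measurable_snd.aemeasurable
      (continuous_bracket_pos _).aestronglyMeasurable, Measure.integral_compProd hsnd]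
    rfl
  have hmi : Integrable (fun g => bracketMean (k / 2) (tensorPower g 1))
      (π : Measure (ProbabilityMeasure State)) := hsnd.integral_compProd
  have hbi : Integrable (fun g => bracketMean (k / 2) (tensorPower g 1) +
      Real.log (gibbsMass (k / 2))) (π : Measure (ProbabilityMeasure State)) :=
    hmi.add (integrable_const _)
  rw [extIntegral_congr_ae hg, extIntegral_coe_sub hdual.measurable_tensorPower.aemeasurable hbi,
    hdual.lintegral_eq_iSup h, integral_add hmi (integrable_const _),
    hmean, biSup_congr hPj, ← coe_iSup_sub]
  simp

/-- Lower semicontinuity of the entropy along the sequence. -/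
theorem iSup_partialEntropy_le_liminf {k : ℝ} (hk : 0 < k) {r : ProbabilityMeasure ℝ}
    {G : (N : ℕ) → ProbabilityMeasure (Config N)} (hG : ∀ N, 2 ≤ N → IIDCirc r (G N))
    {B : ℝ≥0∞} (hB : B < ⊤)
    (hmom : ∀ (N : ℕ) (h : 2 ≤ N), partialMoment k (marginal 1 (one_le_two.trans h) (G N)) ≤ B)
    {P : (j : ℕ) → ProbabilityMeasure (Config j)} (hP : IsCompatible P)
    (hlim : ∀ j, 1 ≤ j →
      Tendsto (fun n : ℕ => marginal j (Nat.le_add_left j n) (G (n + j))) atTop (𝓝 (P j)))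
    (hR : ∀ j, 1 ≤ j → circLaw (P j) = Measure.pi fun _ : Fin j => (r : Measure ℝ))
    (hmomP : partialMoment k (P 1) < ⊤) :
    (⨆ (j : ℕ) (_ : 1 ≤ j), partialEntropy (P j)) ≤
      liminf (fun N : ℕ => partialEntropy (G N)) atTop := by
  have hprob := isProbabilityMeasure_gibbs (half_pos hk)
  have hdual := meanFieldDual_relEntropy ((r : Measure ℝ).prod (gibbs (k / 2)))
  have hPj : ∀ j, 1 ≤ j → partialEntropy (P j) =
      (relEntropy ((r : Measure ℝ).prod (gibbs (k / 2))) j (P j) : EReal) -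
        ((bracketMean (k / 2) (P 1) + Real.log (gibbsMass (k / 2)) : ℝ) : EReal) := by
    intro j hj
    have h1 := (hP.1 j hj).partialEntropy_eq hk hj (hR j hj)
    rw [hP.2 1 j le_rfl hj] at h1
    exact h1 hmomP
  set c : ℝ := bracketMean (k / 2) (P 1) + Real.log (gibbsMass (k / 2)) with hc
  have hbound : ∀ ε : ℝ, 0 < ε →
      (⨆ (j : ℕ) (_ : 1 ≤ j), partialEntropy (P j)) - (ε : EReal) ≤
        liminf (fun N : ℕ => partialEntropy (G N)) atTop := by
    intro ε hε
    have hev := eventually_integral_le_of_tendsto (continuous_bracket_pos (k / 2))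
      (fun Y => zero_le_one.trans (one_le_bracket_rpow (half_pos hk) _)) (hlim 1 le_rfl) hB (by
        filter_upwards [eventually_ge_atTop 1] with n hn
        rw [lintegral_bracket_sq_eq]
        exact hmom (n + 1) (by omega)) hε
    have hle : ∀ᶠ N : ℕ in atTop,
        (relEntropy ((r : Measure ℝ).prod (gibbs (k / 2))) N (G N) : EReal) -
          ((c + ε : ℝ) : EReal) ≤ partialEntropy (G N) := by
      obtain ⟨n₀, hn₀⟩ := eventually_atTop.1 hev
      filter_upwards [eventually_ge_atTop (n₀ + 2)] with N hN
      have hN2 : 2 ≤ N := by omega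
      have h1 := (hG N hN2).1.partialEntropy_eq hk (one_le_two.trans hN2) (hG N hN2).2
        ((hmom N hN2).trans_lt hB)
      rw [h1]
      refine EReal.sub_le_sub le_rfl (EReal.coe_le_coe_iff.2 ?_)
      obtain ⟨n, rfl⟩ : ∃ n, N = n + 1 := ⟨N - 1, by omega⟩
      have h2 : bracketMean (k / 2) (marginal 1 (one_le_two.trans hN2) (G (n + 1))) ≤
        bracketMean (k / 2) (P 1) + ε := hn₀ n (by omega)
      linarith
    calc (⨆ (j : ℕ) (_ : 1 ≤ j), partialEntropy (P j)) - (ε : EReal)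
        = ((⨆ (j : ℕ) (_ : 1 ≤ j), relEntropy ((r : Measure ℝ).prod (gibbs (k / 2))) j (P j) :
            ℝ≥0∞) : EReal) - ((c + ε : ℝ) : EReal) := by
          rw [biSup_congr hPj, ← coe_iSup_sub, sub_eq_add_neg, sub_eq_add_neg,
            sub_eq_add_neg, ← EReal.coe_neg, ← EReal.coe_neg, ← EReal.coe_neg, add_assoc,
            ← EReal.coe_add]
          congr 2
          rw [hc]
          ring
      _ ≤ ((liminf (fun N => relEntropy ((r : Measure ℝ).prod (gibbs (k / 2))) N (G N)) atTop :
            ℝ≥0∞) : EReal) - ((c + ε : ℝ) : EReal) :=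
          monotone_coe_ennreal_sub _ (hdual.iSup_le_liminf (fun N hN => (hG N hN).1) hlim)
      _ = _ := coe_liminf_sub _ _
      _ ≤ liminf (fun N : ℕ => partialEntropy (G N)) atTop := liminf_le_liminf hle
  have hcont : ContinuousAt (fun ε : ℝ =>
      (⨆ (j : ℕ) (_ : 1 ≤ j), partialEntropy (P j)) - (ε : EReal)) 0 := by
    simp_rw [sub_eq_add_neg, ← EReal.coe_neg]
    exact (EReal.continuousAt_add (p := (_, ((-0 : ℝ) : EReal))) (by simp) (by simp)).comp
      (f := fun ε : ℝ => (_, ((-ε : ℝ) : EReal))) (continuousAt_const.prodMk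
        (continuous_coe_real_ereal.comp continuous_neg).continuousAt)
  have h1 := hcont.tendsto.mono_left (nhdsWithin_le_nhds (s := Set.Ioi 0))
  rw [EReal.coe_zero, sub_zero] at h1
  exact le_of_tendsto h1 (eventually_nhdsWithin_of_forall hbound)

/-! ### Weak duality for the Fisher information -/

/-- The direction of the `p.2`-th coordinate of the position of the `p.1`-th vortex, in the space of
configurations. -/
noncomputable def posDir {N : ℕ} (p : Fin N × Fin 2) : Config N :=
  Pi.single p.1 (0, EuclideanSpace.single p.2 1)

/-- The direction of the `p.2`-th coordinate of the `p.1`-th position, in the space of positions. -/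
noncomputable def planeDir {N : ℕ} (p : Fin N × Fin 2) : Fin N → Plane :=
  Pi.single p.1 (EuclideanSpace.single p.2 1)

/-- The integrand `-2 div Φ - |Φ|²` of a vector field `Φ` on configurations with values in the space
of positions; the divergence is taken in the positions. -/
noncomputable def fisherIntegrand {N : ℕ} (Φ : Fin N × Fin 2 → Config N → ℝ) (Y : Config N) : ℝ :=
  ∑ p, (-2 * fderiv ℝ (Φ p) Y (posDir p) - Φ p Y ^ 2)

/-- Smooth compactly supported fields. -/
structure IsTestField {N : ℕ} {E : Type*} [NormedAddCommGroup E] [NormedSpace ℝ E]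
    (Φ : Fin N × Fin 2 → E → ℝ) : Prop where
  contDiff : ∀ p, ContDiff ℝ ((⊤ : ℕ∞) : WithTop ℕ∞) (Φ p)
  compact : ∀ p, HasCompactSupport (Φ p)

/-- The integrands of the smooth compactly supported fields. -/
def fisherTests (N : ℕ) : Set (Config N → ℝ) :=
  {ψ | ∃ Φ : Fin N × Fin 2 → Config N → ℝ, IsTestField Φ ∧ ψ = fisherIntegrand Φ}

theorem sum_inner_planeDir {N : ℕ} (w : Fin N → Plane) (p : Fin N × Fin 2) :
    ∑ i, inner ℝ (w i) (planeDir p i) = w p.1 p.2 := by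
  rw [Finset.sum_eq_single p.1 (fun i _ hi => by simp [planeDir, Pi.single_eq_of_ne hi]) (by simp)]
  simp [planeDir, EuclideanSpace.inner_single_right]

theorem sum_norm_sq_eq {N : ℕ} (w : Fin N → Plane) :
    ∑ i, ‖w i‖ ^ 2 = ∑ p : Fin N × Fin 2, w p.1 p.2 ^ 2 := by
  simp_rw [EuclideanSpace.norm_sq_eq, Fintype.sum_prod_type, Real.norm_eq_abs, sq_abs]

theorem continuous_fderiv_apply_of_contDiff {E : Type*} [NormedAddCommGroup E] [NormedSpace ℝ E]
    {φ : E → ℝ} (h : ContDiff ℝ ((⊤ : ℕ∞) : WithTop ℕ∞) φ) (v : E) :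
    Continuous fun X => fderiv ℝ φ X v :=
  (h.continuous_fderiv (by simp)).clm_apply continuous_const

/-- For a law with density `f` and weak gradient `D`, this is `2 D · Ψ - f |Ψ|² ≤ |D|² / f`. -/
theorem ofReal_integral_le_fisher {N : ℕ} (F : Measure (Fin N → Plane)) [IsProbabilityMeasure F]
    {Ψ : Fin N × Fin 2 → (Fin N → Plane) → ℝ} (hΨ : IsTestField Ψ) :
    ENNReal.ofReal (∫ X, ∑ p, (-2 * fderiv ℝ (Ψ p) X (planeDir p) - Ψ p X ^ 2) ∂F) ≤
      N * fisher F := by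
  rcases Nat.eq_zero_or_pos N with rfl | hN
  · simp
  have hN0 : (N : ℝ≥0∞) ≠ 0 := by exact_mod_cast hN.ne'
  have hNt : (N : ℝ≥0∞) ≠ ⊤ := ENNReal.natCast_ne_top N
  rw [fisher]
  split_ifs with hac
  swap
  · rw [ENNReal.mul_top hN0]; exact le_top
  rw [← ENNReal.div_le_iff' hN0 hNt]
  refine le_iInf₂ fun D hD => ?_
  rw [ENNReal.div_le_iff' hN0 hNt, ← mul_assoc, ENNReal.mul_inv_cancel hN0 hNt, one_mul]
  have hf : Integrable (density F) volume := Measure.integrable_toReal_rnDeriv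
  have hdc : ∀ p, Continuous fun X => fderiv ℝ (Ψ p) X (planeDir p) := fun p =>
    continuous_fderiv_apply_of_contDiff (hΨ.contDiff p) _
  have hds : ∀ p, HasCompactSupport fun X => fderiv ℝ (Ψ p) X (planeDir p) := fun p =>
    (hΨ.compact p).fderiv_apply (𝕜 := ℝ) _
  have hi1 : ∀ p, Integrable (fun X => density F X * fderiv ℝ (Ψ p) X (planeDir p)) volume := by
    intro p
    obtain ⟨C, hC⟩ := (hds p).exists_bound_of_continuous (hdc p)
    exact hf.mul_bdd (hdc p).aestronglyMeasurable (Eventually.of_forall hC)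
  have hi2 : ∀ p, Integrable (fun X => density F X * Ψ p X ^ 2) volume := by
    intro p
    obtain ⟨C, hC⟩ := (hΨ.compact p).exists_bound_of_continuous (hΨ.contDiff p).continuous
    refine hf.mul_bdd (c := C ^ 2) (((hΨ.contDiff p).continuous.pow 2).aestronglyMeasurable :)
      (Eventually.of_forall fun X => ?_)
    rw [norm_pow]
    exact pow_le_pow_left₀ (norm_nonneg _) (hC X) 2
  have hi3 : ∀ p, Integrable (fun X => D X p.1 p.2 * Ψ p X) volume := by
    intro p
    have h1 : LocallyIntegrable (fun X => D X p.1 p.2) volume := fun x => by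
      obtain ⟨s, hs, hi⟩ := hD.1 x
      exact ⟨s, hs, ((EuclideanSpace.proj p.2 : Plane →L[ℝ] ℝ).comp
        (ContinuousLinearMap.proj p.1 : (Fin N → Plane) →L[ℝ] Plane)).integrable_comp hi⟩
    exact h1.integrable_smul_right_of_hasCompactSupport (hΨ.contDiff p).continuous (hΨ.compact p)
  have hibp : ∀ p, ∫ X, density F X * fderiv ℝ (Ψ p) X (planeDir p) =
      -∫ X, D X p.1 p.2 * Ψ p X := fun p => by
    rw [hD.2 (Ψ p) (hΨ.contDiff p) (hΨ.compact p) (planeDir p)]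
    simp_rw [sum_inner_planeDir]
  have heq : ∫ X, ∑ p, (-2 * fderiv ℝ (Ψ p) X (planeDir p) - Ψ p X ^ 2) ∂F =
      ∫ X, ∑ p, (2 * (D X p.1 p.2 * Ψ p X) - density F X * Ψ p X ^ 2) := by
    have hi4 : ∀ p, Integrable (fun X => 2 * (D X p.1 p.2 * Ψ p X) - density F X * Ψ p X ^ 2)
      volume := fun p => ((hi3 p).const_mul 2).sub (hi2 p)
    have hi5 : ∀ p, Integrable (fun X => -2 * (density F X * fderiv ℝ (Ψ p) X (planeDir p)) -
      density F X * Ψ p X ^ 2) volume := fun p => ((hi1 p).const_mul (-2)).sub (hi2 p)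
    rw [← integral_rnDeriv_smul hac, integral_finsetSum _ fun p _ => hi4 p]
    have h1 : ∀ X, (F.rnDeriv volume X).toReal •
        ∑ p, (-2 * fderiv ℝ (Ψ p) X (planeDir p) - Ψ p X ^ 2) =
        ∑ p, (-2 * (density F X * fderiv ℝ (Ψ p) X (planeDir p)) - density F X * Ψ p X ^ 2) := by
      intro X
      rw [smul_eq_mul, Finset.mul_sum]
      refine Finset.sum_congr rfl fun p _ => ?_
      rw [density]
      ring
    simp_rw [h1]
    rw [integral_finsetSum _ fun p _ => hi5 p]
    refine Finset.sum_congr rfl fun p _ => ?_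
    rw [integral_sub ((hi1 p).const_mul (-2)) (hi2 p), integral_sub ((hi3 p).const_mul 2) (hi2 p),
      integral_const_mul, integral_const_mul, hibp p]
    ring
  rw [heq]
  refine (ofReal_integral_le_lintegral_ofReal _ _).trans (lintegral_mono_ae ?_)
  filter_upwards [Measure.rnDeriv_lt_top F volume] with X hX
  rw [sum_norm_sq_eq]
  rcases eq_or_ne (F.rnDeriv volume X) 0 with h0 | h0
  · rcases (Finset.sum_nonneg fun (p : Fin N × Fin 2) _ => sq_nonneg (D X p.1 p.2)).eq_or_lt
      with h1 | h1
    · have h2 := (Finset.sum_eq_zero_iff_of_nonneg fun (p : Fin N × Fin 2) _ =>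
        sq_nonneg (D X p.1 p.2)).1 h1.symm
      rw [Finset.sum_eq_zero fun p hp => ?_]
      · simp
      · rw [pow_eq_zero_iff two_ne_zero |>.1 (h2 p hp), density, h0]
        simp
    · rw [h0, ENNReal.div_zero (ENNReal.ofReal_pos.2 h1).ne']
      exact le_top
  · have hpos : 0 < density F X := ENNReal.toReal_pos h0 hX.ne
    have h1 : F.rnDeriv volume X = ENNReal.ofReal (density F X) :=
      (ENNReal.ofReal_toReal hX.ne).symm
    rw [h1, ← ENNReal.ofReal_div_of_pos hpos, Finset.sum_div]
    refine ENNReal.ofReal_le_ofReal (Finset.sum_le_sum fun p _ => ?_)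
    rw [le_div_iff₀ hpos]
    nlinarith [sq_nonneg (D X p.1 p.2 - density F X * Ψ p X)]

/-- The configuration with given circulations and positions. -/
def join {N : ℕ} (M : Fin N → ℝ) (X : Fin N → Plane) : Config N := fun i => (M i, X i)

theorem measurable_join {N : ℕ} :
    Measurable fun p : (Fin N → ℝ) × (Fin N → Plane) => join p.1 p.2 := by
  unfold join; fun_prop

theorem hasFDerivAt_join {N : ℕ} (M : Fin N → ℝ) (X : Fin N → Plane) :
    HasFDerivAt (join M) (ContinuousLinearMap.pi fun i =>
      (ContinuousLinearMap.inr ℝ ℝ Plane).comp (ContinuousLinearMap.proj i)) X := by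
  refine hasFDerivAt_pi.2 fun i => ?_
  exact (hasFDerivAt_const (M i) X).prodMk (hasFDerivAt_apply i X) |>.congr_fderiv (by
    ext v <;> simp)

theorem contDiff_join {N : ℕ} (M : Fin N → ℝ) :
    ContDiff ℝ ((⊤ : ℕ∞) : WithTop ℕ∞) (join M) :=
  contDiff_pi.2 fun i => contDiff_const.prodMk (contDiff_apply ℝ Plane i)

theorem fderiv_comp_join {N : ℕ} {φ : Config N → ℝ}
    (h : ContDiff ℝ ((⊤ : ℕ∞) : WithTop ℕ∞) φ) (M : Fin N → ℝ) (X : Fin N → Plane)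
    (p : Fin N × Fin 2) :
    fderiv ℝ (fun X => φ (join M X)) X (planeDir p) = fderiv ℝ φ (join M X) (posDir p) := by
  have h1 := ((h.differentiable (by simp)) (join M X)).hasFDerivAt.comp X (hasFDerivAt_join M X)
  rw [show (fun X => φ (join M X)) = φ ∘ join M from rfl, h1.fderiv]
  simp only [ContinuousLinearMap.comp_apply]
  congr 1
  funext i
  by_cases hi : i = p.1
  · subst hi
    simp [planeDir, posDir]
  · simp [planeDir, posDir, Pi.single_eq_of_ne hi]

theorem isClosedEmbedding_join {N : ℕ} (M : Fin N → ℝ) : IsClosedEmbedding (join M) := by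
  refine Topology.IsClosedEmbedding.of_continuous_injective_isClosedMap
    (contDiff_join M).continuous ?_ ?_
  · intro X X' h
    funext i
    exact congrArg Prod.snd (congrFun h i)
  · intro s hs
    have : join M '' s = pos ⁻¹' s ∩ circ ⁻¹' {M} := by
      ext Y
      constructor
      · rintro ⟨X, hX, rfl⟩
        exact ⟨hX, rfl⟩
      · rintro ⟨h1, h2⟩
        exact ⟨pos Y, h1, by rw [← (show circ Y = M from h2)]; rfl⟩
    rw [this]
    exact (hs.preimage continuous_pos).inter (isClosed_singleton.preimage continuous_circ)

theorem IsTestField.comp_join {N : ℕ} {Φ : Fin N × Fin 2 → Config N → ℝ} (hΦ : IsTestField Φ)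
    (M : Fin N → ℝ) : IsTestField fun p X => Φ p (join M X) :=
  ⟨fun p => (hΦ.contDiff p).comp (contDiff_join M),
    fun p => (hΦ.compact p).comp_isClosedEmbedding (isClosedEmbedding_join M)⟩

theorem continuous_fisherIntegrand {N : ℕ} {Φ : Fin N × Fin 2 → Config N → ℝ}
    (hΦ : ∀ p, ContDiff ℝ ((⊤ : ℕ∞) : WithTop ℕ∞) (Φ p)) : Continuous (fisherIntegrand Φ) :=
  continuous_finsetSum _ fun p _ =>
    ((continuous_fderiv_apply_of_contDiff (hΦ p) _).const_mul _).sub ((hΦ p).continuous.pow 2)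

theorem fisherIntegrand_bound {N : ℕ} {Φ : Fin N × Fin 2 → Config N → ℝ} {C : ℝ}
    (h1 : ∀ p Y, |Φ p Y| ≤ C) (h2 : ∀ p Y, |fderiv ℝ (Φ p) Y (posDir p)| ≤ C) (Y : Config N) :
    ‖fisherIntegrand Φ Y‖ ≤ ∑ _p : Fin N × Fin 2, (2 * C + C ^ 2) := by
  refine norm_sum_le_of_le _ fun p _ => (norm_sub_le _ _).trans ?_
  rw [norm_mul, norm_pow, Real.norm_eq_abs, Real.norm_eq_abs, Real.norm_eq_abs]
  have h3 : |(-2 : ℝ)| = 2 := by norm_num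
  rw [h3]
  gcongr
  · exact h2 p Y
  · exact h1 p Y

theorem IsTestField.exists_bound {N : ℕ} {Φ : Fin N × Fin 2 → Config N → ℝ} (hΦ : IsTestField Φ) :
    ∃ C : ℝ, (∀ p Y, |Φ p Y| ≤ C) ∧ ∀ p Y, |fderiv ℝ (Φ p) Y (posDir p)| ≤ C := by
  choose C hC using fun p =>
    (hΦ.compact p).exists_bound_of_continuous (hΦ.contDiff p).continuous
  choose C' hC' using fun p =>
    ((hΦ.compact p).fderiv_apply (𝕜 := ℝ) (posDir p)).exists_bound_of_continuous
    (continuous_fderiv_apply_of_contDiff (hΦ.contDiff p) _)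
  have hnn : ∀ p, 0 ≤ C p := fun p => (norm_nonneg _).trans (hC p 0)
  have hnn' : ∀ p, 0 ≤ C' p := fun p => (norm_nonneg _).trans (hC' p 0)
  refine ⟨∑ p, (C p + C' p), fun p Y => (hC p Y).trans ?_, fun p Y => (hC' p Y).trans ?_⟩
  · exact (le_add_of_nonneg_right (hnn' p)).trans (Finset.single_le_sum
      (f := fun p => C p + C' p) (fun q _ => add_nonneg (hnn q) (hnn' q)) (Finset.mem_univ p))
  · exact (le_add_of_nonneg_left (hnn p)).trans (Finset.single_le_sum
      (f := fun p => C p + C' p) (fun q _ => add_nonneg (hnn q) (hnn' q)) (Finset.mem_univ p))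

/-- Integrals are iterated integrals, over the circulations and then over the positions. -/
theorem integral_eq_integral_condPos {N : ℕ} (G : ProbabilityMeasure (Config N)) {f : Config N → ℝ}
    (hf : Integrable f (G : Measure (Config N))) :
    ∫ Y, f Y ∂(G : Measure (Config N)) = ∫ M, ∫ X, f (join M X) ∂(condPos G M) ∂(circLaw G) := by
  have h1 := circLaw_compProd_condPos G
  have h2 : (G : Measure (Config N)) = (circLaw G ⊗ₘ condPos G).map fun p => join p.1 p.2 := by
    rw [h1, Measure.map_map measurable_join measurable_circ_pos]
    exact Measure.map_id.symm
  have h3 := hf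
  rw [h2] at h3
  conv_lhs => rw [h2]
  rw [integral_map measurable_join.aemeasurable h3.aestronglyMeasurable]
  exact Measure.integral_compProd ((integrable_map_measure h3.aestronglyMeasurable
    measurable_join.aemeasurable).1 h3)

theorem IsTestField.ofReal_integral_le {N : ℕ} {Φ : Fin N × Fin 2 → Config N → ℝ}
    (hΦ : IsTestField Φ) (G : ProbabilityMeasure (Config N)) :
    ENNReal.ofReal (∫ Y, fisherIntegrand Φ Y ∂(G : Measure (Config N))) ≤ N * partialFisher G := by
  obtain ⟨C, h1, h2⟩ := hΦ.exists_bound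
  rw [integral_eq_integral_condPos G (integrable_of_continuous_bounded _
    (continuous_fisherIntegrand hΦ.contDiff) ⟨_, fisherIntegrand_bound h1 h2⟩), partialFisher]
  refine (ofReal_integral_le_lintegral_ofReal _ _).trans ?_
  rw [← lintegral_const_mul' _ _ (ENNReal.natCast_ne_top N)]
  refine lintegral_mono fun M => ?_
  refine le_trans (le_of_eq ?_) (ofReal_integral_le_fisher (condPos G M) (hΦ.comp_join M))
  simp_rw [fisherIntegrand, fderiv_comp_join (hΦ.contDiff _)]

/-! ### Bounded fields, blocks and tensor powers -/

/-- Smooth cutoff functions with bounded gradients, which exhaust the space. -/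
theorem exists_cutoff (E : Type*) [NormedAddCommGroup E] [NormedSpace ℝ E]
    [FiniteDimensional ℝ E] :
    ∃ (χ : ℕ → E → ℝ) (B : ℝ), 0 ≤ B ∧ (∀ n, ContDiff ℝ ((⊤ : ℕ∞) : WithTop ℕ∞) (χ n)) ∧
      (∀ n, HasCompactSupport (χ n)) ∧ (∀ n x, |χ n x| ≤ 1) ∧ (∀ n x, ‖fderiv ℝ (χ n) x‖ ≤ B) ∧
      ∀ x, ∀ᶠ n in atTop, χ n =ᶠ[𝓝 x] 1 := by
  let b : ContDiffBump (0 : E) := ⟨1, 2, one_pos, one_lt_two⟩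
  have hb : ContDiff ℝ ((⊤ : ℕ∞) : WithTop ℕ∞) b := b.contDiff
  obtain ⟨B, hB⟩ := (b.hasCompactSupport.fderiv (𝕜 := ℝ)).exists_bound_of_continuous
    (hb.continuous_fderiv (by simp))
  have hc : ∀ n : ℕ, (0 : ℝ) < ((n : ℝ) + 1)⁻¹ := fun n => by positivity
  refine ⟨fun n x => b (((n : ℝ) + 1)⁻¹ • x), B, (norm_nonneg _).trans (hB 0), fun n =>
    hb.comp (contDiff_const_smul _), fun n => b.hasCompactSupport.comp_smul (hc n).ne',
    fun n x => abs_le.2 ⟨by linarith [b.nonneg (x := ((n : ℝ) + 1)⁻¹ • x)], b.le_one⟩,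
    fun n x => ?_, fun x => ?_⟩
  · rw [fderiv_comp_smul, norm_smul, Real.norm_of_nonneg (hc n).le]
    have h1 : ((n : ℝ) + 1)⁻¹ ≤ 1 := inv_le_one_of_one_le₀ (by linarith [n.cast_nonneg (α := ℝ)])
    calc ((n : ℝ) + 1)⁻¹ * ‖fderiv ℝ b (((n : ℝ) + 1)⁻¹ • x)‖ ≤ 1 * B :=
          mul_le_mul h1 (hB _) (norm_nonneg _) zero_le_one
      _ = B := one_mul B
  · obtain ⟨m, hm⟩ := exists_nat_gt ‖x‖
    filter_upwards [eventually_ge_atTop m] with n hn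
    have h1 : ((n : ℝ) + 1)⁻¹ • x ∈ Metric.ball (0 : E) b.rIn := by
      rw [mem_ball_zero_iff, norm_smul, Real.norm_of_nonneg (hc n).le, inv_mul_eq_div,
        div_lt_iff₀ (by positivity)]
      have : (m : ℝ) ≤ n := by exact_mod_cast hn
      change ‖x‖ < 1 * _
      linarith
    have h2 : Tendsto (fun y : E => ((n : ℝ) + 1)⁻¹ • y) (𝓝 x) (𝓝 (((n : ℝ) + 1)⁻¹ • x)) :=
      (continuous_const_smul _).tendsto x
    exact h2.eventually (b.eventuallyEq_one_of_mem_ball h1)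

theorem ofReal_integral_fisherIntegrand_le {N : ℕ} {Φ : Fin N × Fin 2 → Config N → ℝ}
    (hΦ : ∀ p, ContDiff ℝ ((⊤ : ℕ∞) : WithTop ℕ∞) (Φ p)) {C : ℝ} (h1 : ∀ p Y, |Φ p Y| ≤ C)
    (h2 : ∀ p Y, |fderiv ℝ (Φ p) Y (posDir p)| ≤ C) (G : ProbabilityMeasure (Config N)) :
    ENNReal.ofReal (∫ Y, fisherIntegrand Φ Y ∂(G : Measure (Config N))) ≤
      N * partialFisher G := by
  obtain ⟨χ, B, hB, hχ, hχc, hχ1, hχB, hχe⟩ := exists_cutoff (Config N)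
  have hΦd : ∀ p Y, DifferentiableAt ℝ (Φ p) Y := fun p => (hΦ p).differentiable (by simp)
  have hχd : ∀ n Y, DifferentiableAt ℝ (χ n) Y := fun n => (hχ n).differentiable (by simp)
  have hder : ∀ n p Y, fderiv ℝ (fun Y => χ n Y * Φ p Y) Y (posDir p) =
      χ n Y * fderiv ℝ (Φ p) Y (posDir p) + Φ p Y * fderiv ℝ (χ n) Y (posDir p) := by
    intro n p Y
    rw [fderiv_fun_mul (hχd n Y) (hΦd p Y)]
    simp
  have htest : ∀ n, IsTestField fun p Y => χ n Y * Φ p Y := fun n =>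
    ⟨fun p => (hχ n).mul (hΦ p), fun p => (hχc n).mul_right⟩
  obtain ⟨V, hV⟩ : ∃ V : ℝ, ∀ p : Fin N × Fin 2, ‖(posDir p : Config N)‖ ≤ V :=
    ⟨∑ p, ‖(posDir p : Config N)‖, fun p => Finset.single_le_sum
      (f := fun p => ‖(posDir p : Config N)‖) (fun _ _ => norm_nonneg _) (Finset.mem_univ p)⟩
  have hb1 : ∀ n p Y, |χ n Y * Φ p Y| ≤ C + C * (B * V) := fun n p Y => by
    have hC : 0 ≤ C := (abs_nonneg _).trans (h1 p Y)
    have hV0 : 0 ≤ V := (norm_nonneg _).trans (hV p)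
    rw [abs_mul]
    calc |χ n Y| * |Φ p Y| ≤ 1 * C := mul_le_mul (hχ1 n Y) (h1 p Y) (abs_nonneg _) zero_le_one
      _ ≤ C + C * (B * V) := by
          have : 0 ≤ C * (B * V) := by positivity
          linarith
  have hb2 : ∀ n p Y, |fderiv ℝ (fun Y => χ n Y * Φ p Y) Y (posDir p)| ≤ C + C * (B * V) :=
    fun n p Y => by
    have hC : 0 ≤ C := (abs_nonneg _).trans (h1 p Y)
    rw [hder]
    refine (abs_add_le _ _).trans ?_
    rw [abs_mul, abs_mul]
    have h3 : |fderiv ℝ (χ n) Y (posDir p)| ≤ B * V :=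
      ((fderiv ℝ (χ n) Y).le_opNorm _).trans
        (mul_le_mul (hχB n Y) (hV p) (norm_nonneg _) hB)
    calc |χ n Y| * |fderiv ℝ (Φ p) Y (posDir p)| + |Φ p Y| * |fderiv ℝ (χ n) Y (posDir p)|
        ≤ 1 * C + C * (B * V) := add_le_add
          (mul_le_mul (hχ1 n Y) (h2 p Y) (abs_nonneg _) zero_le_one)
          (mul_le_mul (h1 p Y) h3 (abs_nonneg _) hC)
      _ = _ := by rw [one_mul]
  have hlim := integral_tendsto_of_bounded (G : Measure (Config N))
    (u := fun n => fisherIntegrand fun p Y => χ n Y * Φ p Y) (f := fisherIntegrand Φ)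
    (fun n => continuous_fisherIntegrand (htest n).contDiff)
    (fun n Y => fisherIntegrand_bound (hb1 n) (hb2 n) Y) (fun Y => by
      refine tendsto_const_nhds.congr' ?_
      filter_upwards [hχe Y] with n hn
      unfold fisherIntegrand
      refine Finset.sum_congr rfl fun p _ => ?_
      have h3 : χ n Y = 1 := hn.eq_of_nhds
      rw [hder, hn.fderiv_eq, h3]
      simp [h3])
  exact le_of_tendsto ((ENNReal.continuous_ofReal.tendsto _).comp hlim)
    (Eventually.of_forall fun n => (htest n).ofReal_integral_le G)

theorem fderiv_comp_apply {E E' : Type*} [NormedAddCommGroup E] [NormedSpace ℝ E]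
    [NormedAddCommGroup E'] [NormedSpace ℝ E'] {φ : E' → ℝ}
    (h : ContDiff ℝ ((⊤ : ℕ∞) : WithTop ℕ∞) φ) {a : E → E'} {L : E →L[ℝ] E'} {x : E}
    (ha : HasFDerivAt a L x) (v : E) :
    fderiv ℝ (fun x => φ (a x)) x v = fderiv ℝ φ (a x) (L v) := by
  have h1 := ((h.differentiable (by simp)) (a x)).hasFDerivAt.comp x ha
  rw [show (fun x => φ (a x)) = φ ∘ a from rfl, h1.fderiv]
  rfl

/-- The restriction to a block, as a linear map. -/
noncomputable def blockCLM {n j N : ℕ} (h : n * j ≤ N) (b : Fin n) : Config N →L[ℝ] Config j :=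
  ContinuousLinearMap.pi fun q => ContinuousLinearMap.proj (blockIdx h b q)

theorem blockCLM_apply {n j N : ℕ} (h : n * j ≤ N) (b : Fin n) (Y : Config N) :
    blockCLM h b Y = block h b Y := rfl

theorem blockCLM_posDir {n j N : ℕ} (h : n * j ≤ N) (b : Fin n) (p : Fin j × Fin 2) :
    blockCLM h b (posDir (blockIdx h b p.1, p.2)) = posDir p := by
  rw [blockCLM_apply]
  funext q
  by_cases hq : q = p.1
  · subst hq
    simp [block, posDir]
  · have : blockIdx h b q ≠ blockIdx h b p.1 := fun h' => hq ((blockIdx_inj h).1 h').2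
    simp [block, posDir, Pi.single_eq_of_ne this, Pi.single_eq_of_ne hq]

/-- The field which acts as `Φ` on each of several disjoint blocks. -/
theorem ofReal_integral_sum_block_le {n j N : ℕ} (h : n * j ≤ N)
    {Φ : Fin j × Fin 2 → Config j → ℝ} (hΦ : IsTestField Φ) (G : ProbabilityMeasure (Config N)) :
    ENNReal.ofReal (∫ Y, ∑ b, fisherIntegrand Φ (block h b Y) ∂(G : Measure (Config N))) ≤
      N * partialFisher G := by
  obtain ⟨C, h1, h2⟩ := hΦ.exists_bound
  let e : Fin n × (Fin j × Fin 2) → Fin N × Fin 2 := fun q => (blockIdx h q.1 q.2.1, q.2.2)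
  have he : Function.Injective e := fun q q' hq => by
    have h3 := (blockIdx_inj h).1 (congrArg Prod.fst hq)
    have h4 : q.2.2 = q'.2.2 := congrArg (fun x : Fin N × Fin 2 => x.2) hq
    exact Prod.ext h3.1 (Prod.ext h3.2 h4)
  let Ψ : Fin N × Fin 2 → Config N → ℝ :=
    Function.extend e (fun q Y => Φ q.2 (block h q.1 Y)) 0
  have hΨe : ∀ q, Ψ (e q) = fun Y => Φ q.2 (block h q.1 Y) := fun q => he.extend_apply _ _ q
  have hΨn : ∀ p, p ∉ Set.range e → Ψ p = 0 := fun p hp => Function.extend_apply' _ _ _ hp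
  have hder : ∀ q Y, fderiv ℝ (Ψ (e q)) Y (posDir (e q)) =
      fderiv ℝ (Φ q.2) (block h q.1 Y) (posDir q.2) := fun q Y => by
    have ha : HasFDerivAt (block h q.1) (blockCLM h q.1) Y := (blockCLM h q.1).hasFDerivAt
    rw [hΨe, fderiv_comp_apply (hΦ.contDiff q.2) ha, blockCLM_posDir]
  have hcase : ∀ p, (∃ q, e q = p) ∨ Ψ p = 0 := fun p => by
    by_cases hp : p ∈ Set.range e
    · exact Or.inl hp
    · exact Or.inr (hΨn p hp)
  have hsum : ∀ Y, ∑ b, fisherIntegrand Φ (block h b Y) = fisherIntegrand Ψ Y := fun Y => by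
    unfold fisherIntegrand
    rw [← Fintype.sum_prod_type' (f := fun (b : Fin n) (p : Fin j × Fin 2) =>
      -2 * fderiv ℝ (Φ p) (block h b Y) (posDir p) - Φ p (block h b Y) ^ 2)]
    refine Fintype.sum_of_injective e he _ _ (fun p hp => ?_) fun q => ?_
    · rw [hΨn p hp]
      simp
    · rw [hder, hΨe]
  simp_rw [hsum]
  refine ofReal_integral_fisherIntegrand_le (C := |C|) (fun p => ?_) (fun p Y => ?_)
    (fun p Y => ?_) G
  · rcases hcase p with ⟨q, rfl⟩ | hp
    · rw [hΨe]
      exact (hΦ.contDiff q.2).comp (blockCLM h q.1).contDiff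
    · rw [hp]
      exact contDiff_const
  · rcases hcase p with ⟨q, rfl⟩ | hp
    · rw [hΨe]
      exact (h1 _ _).trans (le_abs_self C)
    · rw [hp]
      simp
  · rcases hcase p with ⟨q, rfl⟩ | hp
    · rw [hder]
      exact (h2 _ _).trans (le_abs_self C)
    · rw [hp]
      simp

/-- Freezing all but one vortex turns a field on configurations into a field for one vortex. -/
theorem ofReal_integral_tensorPower_fisherIntegrand_le {j : ℕ} {Φ : Fin j × Fin 2 → Config j → ℝ}
    (hΦ : IsTestField Φ) (g : ProbabilityMeasure State) :
    ENNReal.ofReal (∫ Y, fisherIntegrand Φ Y ∂(tensorPower g j : Measure (Config j))) ≤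
      j * partialFisher (tensorPower g 1) := by
  rcases Nat.eq_zero_or_pos j with rfl | hj
  · simp [fisherIntegrand]
  have hj0 : (j : ℝ≥0∞) ≠ 0 := by exact_mod_cast hj.ne'
  by_cases htop : partialFisher (tensorPower g 1) = ⊤
  · rw [htop, ENNReal.mul_top hj0]
    exact le_top
  obtain ⟨C, h1, h2⟩ := hΦ.exists_bound
  obtain ⟨i, rfl⟩ : ∃ i, j = i + 1 := ⟨j - 1, by omega⟩
  let f : Fin (i + 1) → Config (i + 1) → ℝ := fun l Y =>
    ∑ a : Fin 2, (-2 * fderiv ℝ (Φ (l, a)) Y (posDir (l, a)) - Φ (l, a) Y ^ 2)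
  have hfc : ∀ l, Continuous (f l) := fun l => continuous_finsetSum _ fun a _ =>
    ((continuous_fderiv_apply_of_contDiff (hΦ.contDiff _) _).const_mul _).sub
      ((hΦ.contDiff _).continuous.pow 2)
  have hfb : ∀ l Y, ‖f l Y‖ ≤ ∑ _a : Fin 2, (2 * C + C ^ 2) := fun l Y => by
    refine norm_sum_le_of_le _ fun a _ => (norm_sub_le _ _).trans ?_
    rw [norm_mul, norm_pow, Real.norm_eq_abs, Real.norm_eq_abs, Real.norm_eq_abs,
      show |(-2 : ℝ)| = 2 by norm_num]
    gcongr
    · exact h2 _ Y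
    · exact h1 _ Y
  have hone : ∀ (l : Fin (i + 1)) (Y : Config (i + 1)),
      ∫ y, f l (Function.update Y l y) ∂(g : Measure State) ≤
        (partialFisher (tensorPower g 1)).toReal := by
    intro l Y
    have hup : ∀ Z : Config 1, HasFDerivAt (fun Z : Config 1 => Function.update Y l (Z 0))
        ((ContinuousLinearMap.pi (Pi.single l (ContinuousLinearMap.id ℝ State))).comp
          (ContinuousLinearMap.proj 0)) Z := fun Z =>
      HasFDerivAt.comp (g := Function.update Y l) (f := fun Z : Config 1 => Z 0) Z
        (hasFDerivAt_update Y (Z 0)) (hasFDerivAt_apply (𝕜 := ℝ) (0 : Fin 1) Z)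
    have hdir : ∀ p : Fin 1 × Fin 2,
        ((ContinuousLinearMap.pi (Pi.single l (ContinuousLinearMap.id ℝ State))).comp
          (ContinuousLinearMap.proj 0)) (posDir p) = (posDir (l, p.2) : Config (i + 1)) :=
        fun p => by
      have hp : p.1 = 0 := Subsingleton.elim _ _
      funext q
      by_cases hq : q = l
      · subst hq
        simp [posDir, hp]
      · simp [posDir, hp, Pi.single_eq_of_ne hq]
    let Ψ : Fin 1 × Fin 2 → Config 1 → ℝ := fun p Z => Φ (l, p.2) (Function.update Y l (Z 0))
    have hder : ∀ p Z, fderiv ℝ (Ψ p) Z (posDir p) =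
        fderiv ℝ (Φ (l, p.2)) (Function.update Y l (Z 0)) (posDir (l, p.2)) := fun p Z => by
      rw [fderiv_comp_apply (hΦ.contDiff _) (hup Z), hdir]
    have h3 := ofReal_integral_fisherIntegrand_le (Φ := Ψ) (C := C)
      (fun p => (hΦ.contDiff _).comp ((contDiff_update _ Y l).comp (contDiff_apply ℝ State 0)))
      (fun p Z => h1 _ _) (fun p Z => by rw [hder]; exact h2 _ _) (tensorPower g 1)
    rw [Nat.cast_one, one_mul, ENNReal.ofReal_le_iff_le_toReal htop] at h3
    refine le_trans (le_of_eq ?_) h3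
    have h4 : ∀ Z, fisherIntegrand Ψ Z = f l (Function.update Y l (Z 0)) := fun Z => by
      unfold fisherIntegrand
      simp_rw [hder]
      rw [Fintype.sum_prod_type]
      simp [Ψ, f]
    simp_rw [h4, tensorPower, ProbabilityMeasure.toMeasure_pi]
    exact (integral_comp_eval (μ := fun _ : Fin 1 => (g : Measure State)) (i := 0)
      (((hfc l).comp (continuous_const.update l continuous_id)).aestronglyMeasurable)).symm
  have hl : ∀ l, ∫ Y, f l Y ∂(tensorPower g (i + 1) : Measure (Config (i + 1))) ≤
      (partialFisher (tensorPower g 1)).toReal := by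
    intro l
    have hg := (measurePreserving_piFinSuccAbove
      (fun _ : Fin (i + 1) => (g : Measure State)) l).symm
    let e := MeasurableEquiv.piFinSuccAbove (fun _ : Fin (i + 1) => State) l
    have hm : Measurable fun p => f l (e.symm p) := (hfc l).measurable.comp e.symm.measurable
    have hint := integrable_of_measurable_bounded ((g : Measure State).prod
      (Measure.pi fun _ : Fin i => (g : Measure State))) hm ⟨_, fun p => hfb l _⟩
    have h3 : ∫ Y, f l Y ∂(tensorPower g (i + 1) : Measure (Config (i + 1))) =
        ∫ Z, ∫ y, f l (e.symm (y, Z)) ∂(g : Measure State)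
          ∂(Measure.pi fun _ : Fin i => (g : Measure State)) := by
      rw [← integral_prod_symm _ hint]
      exact (hg.integral_comp' (f l)).symm
    rw [h3]
    refine (integral_mono hint.integral_prod_right (integrable_const
      (partialFisher (tensorPower g 1)).toReal) fun Z => ?_).trans (by simp)
    refine le_trans (le_of_eq ?_) (hone l (Fin.insertNth l 0 Z))
    simp_rw [Fin.update_insertNth]
    rfl
  have h3 : ∫ Y, fisherIntegrand Φ Y ∂(tensorPower g (i + 1) : Measure (Config (i + 1))) =
      ∑ l, ∫ Y, f l Y ∂(tensorPower g (i + 1) : Measure (Config (i + 1))) := by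
    rw [← integral_finsetSum _ fun l _ => integrable_of_continuous_bounded _ (hfc l) ⟨_, hfb l⟩]
    simp_rw [fisherIntegrand, Fintype.sum_prod_type, f]
  rw [h3]
  refine (ENNReal.ofReal_le_ofReal (Finset.sum_le_sum fun l _ => hl l)).trans (le_of_eq ?_)
  rw [Finset.sum_const, Finset.card_univ, Fintype.card_fin, nsmul_eq_mul,
    ENNReal.ofReal_mul (by positivity), ENNReal.ofReal_natCast, ENNReal.ofReal_toReal htop]

/-! ### Gibbs weights and maxima of sums -/

section Softmax

variable {ι : Type*} [Fintype ι]

/-- The Gibbs weights `e^{sᵢ} / ∑ₖ e^{sₖ}`. -/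
noncomputable def softmax (s : ι → ℝ) (i : ι) : ℝ := Real.exp (s i) / ∑ k, Real.exp (s k)

variable [Nonempty ι]

theorem sum_exp_pos (s : ι → ℝ) : 0 < ∑ k, Real.exp (s k) :=
  Finset.sum_pos (fun _ _ => Real.exp_pos _) Finset.univ_nonempty

theorem softmax_nonneg (s : ι → ℝ) (i : ι) : 0 ≤ softmax s i :=
  div_nonneg (Real.exp_pos _).le (sum_exp_pos s).le

theorem sum_softmax (s : ι → ℝ) : ∑ i, softmax s i = 1 := by
  unfold softmax
  rw [← Finset.sum_div, div_self (sum_exp_pos s).ne']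

/-- The Gibbs weights concentrate near the maximum, since `t e^{-t} ≤ 1`. -/
theorem sup_sub_card_le_sum_softmax (s : ι → ℝ) :
    Finset.univ.sup' Finset.univ_nonempty s - Fintype.card ι ≤ ∑ i, softmax s i * s i := by
  obtain ⟨i₀, -, hi₀⟩ := Finset.exists_mem_eq_sup' Finset.univ_nonempty s
  have hle : ∀ i, s i ≤ s i₀ := fun i => by
    rw [← hi₀]
    exact Finset.le_sup' s (Finset.mem_univ i)
  rw [hi₀]
  have h1 : ∀ i, softmax s i * (s i₀ - s i) ≤ 1 := fun i => by
    have h2 : Real.exp (s i₀) ≤ ∑ k, Real.exp (s k) :=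
      Finset.single_le_sum (f := fun k => Real.exp (s k)) (fun _ _ => (Real.exp_pos _).le)
        (Finset.mem_univ i₀)
    have h3 : s i₀ - s i ≤ Real.exp (s i₀ - s i) := by
      linarith [Real.add_one_le_exp (s i₀ - s i)]
    have h4 : Real.exp (s i) * Real.exp (s i₀ - s i) = Real.exp (s i₀) := by
      rw [← Real.exp_add]; congr 1; ring
    rw [softmax, div_mul_eq_mul_div, div_le_one (sum_exp_pos s)]
    refine le_trans ?_ h2
    rw [← h4]
    gcongr
  have h5 : s i₀ - ∑ i, softmax s i * s i = ∑ i, softmax s i * (s i₀ - s i) := by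
    simp_rw [mul_sub]
    rw [Finset.sum_sub_distrib, ← Finset.sum_mul, sum_softmax, one_mul]
  have h6 : ∑ i, softmax s i * (s i₀ - s i) ≤ ∑ _i : ι, (1 : ℝ) := Finset.sum_le_sum fun i _ => h1 i
  rw [← h5] at h6
  simp only [Finset.sum_const, Finset.card_univ, nsmul_eq_mul, mul_one] at h6
  linarith

theorem sq_sum_softmax_le (s a : ι → ℝ) :
    (∑ i, softmax s i * a i) ^ 2 ≤ ∑ i, softmax s i * a i ^ 2 :=
  Real.pow_arith_mean_le_arith_mean_pow_of_even _ _ _ (fun i _ => softmax_nonneg s i)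
    (sum_softmax s) even_two

variable {E : Type*} [NormedAddCommGroup E] [NormedSpace ℝ E] {S : ι → E → ℝ}

theorem contDiff_softmax (hS : ∀ i, ContDiff ℝ ((⊤ : ℕ∞) : WithTop ℕ∞) (S i)) (i : ι) :
    ContDiff ℝ ((⊤ : ℕ∞) : WithTop ℕ∞) fun x => softmax (fun k => S k x) i :=
  (hS i).exp.div (ContDiff.sum fun k _ => (hS k).exp) fun x => (sum_exp_pos fun k => S k x).ne'

theorem abs_fderiv_softmax_le (hS : ∀ i, ContDiff ℝ ((⊤ : ℕ∞) : WithTop ℕ∞) (S i)) {x v : E}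
    {b : ℝ} (hb : ∀ i, |fderiv ℝ (S i) x v| ≤ b) (i : ι) :
    |fderiv ℝ (fun x => softmax (fun k => S k x) i) x v| ≤ 2 * b * softmax (fun k => S k x) i := by
  have hd : ∀ i, HasFDerivAt (S i) (fderiv ℝ (S i) x) x := fun i =>
    ((hS i).differentiable (by simp) x).hasFDerivAt
  have hZ : HasFDerivAt (fun x => ∑ k, Real.exp (S k x))
      (∑ k, Real.exp (S k x) • fderiv ℝ (S k) x) x := HasFDerivAt.fun_sum fun k _ => (hd k).exp
  have hpos : ∀ y, 0 < ∑ k, Real.exp (S k y) := fun y => sum_exp_pos fun k => S k y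
  have hlog := hZ.log (hpos x).ne'
  have hw : (fun x => softmax (fun k => S k x) i) =
      fun x => Real.exp (S i x - Real.log (∑ k, Real.exp (S k x))) := by
    funext y
    rw [Real.exp_sub, Real.exp_log (hpos y)]
    rfl
  have hder := ((hd i).fun_sub hlog).exp
  have hval : Real.exp (S i x - Real.log (∑ k, Real.exp (S k x))) =
      softmax (fun k => S k x) i := (congrFun hw x).symm
  have hmean : |(∑ k, Real.exp (S k x))⁻¹ * ∑ k, Real.exp (S k x) * fderiv ℝ (S k) x v| ≤ b := by
    rw [abs_mul, abs_of_pos (inv_pos.2 (hpos x)), inv_mul_le_iff₀ (hpos x), Finset.sum_mul]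
    refine (Finset.abs_sum_le_sum_abs _ _).trans (Finset.sum_le_sum fun k _ => ?_)
    rw [abs_mul, abs_of_pos (Real.exp_pos _)]
    exact mul_le_mul_of_nonneg_left (hb k) (Real.exp_pos _).le
  have heq : fderiv ℝ (fun x => softmax (fun k => S k x) i) x v =
      softmax (fun k => S k x) i * (fderiv ℝ (S i) x v -
        (∑ k, Real.exp (S k x))⁻¹ * ∑ k, Real.exp (S k x) * fderiv ℝ (S k) x v) := by
    rw [hw, hder.fderiv, ← hval]
    simp
  rw [heq, abs_mul, abs_of_nonneg (softmax_nonneg _ i), mul_comm]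
  refine mul_le_mul_of_nonneg_right ((abs_sub _ _).trans ?_) (softmax_nonneg _ i)
  linarith [hb i]

end Softmax

theorem contDiff_fisherIntegrand {N : ℕ} {Φ : Fin N × Fin 2 → Config N → ℝ}
    (hΦ : ∀ p, ContDiff ℝ ((⊤ : ℕ∞) : WithTop ℕ∞) (Φ p)) :
    ContDiff ℝ ((⊤ : ℕ∞) : WithTop ℕ∞) (fisherIntegrand Φ) :=
  ContDiff.sum fun p _ => ((contDiff_const.mul
    (((hΦ p).fderiv_right (m := ((⊤ : ℕ∞) : WithTop ℕ∞)) (by simp)).clm_apply contDiff_const))).sub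
      ((hΦ p).pow 2)

theorem IsTestField.hasCompactSupport_fisherIntegrand {N : ℕ} {Φ : Fin N × Fin 2 → Config N → ℝ}
    (hΦ : IsTestField Φ) : HasCompactSupport (fisherIntegrand Φ) := by
  refine HasCompactSupport.intro (isCompact_iUnion fun p => hΦ.compact p) fun Y hY => ?_
  rw [Set.mem_iUnion, not_exists] at hY
  refine Finset.sum_eq_zero fun p _ => ?_
  rw [image_eq_zero_of_notMem_tsupport (hY p), fderiv_of_notMem_tsupport ℝ (hY p)]
  simp

/-- The projection to the `l`-th vortex, as a linear map. -/
noncomputable def vortexCLM {j : ℕ} (l : Fin j) : Config j →L[ℝ] Config 1 :=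
  ContinuousLinearMap.pi fun _ => ContinuousLinearMap.proj l

theorem hasFDerivAt_vortex {j : ℕ} (l : Fin j) (Y : Config j) :
    HasFDerivAt (fun (Y : Config j) (_ : Fin 1) => Y l) (vortexCLM l) Y :=
  (vortexCLM l).hasFDerivAt

theorem vortexCLM_posDir_self {j : ℕ} (l : Fin j) (a : Fin 2) :
    vortexCLM l (posDir (l, a)) = posDir (0, a) := by
  funext q
  rw [Subsingleton.elim q 0]
  simp [vortexCLM, posDir]

theorem vortexCLM_posDir_of_ne {j : ℕ} {l l' : Fin j} (h : l' ≠ l) (a : Fin 2) :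
    vortexCLM l' (posDir (l, a)) = 0 := by
  funext q
  simp [vortexCLM, posDir, Pi.single_eq_of_ne h]

/-- The maximum of finitely many sums `∑ₗ ψᵢ(Yₗ)` is controlled by using the fields with the Gibbs
weights of inverse temperature `j ^ (-1/2)`. -/
theorem partialFisher_max {m : ℕ} (ψ : Fin (m + 1) → Config 1 → ℝ) (hψ : ∀ i, ψ i ∈ fisherTests 1) :
    ∃ C : ℝ, ∀ j, 1 ≤ j → ∀ G : ProbabilityMeasure (Config j),
      ENNReal.ofReal ((j : ℝ)⁻¹ * ∫ Y, Finset.univ.sup' Finset.univ_nonempty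
          (fun i => ∑ l, ψ i (fun _ => Y l)) ∂(G : Measure (Config j)) - C / √j) ≤
        partialFisher G := by
  choose Φ hΦ hψΦ using hψ
  obtain rfl : ψ = fun i => fisherIntegrand (Φ i) := funext hψΦ
  choose C₀ hC1 hC2 using fun i => (hΦ i).exists_bound
  have hψs : ∀ i, ContDiff ℝ ((⊤ : ℕ∞) : WithTop ℕ∞) (fisherIntegrand (Φ i)) := fun i =>
    contDiff_fisherIntegrand (hΦ i).contDiff
  choose B₀ hB₀ using fun i => ((hΦ i).hasCompactSupport_fisherIntegrand.fderiv
    (𝕜 := ℝ)).exists_bound_of_continuous ((hψs i).continuous_fderiv (by simp))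
  choose D₀ hD₀ using fun i => (hΦ i).hasCompactSupport_fisherIntegrand.exists_bound_of_continuous
    (hψs i).continuous
  obtain ⟨C, hC⟩ : ∃ C : ℝ, ∀ i, C₀ i ≤ C := 
    ⟨Finset.univ.sup' Finset.univ_nonempty C₀, fun i => Finset.le_sup' C₀ (Finset.mem_univ i)⟩
  obtain ⟨D, hD⟩ : ∃ D : ℝ, ∀ i, D₀ i ≤ D := 
    ⟨Finset.univ.sup' Finset.univ_nonempty D₀, fun i => Finset.le_sup' D₀ (Finset.mem_univ i)⟩
  obtain ⟨B, hB⟩ : ∃ B : ℝ, ∀ i (a : Fin 2), B₀ i * ‖(posDir (0, a) : Config 1)‖ ≤ B :=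
    ⟨Finset.univ.sup' Finset.univ_nonempty fun q : Fin (m + 1) × Fin 2 =>
      B₀ q.1 * ‖(posDir (0, q.2) : Config 1)‖, fun i a =>
      Finset.le_sup' (fun q : Fin (m + 1) × Fin 2 =>
        B₀ q.1 * ‖(posDir (0, q.2) : Config 1)‖) (Finset.mem_univ (i, a))⟩
  have hCnn : 0 ≤ C := ((abs_nonneg _).trans (hC1 0 (0, 0) 0)).trans (hC 0)
  have hBψ : ∀ i a Z, |fderiv ℝ (fisherIntegrand (Φ i)) Z (posDir (0, a))| ≤ B := fun i a Z =>
    ((ContinuousLinearMap.le_opNorm _ _).trans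
      (mul_le_mul_of_nonneg_right (hB₀ i Z) (norm_nonneg _))).trans (hB i a)
  have hBnn : 0 ≤ B := (abs_nonneg _).trans (hBψ 0 0 0)
  refine ⟨8 * B * C + (m + 1), fun j hj G => ?_⟩
  have hj0 : (0 : ℝ) < j := by exact_mod_cast hj
  have hsj : 0 < √(j : ℝ) := Real.sqrt_pos.2 hj0
  let S : Fin (m + 1) → Config j → ℝ := fun i Y => ∑ l, fisherIntegrand (Φ i) fun _ => Y l
  let s : Fin (m + 1) → Config j → ℝ := fun i Y => (√(j : ℝ))⁻¹ * S i Y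
  have hSs : ∀ i, ContDiff ℝ ((⊤ : ℕ∞) : WithTop ℕ∞) (S i) := fun i =>
    ContDiff.sum fun l _ => (hψs i).comp (vortexCLM l).contDiff
  have hss : ∀ i, ContDiff ℝ ((⊤ : ℕ∞) : WithTop ℕ∞) (s i) := fun i =>
    contDiff_const.mul (hSs i)
  have hsd : ∀ i Y p, |fderiv ℝ (s i) Y (posDir p)| ≤ (√(j : ℝ))⁻¹ * B := by
    rintro i Y ⟨l, a⟩
    have h1 : HasFDerivAt (s i) ((√(j : ℝ))⁻¹ • ∑ l, (fderiv ℝ (fisherIntegrand (Φ i))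
        fun _ => Y l).comp (vortexCLM l)) Y := by
      refine HasFDerivAt.const_mul (HasFDerivAt.fun_sum fun l _ => ?_) _
      exact HasFDerivAt.comp (g := fisherIntegrand (Φ i))
        (f := fun (Y : Config j) (_ : Fin 1) => Y l)
        Y ((hψs i).differentiable (by simp) _).hasFDerivAt (hasFDerivAt_vortex l Y)
    have h2 : fderiv ℝ (s i) Y (posDir (l, a)) =
        (√(j : ℝ))⁻¹ * fderiv ℝ (fisherIntegrand (Φ i)) (fun _ => Y l) (posDir (0, a)) := by
      rw [h1.fderiv, smul_apply, sum_apply,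
        Finset.sum_eq_single l]
      · rw [ContinuousLinearMap.comp_apply, vortexCLM_posDir_self, smul_eq_mul]
      · intro l' _ hl'
        rw [ContinuousLinearMap.comp_apply, vortexCLM_posDir_of_ne hl', map_zero]
      · simp
    rw [h2, abs_mul, abs_of_pos (inv_pos.2 hsj)]
    exact mul_le_mul_of_nonneg_left (hBψ i a _) (inv_pos.2 hsj).le
  let w : Fin (m + 1) → Config j → ℝ := fun i Y => softmax (fun k => s k Y) i
  have hws : ∀ i, ContDiff ℝ ((⊤ : ℕ∞) : WithTop ℕ∞) (w i) := fun i => contDiff_softmax hss i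
  have hwnn : ∀ i Y, 0 ≤ w i Y := fun i Y => softmax_nonneg _ i
  have hw1 : ∀ Y, ∑ i, w i Y = 1 := fun Y => sum_softmax _
  have hwd : ∀ i Y p, |fderiv ℝ (w i) Y (posDir p)| ≤ 2 * ((√(j : ℝ))⁻¹ * B) * w i Y :=
    fun i Y p => abs_fderiv_softmax_le hss (fun i => hsd i Y p) i
  let φ : Fin (m + 1) → Fin j × Fin 2 → Config j → ℝ := fun i p Y => Φ i (0, p.2) fun _ => Y p.1
  have hφs : ∀ i p, ContDiff ℝ ((⊤ : ℕ∞) : WithTop ℕ∞) (φ i p) := fun i p =>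
    ((hΦ i).contDiff _).comp (vortexCLM p.1).contDiff
  have hφd : ∀ i p Y, fderiv ℝ (φ i p) Y (posDir p) =
      fderiv ℝ (Φ i (0, p.2)) (fun _ => Y p.1) (posDir (0, p.2)) := fun i p Y => by
    rw [fderiv_comp_apply ((hΦ i).contDiff _) (hasFDerivAt_vortex p.1 Y), vortexCLM_posDir_self]
  have hφ1 : ∀ i p Y, |φ i p Y| ≤ C := fun i p Y => (hC1 i _ _).trans (hC i)
  have hφ2 : ∀ i p Y, |fderiv ℝ (φ i p) Y (posDir p)| ≤ C := fun i p Y => by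
    rw [hφd]
    exact (hC2 i _ _).trans (hC i)
  have hSφ : ∀ i Y, S i Y = ∑ p, (-2 * fderiv ℝ (φ i p) Y (posDir p) - φ i p Y ^ 2) :=
    fun i Y => by
    simp_rw [hφd, S, fisherIntegrand, φ, Fintype.sum_prod_type]
    simp
  let Ψ : Fin j × Fin 2 → Config j → ℝ := fun p Y => ∑ i, w i Y * φ i p Y
  have hΨs : ∀ p, ContDiff ℝ ((⊤ : ℕ∞) : WithTop ℕ∞) (Ψ p) := fun p =>
    ContDiff.sum fun i _ => (hws i).mul (hφs i p)
  have hΨd : ∀ p Y, fderiv ℝ (Ψ p) Y (posDir p) = ∑ i, w i Y * fderiv ℝ (φ i p) Y (posDir p) +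
      ∑ i, φ i p Y * fderiv ℝ (w i) Y (posDir p) := fun p Y => by
    have h1 : HasFDerivAt (Ψ p)
        (∑ i, (w i Y • fderiv ℝ (φ i p) Y + φ i p Y • fderiv ℝ (w i) Y)) Y :=
      HasFDerivAt.fun_sum fun i _ => ((hws i).differentiable (by simp) Y).hasFDerivAt.mul
        ((hφs i p).differentiable (by simp) Y).hasFDerivAt
    rw [h1.fderiv]
    simp [Finset.sum_add_distrib]
  have hconv : ∀ (Y : Config j) (c : ℝ) (a : Fin (m + 1) → ℝ), (∀ i, |a i| ≤ c) →
      |∑ i, w i Y * a i| ≤ c := fun Y c a ha => by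
    calc |∑ i, w i Y * a i| ≤ ∑ i, w i Y * c :=
          (Finset.abs_sum_le_sum_abs _ _).trans (Finset.sum_le_sum fun i _ => by
            rw [abs_mul, abs_of_nonneg (hwnn i Y)]
            exact mul_le_mul_of_nonneg_left (ha i) (hwnn i Y))
      _ = c := by rw [← Finset.sum_mul, hw1, one_mul]
  have herr : ∀ p Y, |∑ i, φ i p Y * fderiv ℝ (w i) Y (posDir p)| ≤
      2 * ((√(j : ℝ))⁻¹ * B) * C := fun p Y => by
    calc |∑ i, φ i p Y * fderiv ℝ (w i) Y (posDir p)|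
        ≤ ∑ i, C * (2 * ((√(j : ℝ))⁻¹ * B) * w i Y) :=
          (Finset.abs_sum_le_sum_abs _ _).trans (Finset.sum_le_sum fun i _ => by
            rw [abs_mul]
            exact mul_le_mul (hφ1 i p Y) (hwd i Y p) (abs_nonneg _) hCnn)
      _ = _ := by
          rw [← Finset.mul_sum, ← Finset.mul_sum, hw1]
          ring
  have hlow : ∀ Y, Finset.univ.sup' Finset.univ_nonempty (fun i => S i Y) -
      (8 * B * C + (m + 1)) * √j ≤ fisherIntegrand Ψ Y := fun Y => by
    have h1 : ∑ i, w i Y * S i Y - 8 * B * C * √j ≤ fisherIntegrand Ψ Y := by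
      have h2 : ∀ p, ∑ i, w i Y * (-2 * fderiv ℝ (φ i p) Y (posDir p) - φ i p Y ^ 2) -
          2 * (2 * ((√(j : ℝ))⁻¹ * B) * C) ≤
            -2 * fderiv ℝ (Ψ p) Y (posDir p) - Ψ p Y ^ 2 := fun p => by
        have h3 : Ψ p Y ^ 2 ≤ ∑ i, w i Y * φ i p Y ^ 2 := sq_sum_softmax_le _ _
        have h4 := (abs_le.1 (herr p Y)).2
        have h5 : ∑ i, w i Y * (-2 * fderiv ℝ (φ i p) Y (posDir p) - φ i p Y ^ 2) =
            -2 * ∑ i, w i Y * fderiv ℝ (φ i p) Y (posDir p) - ∑ i, w i Y * φ i p Y ^ 2 := by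
          rw [Finset.mul_sum, ← Finset.sum_sub_distrib]
          exact Finset.sum_congr rfl fun i _ => by ring
        rw [hΨd, h5]
        linarith
      have h6 := Finset.sum_le_sum fun p (_ : p ∈ Finset.univ) => h2 p
      rw [Finset.sum_sub_distrib, Finset.sum_comm] at h6
      simp_rw [← Finset.mul_sum, ← hSφ] at h6
      refine le_trans (le_of_eq ?_) h6
      have h7 : (j : ℝ) * (√(j : ℝ))⁻¹ = √j := by rw [← div_eq_mul_inv, Real.div_sqrt]
      simp only [Finset.sum_const, Finset.card_univ, Fintype.card_prod, Fintype.card_fin,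
        nsmul_eq_mul]
      push_cast
      linear_combination 8 * B * C * h7
    have h8 := sup_sub_card_le_sum_softmax fun k => s k Y
    obtain ⟨i₀, -, hi₀⟩ := Finset.exists_mem_eq_sup' Finset.univ_nonempty (fun i => S i Y)
    have h9 : (√(j : ℝ))⁻¹ * S i₀ Y - (m + 1) ≤ (√(j : ℝ))⁻¹ * ∑ i, w i Y * S i Y := by
      have h10 := Finset.le_sup' (fun k => s k Y) (Finset.mem_univ i₀)
      rw [Fintype.card_fin] at h8
      push_cast at h8
      have h11 : ∑ i, softmax (fun k => s k Y) i * s i Y =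
          (√(j : ℝ))⁻¹ * ∑ i, w i Y * S i Y := by
        rw [Finset.mul_sum]
        exact Finset.sum_congr rfl fun i _ => by simp only [w, s]; ring
      rw [← h11]
      refine le_trans ?_ h8
      exact sub_le_sub_right h10 _
    rw [hi₀]
    have h12 := mul_le_mul_of_nonneg_left h9 hsj.le
    rw [mul_sub, mul_inv_cancel_left₀ hsj.ne', mul_inv_cancel_left₀ hsj.ne'] at h12
    linarith
  have hΨ1 : ∀ p Y, |Ψ p Y| ≤ C + 2 * ((√(j : ℝ))⁻¹ * B) * C := fun p Y =>
    (hconv Y C _ fun i => hφ1 i p Y).trans (le_add_of_nonneg_right (by positivity))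
  have hΨ2 : ∀ p Y, |fderiv ℝ (Ψ p) Y (posDir p)| ≤ C + 2 * ((√(j : ℝ))⁻¹ * B) * C := fun p Y => by
    rw [hΨd]
    exact (abs_add_le _ _).trans (add_le_add (hconv Y C _ fun i => hφ2 i p Y) (herr p Y))
  have hmain := ofReal_integral_fisherIntegrand_le hΨs hΨ1 hΨ2 G
  have hint := integrable_of_continuous_bounded (G : Measure (Config j))
    (continuous_fisherIntegrand hΨs) ⟨_, fisherIntegrand_bound hΨ1 hΨ2⟩
  have hsup : Integrable (fun Y => Finset.univ.sup' Finset.univ_nonempty fun i => S i Y)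
      (G : Measure (Config j)) := by
    refine integrable_of_continuous_bounded _ ?_ ⟨∑ _l : Fin j, D, fun Y => ?_⟩
    · exact Continuous.finset_sup'_apply _ fun i _ => (hSs i).continuous
    · obtain ⟨i₀, -, hi₀⟩ := Finset.exists_mem_eq_sup' Finset.univ_nonempty (fun i => S i Y)
      rw [hi₀]
      exact norm_sum_le_of_le _ fun l _ => (hD₀ i₀ _).trans (hD i₀)
  have hj1 : (j : ℝ≥0∞) ≠ 0 := by exact_mod_cast hj0.ne'
  refine (ENNReal.mul_le_mul_iff_right hj1 (ENNReal.natCast_ne_top j)).1 (le_trans ?_ hmain)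
  rw [← ENNReal.ofReal_natCast, ← ENNReal.ofReal_mul hj0.le]
  refine ENNReal.ofReal_le_ofReal ?_
  have h1 : ∫ Y, (Finset.univ.sup' Finset.univ_nonempty (fun i => S i Y) -
      (8 * B * C + (m + 1)) * √j) ∂(G : Measure (Config j)) ≤
      ∫ Y, fisherIntegrand Ψ Y ∂(G : Measure (Config j)) :=
    integral_mono (hsup.sub (integrable_const _)) hint hlow
  rw [integral_sub hsup (integrable_const _), integral_const, probReal_univ, one_smul] at h1
  refine le_trans (le_of_eq ?_) h1
  have h3 : (j : ℝ) * ((8 * B * C + (m + 1)) / √j) = (8 * B * C + (m + 1)) * √j := by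
    rw [mul_div_assoc', mul_comm, mul_div_assoc, Real.div_sqrt]
  rw [mul_sub, mul_inv_cancel_left₀ hj0.ne', h3]

/-! ### Laws with a logarithmic gradient -/

/-- The indicator of a compact set is a pointwise limit of smooth functions with values in
`[0, 1]` and compact support. -/
theorem exists_smooth_tendsto_indicator {E : Type*} [NormedAddCommGroup E] [NormedSpace ℝ E]
    [FiniteDimensional ℝ E] {K : Set E} (hK : IsCompact K) :
    ∃ g : ℕ → E → ℝ, (∀ n, ContDiff ℝ ((⊤ : ℕ∞) : WithTop ℕ∞) (g n)) ∧
      (∀ n, HasCompactSupport (g n)) ∧ (∀ n x, ‖g n x‖ ≤ 1) ∧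
      ∀ x, Tendsto (fun n => g n x) atTop (𝓝 (K.indicator (fun _ => 1) x)) := by
  obtain ⟨δ, δpos, hδ⟩ := hK.exists_isCompact_cthickening
  obtain ⟨u, -, u_pos, u_lim⟩ := exists_seq_strictAnti_tendsto' δpos
  have h : ∀ n, ∃ g : E → ℝ, Function.support g = Metric.thickening (u n) K ∧
      ContDiff ℝ ((⊤ : ℕ∞) : WithTop ℕ∞) g ∧ Set.range g ⊆ Set.Icc 0 1 ∧ ∀ x ∈ K, g x = 1 := by
    intro n
    obtain ⟨g, g_smooth, g_range, g_supp, hg⟩ := exists_contMDiff_support_eq_eq_one_iff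
      (modelWithCornersSelf ℝ E) Metric.isOpen_thickening hK.isClosed
      (Metric.self_subset_thickening (u_pos n).1 K)
    exact ⟨g, g_supp, g_smooth.contDiff, g_range, fun x hx => (hg x).1 hx⟩
  choose g g_supp g_diff g_range hg using h
  refine ⟨g, g_diff, fun n => ?_, fun n x => ?_, fun x => ?_⟩
  · refine HasCompactSupport.of_support_subset_isCompact hδ ?_
    rw [g_supp]
    exact Metric.thickening_subset_cthickening_of_le (u_pos n).2.le _
  · have := g_range n (Set.mem_range_self (f := g n) x)
    rw [Real.norm_of_nonneg this.1]
    exact this.2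
  · by_cases hx : x ∈ K
    · simp [hg _ x hx, Set.indicator_of_mem hx]
    · rw [Set.indicator_of_notMem hx]
      refine tendsto_const_nhds.congr' ?_
      obtain ⟨ε, εpos, hε⟩ : ∃ ε, 0 < ε ∧ x ∉ Metric.thickening ε K := by
        rw [← hK.isClosed.closure_eq, Metric.closure_eq_iInter_thickening K] at hx
        simpa using hx
      filter_upwards [(tendsto_order.1 u_lim).2 _ εpos] with n hn
      have h1 : x ∉ Function.support (g n) := by
        rw [g_supp]
        exact fun h => hε (Metric.thickening_mono hn.le K h)
      exact (Function.notMem_support.1 h1).symm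

/-- `h` is the logarithmic gradient of the law `F`, in the sense of distributions: `∇F = h F`. -/
structure IsLogGradient {N : ℕ} (F : Measure (Fin N → Plane))
    (h : Fin N × Fin 2 → (Fin N → Plane) → ℝ) : Prop where
  measurable : ∀ p, Measurable (h p)
  integrable : ∀ p, Integrable (h p) F
  integral_eq : ∀ p (φ : (Fin N → Plane) → ℝ), ContDiff ℝ ((⊤ : ℕ∞) : WithTop ℕ∞) φ →
    HasCompactSupport φ → ∫ X, fderiv ℝ φ X (planeDir p) ∂F = -∫ X, φ X * h p X ∂F

theorem eq_sum_planeDir {N : ℕ} (v : Fin N → Plane) :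
    v = ∑ p : Fin N × Fin 2, v p.1 p.2 • planeDir p := by
  funext i
  ext a
  rw [Finset.sum_apply, WithLp.ofLp_sum, Finset.sum_apply, Finset.sum_eq_single (i, a)]
  · simp [planeDir]
  · rintro ⟨i', a'⟩ _ hne
    by_cases hi : i' = i
    · subst hi
      have ha : a ≠ a' := fun h => hne (by rw [h])
      simp [planeDir, ha]
    · simp [planeDir, Pi.single_eq_of_ne (Ne.symm hi)]
  · simp

namespace IsLogGradient

variable {N : ℕ} {F : Measure (Fin N → Plane)} [IsProbabilityMeasure F]
  {h : Fin N × Fin 2 → (Fin N → Plane) → ℝ}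

theorem integral_fderiv (hF : IsLogGradient F h) {φ : (Fin N → Plane) → ℝ}
    (hφ : ContDiff ℝ ((⊤ : ℕ∞) : WithTop ℕ∞) φ) (hc : HasCompactSupport φ) (v : Fin N → Plane) :
    ∫ X, fderiv ℝ φ X v ∂F = -∑ p : Fin N × Fin 2, v p.1 p.2 * ∫ X, φ X * h p X ∂F := by
  have hi : ∀ w, Integrable (fun X => fderiv ℝ φ X w) F := fun w => by
    obtain ⟨C, hC⟩ := (hc.fderiv_apply (𝕜 := ℝ) w).exists_bound_of_continuous
      (continuous_fderiv_apply_of_contDiff hφ w)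
    exact integrable_of_continuous_bounded _ (continuous_fderiv_apply_of_contDiff hφ w) ⟨C, hC⟩
  conv_lhs => rw [eq_sum_planeDir v]
  simp_rw [map_sum, map_smul, smul_eq_mul]
  rw [integral_finsetSum _ fun p _ => (hi _).const_mul _, ← Finset.sum_neg_distrib]
  refine Finset.sum_congr rfl fun p _ => ?_
  rw [integral_const_mul, hF.integral_eq p φ hφ hc]
  ring

/-- Translations act continuously, in total variation, on a law with a logarithmic gradient. -/
theorem abs_integral_add_sub_le (hF : IsLogGradient F h) {φ : (Fin N → Plane) → ℝ}
    (hφ : ContDiff ℝ ((⊤ : ℕ∞) : WithTop ℕ∞) φ) (hc : HasCompactSupport φ)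
    (h1 : ∀ X, ‖φ X‖ ≤ 1) (v : Fin N → Plane) :
    |∫ X, φ (X + v) ∂F - ∫ X, φ X ∂F| ≤ ‖v‖ * ∑ p, ∫ X, |h p X| ∂F := by
  obtain ⟨C, hC⟩ := (hc.fderiv (𝕜 := ℝ)).exists_bound_of_continuous
    (hφ.continuous_fderiv (by simp))
  have hφt : ∀ t : ℝ, ContDiff ℝ ((⊤ : ℕ∞) : WithTop ℕ∞) fun X => φ (X + t • v) := fun t =>
    hφ.comp (contDiff_id.add contDiff_const)
  have hct : ∀ t : ℝ, HasCompactSupport fun X => φ (X + t • v) := fun t =>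
    hc.comp_homeomorph (Homeomorph.addRight (t • v))
  have hder : ∀ t : ℝ, HasDerivAt (fun t : ℝ => ∫ X, φ (X + t • v) ∂F)
      (∫ X, fderiv ℝ φ (X + t • v) v ∂F) t := by
    intro t
    refine (hasDerivAt_integral_of_dominated_loc_of_deriv_le (s := Set.univ) (μ := F)
      (F := fun t X => φ (X + t • v)) (F' := fun t X => fderiv ℝ φ (X + t • v) v)
      (bound := fun _ => C * ‖v‖) univ_mem
      (Eventually.of_forall fun s => (hφt s).continuous.aestronglyMeasurable)
      (integrable_of_continuous_bounded _ (hφt t).continuous ⟨1, fun X => h1 _⟩) ?_ ?_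
      (integrable_const _) ?_).2
    · exact ((continuous_fderiv_apply_of_contDiff hφ v).comp (by fun_prop)).aestronglyMeasurable
    · refine Eventually.of_forall fun X s _ => (ContinuousLinearMap.le_opNorm _ _).trans ?_
      exact mul_le_mul_of_nonneg_right (hC _) (norm_nonneg _)
    · refine Eventually.of_forall fun X s _ => ?_
      have h2 : HasDerivAt (fun s : ℝ => X + s • v) v s := by
        simpa using ((hasDerivAt_id s).smul_const v).const_add X
      exact ((hφ.differentiable (by simp)) (X + s • v)).hasFDerivAt.comp_hasDerivAt s h2
  have hbound : ∀ t : ℝ, ‖∫ X, fderiv ℝ φ (X + t • v) v ∂F‖ ≤ ‖v‖ * ∑ p, ∫ X, |h p X| ∂F := by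
    intro t
    have h2 : ∀ X, fderiv ℝ φ (X + t • v) v = fderiv ℝ (fun X => φ (X + t • v)) X v := fun X => by
      rw [fderiv_comp_add_right]
    simp_rw [h2]
    rw [hF.integral_fderiv (hφt t) (hct t) v, norm_neg, Finset.mul_sum]
    refine norm_sum_le_of_le _ fun p _ => ?_
    rw [norm_mul]
    refine mul_le_mul ((PiLp.norm_apply_le (v p.1) p.2).trans (norm_le_pi_norm v p.1)) ?_
      (norm_nonneg _) (norm_nonneg _)
    refine (norm_integral_le_integral_norm _).trans (integral_mono_of_nonneg
      (Eventually.of_forall fun X => norm_nonneg _) (hF.integrable p).abs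
      (Eventually.of_forall fun X => ?_))
    simp only [norm_mul]
    exact mul_le_of_le_one_left (norm_nonneg _) (h1 _)
  have := norm_image_sub_le_of_norm_deriv_le_segment_01'
    (f := fun t : ℝ => ∫ X, φ (X + t • v) ∂F) (fun t _ => (hder t).hasDerivWithinAt)
    (fun t _ => hbound t)
  simpa using this

/-- A law with a logarithmic gradient has a density: a null compact set is disjoint, up to null
sets, from almost all of its translates, and translations are continuous. -/
theorem absolutelyContinuous (hF : IsLogGradient F h) : F ≪ volume := by
  set c := ∑ p, ∫ X, |h p X| ∂F with hc
  have hc0 : 0 ≤ c := Finset.sum_nonneg fun p _ => integral_nonneg fun X => abs_nonneg _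
  have htrans : ∀ K : Set (Fin N → Plane), IsCompact K → ∀ v : Fin N → Plane,
      F.real K ≤ F.real ((fun X => X + v) ⁻¹' K) + ‖v‖ * c := by
    intro K hK v
    obtain ⟨g, hg, hgc, hg1, hgl⟩ := exists_smooth_tendsto_indicator hK
    have hl1 := integral_tendsto_of_bounded F (fun n => (hg n).continuous) hg1 hgl
    have hl2 := integral_tendsto_of_bounded F (u := fun n X => g n (X + v))
      (fun n => (hg n).continuous.comp (by fun_prop)) (fun n X => hg1 n _) fun X => hgl (X + v)
    have h2 := le_of_tendsto (hl2.sub hl1).abs (Eventually.of_forall fun n =>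
      hF.abs_integral_add_sub_le (hg n) (hgc n) (hg1 n) v)
    have h3 : ∫ X, K.indicator (fun _ => (1 : ℝ)) X ∂F = F.real K :=
      integral_indicator_one hK.measurableSet
    have h4 : ∫ X, K.indicator (fun _ => (1 : ℝ)) (X + v) ∂F =
        F.real ((fun X => X + v) ⁻¹' K) := by
      rw [← integral_indicator_one (hK.measurableSet.preimage (by fun_prop))]
      rfl
    rw [h3, h4] at h2
    linarith [(abs_le.1 h2).1]
  have hcompact : ∀ K : Set (Fin N → Plane), IsCompact K → volume K = 0 → F K = 0 := by
    intro K hK hK0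
    have hmeas : MeasurableSet {q : (Fin N → Plane) × (Fin N → Plane) | q.2 + q.1 ∈ K} :=
      hK.measurableSet.preimage (by fun_prop)
    have hprod : (volume.prod F) {q : (Fin N → Plane) × (Fin N → Plane) | q.2 + q.1 ∈ K} = 0 := by
      rw [Measure.prod_apply_symm hmeas]
      refine (lintegral_congr fun X => ?_).trans lintegral_zero
      exact (measure_preimage_add volume X K).trans hK0
    have hae := Measure.ae_ae_of_ae_prod (measure_eq_zero_iff_ae_notMem.1 hprod)
    have hreal : F.real K ≤ 0 := by
      refine le_of_forall_pos_le_add fun ε hε => ?_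
      have hball : ∃ v ∈ Metric.ball (0 : Fin N → Plane) (ε / (c + 1)),
          F ((fun X => X + v) ⁻¹' K) = 0 := by
        by_contra hcon
        push Not at hcon
        have h5 : Metric.ball (0 : Fin N → Plane) (ε / (c + 1)) ⊆
            {v | ¬ ∀ᵐ X ∂F, (v, X) ∉ {q : (Fin N → Plane) × (Fin N → Plane) | q.2 + q.1 ∈ K}} :=
          fun v hv hcontra => hcon v hv (measure_eq_zero_iff_ae_notMem.2 hcontra)
        exact (Metric.measure_ball_pos volume (0 : Fin N → Plane)
          (div_pos hε (by linarith))).ne' (measure_mono_null h5 (ae_iff.1 hae))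
      obtain ⟨v, hv, hv0⟩ := hball
      have h6 := htrans K hK v
      rw [mem_ball_zero_iff, lt_div_iff₀ (by linarith)] at hv
      have h7 : F.real ((fun X => X + v) ⁻¹' K) = 0 := by rw [Measure.real, hv0]; rfl
      have := norm_nonneg v
      nlinarith
    have h8 : F.real K = 0 := le_antisymm hreal measureReal_nonneg
    exact (measureReal_eq_zero_iff).1 h8
  refine Measure.AbsolutelyContinuous.mk fun s hs hs0 => ?_
  rw [hs.measure_eq_iSup_isCompact_of_ne_top (measure_ne_top F s)]
  simp only [ENNReal.iSup_eq_zero]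
  exact fun K hKs hK => hcompact K hK (measure_mono_null hKs hs0)

theorem isWeakGradient (hF : IsLogGradient F h) :
    IsWeakGradient (density F) fun X i => WithLp.toLp 2 fun a => density F X * h (i, a) X := by
  have hac := hF.absolutelyContinuous
  have hint : ∀ p, Integrable (fun X => density F X * h p X) volume := fun p =>
    (integrable_rnDeriv_smul_iff hac).2 (hF.integrable p)
  refine ⟨Integrable.locallyIntegrable ?_, fun φ hφ hc v => ?_⟩
  · refine Integrable.of_eval fun i => ?_
    exact Integrable.of_eval_piLp fun a => hint (i, a)
  · have h1 : ∫ X, density F X * fderiv ℝ φ X v = ∫ X, fderiv ℝ φ X v ∂F :=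
      integral_rnDeriv_smul hac
    rw [h1, hF.integral_fderiv hφ hc v]
    congr 1
    obtain ⟨C, hC⟩ := hc.exists_bound_of_continuous hφ.continuous
    have h2 : ∀ X, (∑ i, inner ℝ (WithLp.toLp 2 fun a => density F X * h (i, a) X) (v i)) * φ X =
        ∑ p : Fin N × Fin 2, v p.1 p.2 * (density F X * (φ X * h p X)) := fun X => by
      rw [Fintype.sum_prod_type, Finset.sum_mul]
      refine Finset.sum_congr rfl fun i _ => ?_
      rw [PiLp.inner_apply, Finset.sum_mul]
      refine Finset.sum_congr rfl fun a _ => ?_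
      simp only [RCLike.inner_apply, conj_trivial]
      ring
    have h3 : ∀ p, Integrable (fun X => density F X * (φ X * h p X)) volume := fun p => by
      refine ((hint p).bdd_mul (c := C) hφ.continuous.aestronglyMeasurable
        (Eventually.of_forall hC)).congr (Eventually.of_forall fun X => ?_)
      simp only
      ring
    simp_rw [h2]
    rw [integral_finsetSum _ fun p _ => (h3 p).const_mul _]
    refine Finset.sum_congr rfl fun p _ => ?_
    rw [integral_const_mul]
    congr 1
    exact (integral_rnDeriv_smul hac).symm

theorem fisher_le (hF : IsLogGradient F h) :
    fisher F ≤ (N : ℝ≥0∞)⁻¹ * ∫⁻ X, ENNReal.ofReal (∑ p, h p X ^ 2) ∂F := by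
  have hac := hF.absolutelyContinuous
  rw [fisher, if_pos hac]
  refine (iInf₂_le _ hF.isWeakGradient).trans (mul_le_mul_right (le_of_eq ?_) _)
  have hm : Measurable fun X => ENNReal.ofReal (∑ p, h p X ^ 2) :=
    (Finset.measurable_fun_sum _ fun p _ => (hF.measurable p).pow_const 2).ennreal_ofReal
  rw [← lintegral_rnDeriv_mul hac hm.aemeasurable]
  refine lintegral_congr_ae ?_
  filter_upwards [Measure.rnDeriv_lt_top F volume] with X hX
  rw [sum_norm_sq_eq]
  simp_rw [mul_pow]
  rw [← Finset.mul_sum, ENNReal.ofReal_mul (sq_nonneg _), density,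
    ENNReal.ofReal_pow ENNReal.toReal_nonneg, ENNReal.ofReal_toReal hX.ne]
  rcases eq_or_ne (F.rnDeriv volume X) 0 with h0 | h0
  · simp [h0]
  · rw [mul_comm, mul_div_assoc, sq, ENNReal.mul_div_cancel_right h0 hX.ne, mul_comm]

end IsLogGradient

/-! ### Strong duality for the Fisher information -/

/-- The Riesz representation of a functional which is bounded along a linear map to a Hilbert
space. -/
theorem exists_inner_eq_of_bound {V H : Type*} [AddCommGroup V] [Module ℝ V]
    [NormedAddCommGroup H] [InnerProductSpace ℝ H] [CompleteSpace H] (T : V →ₗ[ℝ] H)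
    (l : V →ₗ[ℝ] ℝ) {B : ℝ} (hB : 0 ≤ B) (h : ∀ v, |l v| ≤ B * ‖T v‖) :
    ∃ y : H, ‖y‖ ≤ B ∧ ∀ v, l v = inner ℝ y (T v) := by
  obtain ⟨d, hd⟩ : l ∈ LinearMap.range T.dualMap := by
    rw [LinearMap.range_dualMap_eq_dualAnnihilator_ker, Submodule.mem_dualAnnihilator]
    intro v hv
    have h1 := h v
    rw [LinearMap.mem_ker.1 hv, norm_zero, mul_zero] at h1
    exact abs_nonpos_iff.1 h1
  have hd' : ∀ v, d (T v) = l v := fun v => by rw [← hd]; rfl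
  let f : LinearMap.range T →L[ℝ] ℝ :=
    (d.comp (LinearMap.range T).subtype).mkContinuous B (by
      rintro ⟨_, v, rfl⟩
      change ‖d (T v)‖ ≤ B * ‖T v‖
      rw [hd']
      exact h v)
  obtain ⟨g, hg, hgn⟩ := exists_extension_norm_eq (LinearMap.range T) f
  refine ⟨(InnerProductSpace.toDual ℝ H).symm g, ?_, fun v => ?_⟩
  · rw [LinearIsometryEquiv.norm_map, hgn]
    exact LinearMap.mkContinuous_norm_le _ hB _
  · rw [InnerProductSpace.toDual_symm_apply, ← hd' v]
    exact (hg ⟨T v, v, rfl⟩).symm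

/-- The space of smooth compactly supported fields. -/
def testFields (N : ℕ) : Submodule ℝ (Fin N × Fin 2 → Config N → ℝ) where
  carrier := {Φ | IsTestField Φ}
  add_mem' h1 h2 := ⟨fun p => (h1.contDiff p).add (h2.contDiff p),
    fun p => (h1.compact p).add (h2.compact p)⟩
  zero_mem' := ⟨fun _ => contDiff_const, fun _ => HasCompactSupport.zero⟩
  smul_mem' _ _ h := ⟨fun p => contDiff_const.mul (h.contDiff p),
    fun p => (h.compact p).mul_left⟩

section Riesz

variable {N : ℕ} {G : ProbabilityMeasure (Config N)}

theorem IsTestField.memLp {Φ : Fin N × Fin 2 → Config N → ℝ} (hΦ : IsTestField Φ)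
    (p : Fin N × Fin 2) : MemLp (Φ p) 2 (G : Measure (Config N)) := by
  obtain ⟨C, hC, -⟩ := hΦ.exists_bound
  exact MemLp.of_bound (hΦ.contDiff p).continuous.aestronglyMeasurable C
    (Eventually.of_forall (hC p))

theorem IsTestField.integrable_fderiv {Φ : Fin N × Fin 2 → Config N → ℝ} (hΦ : IsTestField Φ)
    (p : Fin N × Fin 2) :
    Integrable (fun Y => fderiv ℝ (Φ p) Y (posDir p)) (G : Measure (Config N)) := by
  obtain ⟨C, -, hC⟩ := hΦ.exists_bound
  exact integrable_of_continuous_bounded _ (continuous_fderiv_apply_of_contDiff (hΦ.contDiff p) _)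
    ⟨C, hC p⟩

/-- A law for which the divergence functional is bounded in `L²` has a logarithmic gradient in
the positions, which is square integrable. -/
theorem exists_logGradient {c : ℝ} (hc : 0 ≤ c)
    (hbound : ∀ Φ : Fin N × Fin 2 → Config N → ℝ, IsTestField Φ →
      (∑ p, ∫ Y, fderiv ℝ (Φ p) Y (posDir p) ∂(G : Measure (Config N))) ^ 2 ≤
        c * ∑ p, ∫ Y, Φ p Y ^ 2 ∂(G : Measure (Config N))) :
    ∃ h : Fin N × Fin 2 → Config N → ℝ, (∀ p, Measurable (h p)) ∧
      (∀ p, MemLp (h p) 2 (G : Measure (Config N))) ∧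
      ∑ p, ∫ Y, h p Y ^ 2 ∂(G : Measure (Config N)) ≤ c ∧
      ∀ p (φ : Config N → ℝ), ContDiff ℝ ((⊤ : ℕ∞) : WithTop ℕ∞) φ → HasCompactSupport φ →
        ∫ Y, fderiv ℝ φ Y (posDir p) ∂(G : Measure (Config N)) =
          -∫ Y, φ Y * h p Y ∂(G : Measure (Config N)) := by
  let H := PiLp 2 fun _ : Fin N × Fin 2 => Lp ℝ 2 (G : Measure (Config N))
  have hinner : ∀ f g : Lp ℝ 2 (G : Measure (Config N)),
      inner ℝ f g = ∫ Y, g Y * f Y ∂(G : Measure (Config N)) := fun f g => by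
    rw [L2.inner_def]
    simp
  let T : testFields N →ₗ[ℝ] H :=
    { toFun := fun Φ => WithLp.toLp 2 fun p => (Φ.2.memLp (G := G) p).toLp
      map_add' := fun Φ Ψ => by
        ext1 p
        exact MemLp.toLp_add (Φ.2.memLp (G := G) p) (Ψ.2.memLp (G := G) p)
      map_smul' := fun a Φ => by
        ext1 p
        exact MemLp.toLp_const_smul a (Φ.2.memLp (G := G) p) }
  have hT : ∀ (Φ : testFields N) p, (T Φ).ofLp p =ᵐ[(G : Measure (Config N))] Φ.1 p := fun Φ p =>
    MemLp.coeFn_toLp (Φ.2.memLp (G := G) p)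
  let l : testFields N →ₗ[ℝ] ℝ :=
    { toFun := fun Φ => ∑ p, ∫ Y, fderiv ℝ (Φ.1 p) Y (posDir p) ∂(G : Measure (Config N))
      map_add' := fun Φ Ψ => by
        rw [← Finset.sum_add_distrib]
        refine Finset.sum_congr rfl fun p _ => ?_
        rw [← integral_add (Φ.2.integrable_fderiv p) (Ψ.2.integrable_fderiv p)]
        refine integral_congr_ae (Eventually.of_forall fun Y => ?_)
        have h1 := ((Φ.2.contDiff p).differentiable (by simp) Y).hasFDerivAt.add
          ((Ψ.2.contDiff p).differentiable (by simp) Y).hasFDerivAt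
        change fderiv ℝ (Φ.1 p + Ψ.1 p) Y (posDir p) = _
        rw [h1.fderiv]
        rfl
      map_smul' := fun a Φ => by
        rw [RingHom.id_apply, smul_eq_mul, Finset.mul_sum]
        refine Finset.sum_congr rfl fun p _ => ?_
        rw [← integral_const_mul]
        refine integral_congr_ae (Eventually.of_forall fun Y => ?_)
        have h1 := ((Φ.2.contDiff p).differentiable (by simp) Y).hasFDerivAt.const_smul a
        change fderiv ℝ (a • Φ.1 p) Y (posDir p) = _
        rw [h1.fderiv]
        rfl }
  have hTn : ∀ Φ, ‖T Φ‖ ^ 2 = ∑ p, ∫ Y, Φ.1 p Y ^ 2 ∂(G : Measure (Config N)) := fun Φ => by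
    rw [PiLp.norm_sq_eq_of_L2]
    refine Finset.sum_congr rfl fun p _ => ?_
    rw [← real_inner_self_eq_norm_sq, hinner]
    refine integral_congr_ae ?_
    filter_upwards [hT Φ p] with Y hY
    rw [hY, sq]
  obtain ⟨y, hy, hly⟩ := exists_inner_eq_of_bound T l (Real.sqrt_nonneg c) fun Φ => by
    have h1 := hbound Φ.1 Φ.2
    rw [← hTn] at h1
    rw [← Real.sqrt_sq (norm_nonneg (T Φ)), ← Real.sqrt_mul hc]
    exact Real.abs_le_sqrt h1
  refine ⟨fun p Y => -(y.ofLp p : Config N → ℝ) Y,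
    fun p => (Lp.stronglyMeasurable _).measurable.neg, fun p => (Lp.memLp _).neg, ?_, ?_⟩
  · have h1 : ‖y‖ ^ 2 ≤ c := by
      rw [← Real.sq_sqrt hc]
      exact pow_le_pow_left₀ (norm_nonneg _) hy 2
    rw [PiLp.norm_sq_eq_of_L2] at h1
    refine le_trans (le_of_eq (Finset.sum_congr rfl fun p _ => ?_)) h1
    rw [← real_inner_self_eq_norm_sq, hinner]
    simp_rw [neg_sq, sq]
  · intro p φ hφ hcφ
    have hΦ : IsTestField (Pi.single p φ : Fin N × Fin 2 → Config N → ℝ) := by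
      constructor <;> intro q <;> by_cases hq : q = p
      · subst hq
        rwa [Pi.single_eq_same]
      · rw [Pi.single_eq_of_ne hq]
        exact contDiff_const
      · subst hq
        rwa [Pi.single_eq_same]
      · rw [Pi.single_eq_of_ne hq]
        exact HasCompactSupport.zero
    have h1 := hly ⟨_, hΦ⟩
    have h2 : l ⟨_, hΦ⟩ = ∫ Y, fderiv ℝ φ Y (posDir p) ∂(G : Measure (Config N)) := by
      change ∑ q, ∫ Y, fderiv ℝ ((Pi.single p φ : Fin N × Fin 2 → Config N → ℝ) q) Y (posDir q)
        ∂(G : Measure (Config N)) = _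
      rw [Finset.sum_eq_single p]
      · rw [Pi.single_eq_same]
      · intro q _ hq
        rw [Pi.single_eq_of_ne hq]
        simp
      · simp
    rw [← h2, h1, PiLp.inner_apply, Finset.sum_eq_single p]
    · rw [hinner, ← integral_neg]
      refine integral_congr_ae ?_
      filter_upwards [hT ⟨_, hΦ⟩ p] with Y hY
      rw [hY]
      simp
    · intro q _ hq
      rw [hinner]
      refine integral_eq_zero_of_ae ?_
      filter_upwards [hT ⟨_, hΦ⟩ q] with Y hY
      rw [hY]
      simp [Pi.single_eq_of_ne hq]
    · simp

end Riesz

section Disintegration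

variable {N : ℕ} {G : ProbabilityMeasure (Config N)}

/-- The circulations, as a linear map. -/
noncomputable def circCLM (N : ℕ) : Config N →L[ℝ] (Fin N → ℝ) :=
  ContinuousLinearMap.pi fun i =>
    (ContinuousLinearMap.fst ℝ ℝ Plane).comp (ContinuousLinearMap.proj i)

/-- The positions, as a linear map. -/
noncomputable def posCLM (N : ℕ) : Config N →L[ℝ] (Fin N → Plane) :=
  ContinuousLinearMap.pi fun i =>
    (ContinuousLinearMap.snd ℝ ℝ Plane).comp (ContinuousLinearMap.proj i)

theorem hasFDerivAt_circ (Y : Config N) : HasFDerivAt circ (circCLM N) Y :=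
  (circCLM N).hasFDerivAt

theorem hasFDerivAt_pos (Y : Config N) : HasFDerivAt pos (posCLM N) Y :=
  (posCLM N).hasFDerivAt

theorem circCLM_posDir (p : Fin N × Fin 2) : circCLM N (posDir p) = 0 := by
  funext i
  by_cases hi : i = p.1
  · subst hi
    simp [circCLM, posDir]
  · simp [circCLM, posDir, Pi.single_eq_of_ne hi]

theorem posCLM_posDir (p : Fin N × Fin 2) : posCLM N (posDir p) = planeDir p := by
  funext i
  by_cases hi : i = p.1
  · subst hi
    simp [posCLM, posDir, planeDir]
  · simp [posCLM, posDir, planeDir, Pi.single_eq_of_ne hi]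

theorem fderiv_mul_circ_pos {η : (Fin N → ℝ) → ℝ} {φ : (Fin N → Plane) → ℝ}
    (hη : ContDiff ℝ ((⊤ : ℕ∞) : WithTop ℕ∞) η) (hφ : ContDiff ℝ ((⊤ : ℕ∞) : WithTop ℕ∞) φ)
    (Y : Config N) (p : Fin N × Fin 2) :
    fderiv ℝ (fun Y => η (circ Y) * φ (pos Y)) Y (posDir p) =
      η (circ Y) * fderiv ℝ φ (pos Y) (planeDir p) := by
  have h1 : HasFDerivAt (fun Y : Config N => η (circ Y)) _ Y :=
    ((hη.differentiable (by simp)) (circ Y)).hasFDerivAt.comp Y (hasFDerivAt_circ Y)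
  have h2 : HasFDerivAt (fun Y : Config N => φ (pos Y)) _ Y :=
    ((hφ.differentiable (by simp)) (pos Y)).hasFDerivAt.comp Y (hasFDerivAt_pos Y)
  rw [(h1.fun_mul h2).fderiv]
  simp [circCLM_posDir, posCLM_posDir]

theorem hasCompactSupport_mul_circ_pos {η : (Fin N → ℝ) → ℝ} {φ : (Fin N → Plane) → ℝ}
    (hη : HasCompactSupport η) (hφ : HasCompactSupport φ) :
    HasCompactSupport fun Y : Config N => η (circ Y) * φ (pos Y) := by
  have hc : Continuous fun q : (Fin N → ℝ) × (Fin N → Plane) => join q.1 q.2 := by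
    unfold join; fun_prop
  refine HasCompactSupport.intro ((hη.isCompact.prod hφ.isCompact).image hc) fun Y hY => ?_
  by_contra h0
  refine hY ⟨(circ Y, pos Y), ⟨?_, ?_⟩, rfl⟩
  · exact subset_tsupport _ fun h => h0 (by simp only [h, zero_mul])
  · exact subset_tsupport _ fun h => h0 (by simp only [h, mul_zero])

/-- The values and derivatives of the test functions on the space of positions. -/
def testJets (N : ℕ) : Set ((Fin N → Plane) → ℝ × (Fin N × Fin 2 → ℝ)) :=
  {f | ∃ φ : (Fin N → Plane) → ℝ, ContDiff ℝ ((⊤ : ℕ∞) : WithTop ℕ∞) φ ∧ HasCompactSupport φ ∧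
    f = fun X => (φ X, fun p => fderiv ℝ φ X (planeDir p))}

theorem continuous_bounded_of_mem_testJets {f : (Fin N → Plane) → ℝ × (Fin N × Fin 2 → ℝ)}
    (hf : f ∈ testJets N) : Continuous f ∧ ∃ C : ℝ, ∀ X, ‖f X‖ ≤ C := by
  obtain ⟨φ, hφ, hc, rfl⟩ := hf
  have hcont : Continuous fun X => (φ X, fun p : Fin N × Fin 2 => fderiv ℝ φ X (planeDir p)) :=
    hφ.continuous.prodMk (continuous_pi fun p => continuous_fderiv_apply_of_contDiff hφ _)
  refine ⟨hcont, HasCompactSupport.exists_bound_of_continuous ?_ hcont⟩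
  refine HasCompactSupport.intro hc.isCompact fun X hX => ?_
  rw [image_eq_zero_of_notMem_tsupport hX, fderiv_of_notMem_tsupport ℝ hX]
  rfl

/-- The conditional laws of the positions inherit a logarithmic gradient: the exceptional sets of
circulations are null for each test function, and countably many test functions suffice. -/
theorem ae_isLogGradient {h : Fin N × Fin 2 → Config N → ℝ} (hm : ∀ p, Measurable (h p))
    (hi : ∀ p, Integrable (h p) (G : Measure (Config N)))
    (heq : ∀ p (φ : Config N → ℝ), ContDiff ℝ ((⊤ : ℕ∞) : WithTop ℕ∞) φ → HasCompactSupport φ →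
        ∫ Y, fderiv ℝ φ Y (posDir p) ∂(G : Measure (Config N)) =
          -∫ Y, φ Y * h p Y ∂(G : Measure (Config N))) :
    ∀ᵐ M ∂(circLaw G), IsLogGradient (condPos G M) fun p X => h p (join M X) := by
  have hcp := circLaw_compProd_condPos G
  have hjoin : ∀ f : Config N → ℝ, Integrable f (G : Measure (Config N)) →
      Integrable (fun q : (Fin N → ℝ) × (Fin N → Plane) => f (join q.1 q.2))
        (circLaw G ⊗ₘ condPos G) := fun f hf => by
    have h2 : (G : Measure (Config N)) = (circLaw G ⊗ₘ condPos G).map fun p => join p.1 p.2 := by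
      rw [hcp, Measure.map_map measurable_join measurable_circ_pos]
      exact Measure.map_id.symm
    rw [h2] at hf
    exact (integrable_map_measure hf.aestronglyMeasurable measurable_join.aemeasurable).1 hf
  have hint : ∀ᵐ M ∂(circLaw G), ∀ p, Integrable (fun X => h p (join M X)) (condPos G M) :=
    ae_all_iff.2 fun p =>
      ((Measure.integrable_compProd_iff (hjoin _ (hi p)).aestronglyMeasurable).1 (hjoin _ (hi p))).1
  have hone : ∀ f ∈ testJets N, ∀ p, ∀ᵐ M ∂(circLaw G),
      ∫ X, ((f X).2 p + (f X).1 * h p (join M X)) ∂(condPos G M) = 0 := by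
    rintro f hf p
    obtain ⟨hfc, C, hC⟩ := continuous_bounded_of_mem_testJets hf
    obtain ⟨φ, hφ, hc, rfl⟩ := hf
    let F : Config N → ℝ := fun Y => fderiv ℝ φ (pos Y) (planeDir p) + φ (pos Y) * h p Y
    have hF1 : Integrable (fun Y : Config N => fderiv ℝ φ (pos Y) (planeDir p))
        (G : Measure (Config N)) :=
      integrable_of_continuous_bounded _
        ((continuous_fderiv_apply_of_contDiff hφ _).comp continuous_pos)
        ⟨C, fun Y => ((norm_le_pi_norm _ p).trans (norm_snd_le _)).trans (hC (pos Y))⟩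
    have hF2 : Integrable (fun Y : Config N => φ (pos Y) * h p Y) (G : Measure (Config N)) :=
      (hi p).bdd_mul (c := C) (hφ.continuous.comp continuous_pos).aestronglyMeasurable
        (Eventually.of_forall fun Y => (norm_fst_le _).trans (hC (pos Y)))
    have hF : Integrable F (G : Measure (Config N)) := hF1.add hF2
    refine ae_eq_zero_of_integral_contDiff_smul_eq_zero
      (hjoin F hF).integral_compProd.locallyIntegrable fun η hη hηc => ?_
    obtain ⟨D, hD⟩ := hηc.exists_bound_of_continuous hη.continuous
    have hηF : ∀ u : Config N → ℝ, Integrable u (G : Measure (Config N)) →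
        Integrable (fun Y => η (circ Y) * u Y) (G : Measure (Config N)) := fun u hu =>
      hu.bdd_mul (c := D) (hη.continuous.comp continuous_circ).aestronglyMeasurable
        (Eventually.of_forall fun Y => hD _)
    have h1 := integral_eq_integral_condPos G (hηF F hF)
    have h2 : ∀ M, ∫ X, η (circ (join M X)) * F (join M X) ∂(condPos G M) =
        η M • ∫ X, F (join M X) ∂(condPos G M) := fun M => by
      rw [smul_eq_mul, ← integral_const_mul]
      rfl
    simp_rw [h2] at h1
    refine h1.symm.trans ?_
    have h3 := heq p _ ((hη.comp (circCLM N).contDiff).mul (hφ.comp (posCLM N).contDiff))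
      (hasCompactSupport_mul_circ_pos hηc hc)
    have h4 : ∀ Y, fderiv ℝ (fun Y => (η ∘ circCLM N) Y * (φ ∘ posCLM N) Y) Y (posDir p) =
      η (circ Y) * fderiv ℝ φ (pos Y) (planeDir p) := fun Y => fderiv_mul_circ_pos hη hφ Y p
    simp_rw [h4] at h3
    have h5 : ∀ Y, η (circ Y) * F Y = η (circ Y) * fderiv ℝ φ (pos Y) (planeDir p) +
        η (circ Y) * (φ (pos Y) * h p Y) := fun Y => mul_add _ _ _
    simp_rw [h5]
    rw [integral_add (hηF _ hF1) (hηF _ hF2), h3, neg_add_eq_zero]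
    refine integral_congr_ae (Eventually.of_forall fun Y => ?_)
    exact mul_assoc _ _ _
  obtain ⟨D, hDc, hDS, hD⟩ := exists_countable_bounded_approx (testJets N)
    fun f hf => continuous_bounded_of_mem_testJets hf
  have hall : ∀ᵐ M ∂(circLaw G), ∀ f ∈ D, ∀ p,
      ∫ X, ((f X).2 p + (f X).1 * h p (join M X)) ∂(condPos G M) = 0 :=
    (ae_ball_iff hDc).2 fun f hf => ae_all_iff.2 fun p => hone f (hDS hf) p
  filter_upwards [hint, hall] with M hM1 hM2
  refine ⟨fun p => (hm p).comp (contDiff_join M).continuous.measurable, hM1,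
    fun p φ hφ hc => ?_⟩
  obtain ⟨C, u, huD, huC, hul⟩ := hD _ ⟨φ, hφ, hc, rfl⟩
  have huc : ∀ n, Continuous (u n) := fun n =>
    (continuous_bounded_of_mem_testJets (hDS (huD n))).1
  have hlim : Tendsto (fun n => ∫ X, ((u n X).2 p + (u n X).1 * h p (join M X)) ∂(condPos G M))
      atTop (𝓝 (∫ X, (fderiv ℝ φ X (planeDir p) + φ X * h p (join M X)) ∂(condPos G M))) := by
    refine tendsto_integral_of_dominated_convergence (fun X => C + C * |h p (join M X)|)
      (fun n => ?_) ((integrable_const _).add ((hM1 p).abs.const_mul C)) (fun n => ?_) ?_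
    · have h1 : Continuous fun X => (u n X).2 p := (continuous_apply p).comp (huc n).snd
      exact h1.aestronglyMeasurable.add ((huc n).fst.aestronglyMeasurable.mul (hM1 p).1)
    · refine Eventually.of_forall fun X => (norm_add_le _ _).trans (add_le_add ?_ ?_)
      · exact ((norm_le_pi_norm _ p).trans (norm_snd_le _)).trans (huC n X)
      · rw [norm_mul]
        exact mul_le_mul_of_nonneg_right ((norm_fst_le _).trans (huC n X)) (norm_nonneg _)
    · refine Eventually.of_forall fun X => ?_
      have h1 := (hul X).snd_nhds
      exact (tendsto_pi_nhds.1 h1 p).add ((hul X).fst_nhds.mul_const _)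
  simp_rw [hM2 _ (huD _) p] at hlim
  have h0 := tendsto_nhds_unique hlim tendsto_const_nhds
  obtain ⟨C', hC'⟩ := (continuous_bounded_of_mem_testJets ⟨φ, hφ, hc, rfl⟩).2
  have hi1 : Integrable (fun X => fderiv ℝ φ X (planeDir p)) (condPos G M) :=
    integrable_of_continuous_bounded _ (continuous_fderiv_apply_of_contDiff hφ _)
      ⟨C', fun X => ((norm_le_pi_norm _ p).trans (norm_snd_le _)).trans (hC' X)⟩
  have hi2 : Integrable (fun X => φ X * h p (join M X)) (condPos G M) :=
    (hM1 p).bdd_mul (c := C') hφ.continuous.aestronglyMeasurable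
      (Eventually.of_forall fun X => (norm_fst_le _).trans (hC' X))
  rw [integral_add hi1 hi2] at h0
  linarith

end Disintegration

/-- The Fisher information is at most the supremum of the integrals of `-2 div Φ - |Φ|²`. -/
theorem natCast_mul_partialFisher_le {N : ℕ} (hN : 1 ≤ N) (G : ProbabilityMeasure (Config N)) :
    N * partialFisher G ≤
      ⨆ ψ ∈ fisherTests N, ENNReal.ofReal (∫ Y, ψ Y ∂(G : Measure (Config N))) := by
  by_cases htop : ⨆ ψ ∈ fisherTests N, ENNReal.ofReal (∫ Y, ψ Y ∂(G : Measure (Config N))) = ⊤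
  · rw [htop]
    exact le_top
  have hN0 : (N : ℝ≥0∞) ≠ 0 := by exact_mod_cast (by omega : N ≠ 0)
  set S := ⨆ ψ ∈ fisherTests N, ENNReal.ofReal (∫ Y, ψ Y ∂(G : Measure (Config N))) with hS
  have hle : ∀ Φ : Fin N × Fin 2 → Config N → ℝ, IsTestField Φ →
      -2 * ∑ p, ∫ Y, fderiv ℝ (Φ p) Y (posDir p) ∂(G : Measure (Config N)) -
        ∑ p, ∫ Y, Φ p Y ^ 2 ∂(G : Measure (Config N)) ≤ S.toReal := by
    intro Φ hΦ
    have h1 := le_iSup₂ (f := fun ψ (_ : ψ ∈ fisherTests N) =>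
      ENNReal.ofReal (∫ Y, ψ Y ∂(G : Measure (Config N)))) _ ⟨Φ, hΦ, rfl⟩
    have h2 := (ENNReal.ofReal_le_iff_le_toReal htop).1 h1
    refine le_trans (le_of_eq ?_) h2
    have h3 : ∀ p, Integrable (fun Y => -2 * fderiv ℝ (Φ p) Y (posDir p))
        (G : Measure (Config N)) :=
      fun p => (hΦ.integrable_fderiv p).const_mul _
    have h4 : ∀ p, Integrable (fun Y => Φ p Y ^ 2) (G : Measure (Config N)) := fun p =>
      (hΦ.memLp p).integrable_sq
    have h5 : ∀ p, Integrable (fun Y => -2 * fderiv ℝ (Φ p) Y (posDir p) - Φ p Y ^ 2)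
      (G : Measure (Config N)) := fun p => (h3 p).sub (h4 p)
    unfold fisherIntegrand
    rw [integral_finsetSum _ fun p _ => h5 p, Finset.mul_sum,
      ← Finset.sum_sub_distrib]
    refine Finset.sum_congr rfl fun p _ => ?_
    rw [integral_sub (h3 p) (h4 p), integral_const_mul]
  have hbound : ∀ Φ : Fin N × Fin 2 → Config N → ℝ, IsTestField Φ →
      (∑ p, ∫ Y, fderiv ℝ (Φ p) Y (posDir p) ∂(G : Measure (Config N))) ^ 2 ≤
        S.toReal * ∑ p, ∫ Y, Φ p Y ^ 2 ∂(G : Measure (Config N)) := by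
    intro Φ hΦ
    set d := ∑ p, ∫ Y, fderiv ℝ (Φ p) Y (posDir p) ∂(G : Measure (Config N)) with hd
    set q := ∑ p, ∫ Y, Φ p Y ^ 2 ∂(G : Measure (Config N)) with hq
    -- the field `t Φ`, for all real `t`, gives a quadratic polynomial in `t` of constant sign
    have hquad : ∀ t : ℝ, 0 ≤ q * (t * t) + 2 * d * t + S.toReal := by
      intro t
      have h1 := hle (fun p => t • Φ p) ((testFields N).smul_mem t hΦ)
      have h2 : ∀ p Y, fderiv ℝ (t • Φ p) Y (posDir p) = t * fderiv ℝ (Φ p) Y (posDir p) :=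
        fun p Y => by
        rw [(((hΦ.contDiff p).differentiable (by simp) Y).hasFDerivAt.const_smul t).fderiv]
        rfl
      simp_rw [h2, Pi.smul_apply, smul_eq_mul, mul_pow, integral_const_mul, ← Finset.mul_sum] at h1
      nlinarith
    have h3 := discrim_le_zero hquad
    rw [discrim] at h3
    nlinarith
  obtain ⟨h, hm, hL2, hsum, heq⟩ := exists_logGradient ENNReal.toReal_nonneg hbound
  have hae := ae_isLogGradient hm (fun p => (hL2 p).integrable one_le_two) heq
  have hmeas : Measurable fun Y => ENNReal.ofReal (∑ p, h p Y ^ 2) :=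
    (Finset.measurable_fun_sum _ fun p _ => (hm p).pow_const 2).ennreal_ofReal
  have hG2 : (G : Measure (Config N)) = (circLaw G ⊗ₘ condPos G).map fun p => join p.1 p.2 := by
    rw [circLaw_compProd_condPos, Measure.map_map measurable_join measurable_circ_pos]
    exact Measure.map_id.symm
  calc N * partialFisher G
      ≤ N * ∫⁻ M, (N : ℝ≥0∞)⁻¹ * ∫⁻ X, ENNReal.ofReal (∑ p, h p (join M X) ^ 2) ∂(condPos G M)
          ∂(circLaw G) := by
        refine mul_le_mul_right (lintegral_mono_ae ?_) _
        filter_upwards [hae] with M hM using hM.fisher_le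
    _ = ∫⁻ M, ∫⁻ X, ENNReal.ofReal (∑ p, h p (join M X) ^ 2) ∂(condPos G M) ∂(circLaw G) := by
        rw [lintegral_const_mul' _ _ (ENNReal.inv_ne_top.2 hN0), ← mul_assoc,
          ENNReal.mul_inv_cancel hN0 (ENNReal.natCast_ne_top N), one_mul]
    _ = ∫⁻ Y, ENNReal.ofReal (∑ p, h p Y ^ 2) ∂(G : Measure (Config N)) := by
        conv_rhs => rw [hG2]
        rw [lintegral_map hmeas measurable_join]
        exact (Measure.lintegral_compProd (hmeas.comp measurable_join)).symm
    _ = ENNReal.ofReal (∑ p, ∫ Y, h p Y ^ 2 ∂(G : Measure (Config N))) := by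
        rw [← integral_finsetSum _ fun p _ => (hL2 p).integrable_sq,
          ofReal_integral_eq_lintegral_ofReal (integrable_finsetSum _ fun p _ =>
            (hL2 p).integrable_sq) (Eventually.of_forall fun Y =>
              Finset.sum_nonneg fun p _ => sq_nonneg _)]
    _ ≤ ENNReal.ofReal S.toReal := ENNReal.ofReal_le_ofReal hsum
    _ = S := ENNReal.ofReal_toReal htop

theorem meanFieldDual_partialFisher :
    MeanFieldDual fisherTests (fun _ G => partialFisher G) where
  cont := by
    rintro j _ ⟨Φ, hΦ, rfl⟩
    exact continuous_fisherIntegrand hΦ.contDiff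
  bdd := by
    rintro j _ ⟨Φ, hΦ, rfl⟩
    obtain ⟨C, h1, h2⟩ := hΦ.exists_bound
    exact ⟨_, fisherIntegrand_bound h1 h2⟩
  zero_mem := by
    refine ⟨fun _ _ => 0, ⟨fun _ => contDiff_const, fun _ => HasCompactSupport.zero⟩, ?_⟩
    funext Y
    simp [fisherIntegrand]
  strong _ hj G := natCast_mul_partialFisher_le hj G
  blocks := by
    rintro n j N h _ ⟨Φ, hΦ, rfl⟩ G
    exact ofReal_integral_sum_block_le h hΦ G
  tensor := by
    rintro j _ _ ⟨Φ, hΦ, rfl⟩ g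
    exact ofReal_integral_tensorPower_fisherIntegrand_le hΦ g
  max _ ψ hψ := partialFisher_max ψ hψ

end Vortex

theorem theorem4p1
    (k : ℝ) (hk : 0 < k) (A : ℝ) (hA : 0 < A)
    (r : ProbabilityMeasure ℝ) (hr : (r : Measure ℝ) (Set.Icc (-A) A)ᶜ = 0)
    (G : (N : ℕ) → ProbabilityMeasure (Vortex.Config N))
    (hG : ∀ N, 2 ≤ N → Vortex.IIDCirc r (G N))
    (hmom : (⨆ (N : ℕ) (h : 2 ≤ N),
      Vortex.partialMoment k (Vortex.marginal 1 (one_le_two.trans h) (G N))) < ⊤)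
    (P : (j : ℕ) → ProbabilityMeasure (Vortex.Config j))
    (hP : Vortex.IsCompatible P)
    (hlim : ∀ j, 1 ≤ j →
      Tendsto (fun n : ℕ => Vortex.marginal j (Nat.le_add_left j n) (G (n + j))) atTop
        (𝓝 (P j))) :
    (∀ π : ProbabilityMeasure (ProbabilityMeasure Vortex.State), Vortex.IsMixingMeasure π P →
      (∫⁻ g, Vortex.partialMoment k (Vortex.tensorPower g 1)
          ∂(π : Measure (ProbabilityMeasure Vortex.State)) < ⊤) ∧
      Vortex.extIntegral (π : Measure (ProbabilityMeasure Vortex.State))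
          (fun g => Vortex.partialEntropy (Vortex.tensorPower g 1)) =
        ⨆ (j : ℕ) (_ : 1 ≤ j), Vortex.partialEntropy (P j) ∧
      ∫⁻ g, Vortex.partialFisher (Vortex.tensorPower g 1)
          ∂(π : Measure (ProbabilityMeasure Vortex.State)) =
        ⨆ (j : ℕ) (_ : 1 ≤ j), Vortex.partialFisher (P j)) ∧
    (⨆ (j : ℕ) (_ : 1 ≤ j), Vortex.partialEntropy (P j)) ≤
        liminf (fun N : ℕ => Vortex.partialEntropy (G N)) atTop ∧
    (⨆ (j : ℕ) (_ : 1 ≤ j), Vortex.partialFisher (P j)) ≤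
        liminf (fun N : ℕ => Vortex.partialFisher (G N)) atTop := by
  have hmomN : ∀ (N : ℕ) (h : 2 ≤ N),
      Vortex.partialMoment k (Vortex.marginal 1 (one_le_two.trans h) (G N)) ≤ _ :=
    fun N h => le_iSup₂ (f := fun (N : ℕ) (h : 2 ≤ N) =>
      Vortex.partialMoment k (Vortex.marginal 1 (one_le_two.trans h) (G N))) N h
  have hR : ∀ j, 1 ≤ j →
      Vortex.circLaw (P j) = Measure.pi fun _ : Fin j => (r : Measure ℝ) := fun j hj =>
    Vortex.circLaw_eq_of_tendsto (by
      filter_upwards [eventually_ge_atTop 1] with n hn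
      exact Vortex.circLaw_marginal _ _ (hG (n + j) (by omega)).2) (hlim j hj)
  have hmomP : Vortex.partialMoment k (P 1) < ⊤ := by
    refine lt_of_le_of_lt ?_ hmom
    rw [Vortex.partialMoment_one]
    refine Vortex.lintegral_ofReal_le_of_tendsto (Vortex.continuous_bracket_pos k)
      (fun Y => zero_le_one.trans (Vortex.one_le_bracket_rpow hk _)) (hlim 1 le_rfl) ?_
    filter_upwards [eventually_ge_atTop 1] with n hn
    rw [← Vortex.partialMoment_one]
    exact hmomN (n + 1) (by omega)
  refine ⟨fun π hπ => ⟨?_, hπ.extIntegral_partialEntropy hk hP hR hmomP,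
    Vortex.meanFieldDual_partialFisher.lintegral_eq_iSup hπ⟩,
    Vortex.iSup_partialEntropy_le_liminf hk hG hmom hmomN hP hlim hR hmomP,
    Vortex.meanFieldDual_partialFisher.iSup_le_liminf (fun N hN => (hG N hN).1) hlim⟩
  rw [hπ.lintegral_partialMoment]
  exact hmomP
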